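/- Let $F$ be a $p$-adic field, i.e. a finite extension of $\mathbb{Q}_p$, and let $E/F$ be a quadratic field extension. For $K\in\{F,E\}$ let $|\cdot|_K$ be the normalized absolute value of $K$, let $B(K)\subset \mathrm{GL}_2(K)$ be the subgroup of upper triangular matrices, and for smooth characters $\chi_1,\chi_2\colon K^\times\to\mathbb{C}^\times$ let $I_{B(K)}^{\mathrm{GL}_2(K)}\chi_1\boxtimes\chi_2$ be the normalized smooth induction: the space of functions $f\colon\mathrm{GL}_2(K)\to\mathbb{C}$ that are right invariant under some open subgroup and satisfy $$f\left(\begin{pmatrix} a & x\\ 0 & d\end{pmatrix}g\right)=\chi_1(a)\chi_2(d)\,\left|\tfrac{a}{d}\right|_K^{1/2}f(g)\qquad(a,d\in K^\times,\ x\in K,\ g\in\mathrm{GL}_2(K)),$$ on which $\mathrm{GL}_2(K)$ acts by right translation. Let $\mathrm{St}_F$ be the Steinberg representation of $\mathrm{GL}_2(F)$, i.e. the unique irreducible quotient of $I_{B(F)}^{\mathrm{GL}_2(F)}|\cdot|_F^{-1/2}\boxtimes|\cdot|_F^{1/2}$, which is its quotient by the constant functions. Let $\chi_1,\chi_2$ be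 smooth characters of $E^\times$ such that $\pi=I_{B(E)}^{\mathrm{GL}_2(E)}\chi_1\boxtimes\chi_2$ is an irreducible representation of $\mathrm{GL}_2(E)$. Then $$\dim_{\mathbb{C}}\mathrm{Hom}_{\mathrm{GL}_2(F)}(\mathrm{St}_F,\pi)=1$$ if and only if $\chi_1\neq\chi_2$ and $\chi_1|_{F^\times}=\chi_2|_{F^\times}=1$. In all remaining cases, $\mathrm{Hom}_{\mathrm{GL}_2(F)}(\mathrm{St}_F,\pi)=0$. -/

import Mathlib

open scoped MatrixGroups

/-- The normalized absolute value `|x|_K = |N_{K/ℚ_p}(x)|_p` of a finite extension `K` of `ℚ_p`;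
it takes a uniformizer to the inverse of the cardinality of the residue field. -/
noncomputable def normalizedAbs (p : ℕ) [Fact p.Prime] (K : Type*) [Field K] [Algebra ℚ_[p] K]
    (x : K) : ℝ :=
  ‖Algebra.norm ℚ_[p] x‖

/-- The character `x ↦ |x|_K ^ s` of `Kˣ`, for a real exponent `s`. -/
noncomputable def absPow (p : ℕ) [Fact p.Prime] (K : Type*) [Field K] [Algebra ℚ_[p] K]
    (s : ℝ) : Kˣ →* ℂˣ :=
  MonoidHom.toHomUnits
    { toFun := fun x => ((normalizedAbs p K (x : K) ^ s : ℝ) : ℂ)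
      map_one' := by simp [normalizedAbs]
      map_mul' := fun x y => by
        simp only [normalizedAbs, Units.val_mul, map_mul, norm_mul]
        rw [Real.mul_rpow (norm_nonneg _) (norm_nonneg _), Complex.ofReal_mul] }

/-- A smooth character of `Kˣ`: a homomorphism to `ℂˣ` with open kernel. -/
def IsSmoothChar {K : Type*} [NormedField K] (χ : Kˣ →* ℂˣ) : Prop :=
  IsOpen (χ.ker : Set Kˣ)

/-- The space of the normalized induction `I_{B(K)}^{GL₂(K)} (χ₁ ⊠ χ₂)`: the functions
`f : GL₂(K) → ℂ`, right invariant under some open subgroup, such that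
`f (b g) = χ₁(a) χ₂(d) |a / d|_K ^ (1/2) f (g)` for every upper triangular matrix `b` with
diagonal entries `a`, `d`. -/
noncomputable def principalSeriesSpace (p : ℕ) [Fact p.Prime] (K : Type*) [NormedField K]
    [Algebra ℚ_[p] K] (χ₁ χ₂ : Kˣ →* ℂˣ) : Submodule ℂ (GL (Fin 2) K → ℂ) where
  carrier := {f |
    (∀ (b g : GL (Fin 2) K) (a d : Kˣ), b 1 0 = 0 → b 0 0 = (a : K) → b 1 1 = (d : K) →
      f (b * g) = χ₁ a * χ₂ d * absPow p K (1 / 2) (a / d) * f g) ∧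
    ∃ U : OpenSubgroup (GL (Fin 2) K), ∀ g : GL (Fin 2) K, ∀ u ∈ U, f (g * u) = f g}
  zero_mem' := ⟨fun b g a d _ _ _ => by simp, ⊤, fun g u _ => rfl⟩
  add_mem' := by
    rintro f₁ f₂ ⟨h₁, U₁, hU₁⟩ ⟨h₂, U₂, hU₂⟩
    refine ⟨fun b g a d hb ha hd => ?_, U₁ ⊓ U₂, fun g u hu => ?_⟩
    · simp only [Pi.add_apply, h₁ b g a d hb ha hd, h₂ b g a d hb ha hd, mul_add]
    · simp only [Pi.add_apply, hU₁ g u hu.1, hU₂ g u hu.2]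
  smul_mem' := by
    rintro c f ⟨h, U, hU⟩
    refine ⟨fun b g a d hb ha hd => ?_, U, fun g u hu => ?_⟩
    · simp only [Pi.smul_apply, h b g a d hb ha hd, smul_eq_mul]
      ring
    · simp only [Pi.smul_apply, hU g u hu]

theorem rightTranslate_mem_principalSeriesSpace (p : ℕ) [Fact p.Prime] (K : Type*) [NormedField K]
    [Algebra ℚ_[p] K] (χ₁ χ₂ : Kˣ →* ℂˣ) (x : GL (Fin 2) K) {f : GL (Fin 2) K → ℂ}
    (hf : f ∈ principalSeriesSpace p K χ₁ χ₂) :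
    (fun g => f (g * x)) ∈ principalSeriesSpace p K χ₁ χ₂ := by
  obtain ⟨h, U, hU⟩ := hf
  refine ⟨fun b g a d hb ha hd => ?_,
    U.comap (MulAut.conj x⁻¹).toMonoidHom ?_, fun g u hu => ?_⟩
  · have := h b (g * x) a d hb ha hd
    rwa [← mul_assoc] at this
  · change Continuous fun g => x⁻¹ * g * (x⁻¹)⁻¹
    fun_prop
  · have hu' : x⁻¹ * u * (x⁻¹)⁻¹ ∈ U := hu
    have h₂ := hU (g * x) _ hu'
    rwa [show g * x * (x⁻¹ * u * (x⁻¹)⁻¹) = g * u * x by group] at h₂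

/-- The representation `I_{B(K)}^{GL₂(K)} (χ₁ ⊠ χ₂)`: the action of `GL₂(K)` by right
translation, `(x • f) (g) = f (g x)`. -/
noncomputable def principalSeries (p : ℕ) [Fact p.Prime] (K : Type*) [NormedField K]
    [Algebra ℚ_[p] K] (χ₁ χ₂ : Kˣ →* ℂˣ) :
    Representation ℂ (GL (Fin 2) K) (principalSeriesSpace p K χ₁ χ₂) where
  toFun x :=
    { toFun := fun f => ⟨fun g => f.1 (g * x),
        rightTranslate_mem_principalSeriesSpace p K χ₁ χ₂ x f.2⟩
      map_add' := fun _ _ => rfl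
      map_smul' := fun _ _ => rfl }
  map_one' := by
    ext f g
    simp
  map_mul' x y := by
    ext f g
    simp [mul_assoc]

theorem one_mem_principalSeriesSpace (p : ℕ) [Fact p.Prime] (K : Type*) [NormedField K]
    [Algebra ℚ_[p] K] [FiniteDimensional ℚ_[p] K] :
    (1 : GL (Fin 2) K → ℂ) ∈
      principalSeriesSpace p K (absPow p K (-(1 / 2))) (absPow p K (1 / 2)) := by
  refine ⟨fun b g a d _ _ _ => ?_, ⊤, fun g u _ => rfl⟩
  have h : absPow p K (-(1 / 2)) = (absPow p K (1 / 2))⁻¹ := by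
    ext x
    simp [absPow, normalizedAbs, Real.rpow_neg]
  rw [h, map_div]
  simp only [Pi.one_apply, mul_one, MonoidHom.inv_apply, ← Units.val_mul]
  rw [inv_mul_eq_div, div_mul_div_cancel, div_self']
  simp

/-- The constant functions, a line in `I_{B(K)}^{GL₂(K)} (|·|^(-1/2) ⊠ |·|^(1/2))`. -/
noncomputable def constantFunctions (p : ℕ) [Fact p.Prime] (K : Type*) [NormedField K]
    [Algebra ℚ_[p] K] [FiniteDimensional ℚ_[p] K] :
    Submodule ℂ (principalSeriesSpace p K (absPow p K (-(1 / 2))) (absPow p K (1 / 2))) :=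
  Submodule.span ℂ {⟨1, one_mem_principalSeriesSpace p K⟩}

theorem constantFunctions_le_comap (p : ℕ) [Fact p.Prime] (K : Type*) [NormedField K]
    [Algebra ℚ_[p] K] [FiniteDimensional ℚ_[p] K] (x : GL (Fin 2) K) :
    constantFunctions p K ≤ (constantFunctions p K).comap
      (principalSeries p K (absPow p K (-(1 / 2))) (absPow p K (1 / 2)) x) := by
  refine Submodule.span_le.mpr ?_
  rintro _ rfl
  exact Submodule.subset_span rfl

/-- The Steinberg representation of `GL₂(K)`: the quotient of
`I_{B(K)}^{GL₂(K)} (|·|^(-1/2) ⊠ |·|^(1/2))`, the smooth functions on `B(K) \ GL₂(K)`, by the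
constant functions. It is the unique irreducible quotient of this principal series. -/
noncomputable def steinberg (p : ℕ) [Fact p.Prime] (K : Type*) [NormedField K]
    [Algebra ℚ_[p] K] [FiniteDimensional ℚ_[p] K] :
    Representation ℂ (GL (Fin 2) K)
      (principalSeriesSpace p K (absPow p K (-(1 / 2))) (absPow p K (1 / 2)) ⧸
        constantFunctions p K) :=
  (principalSeries p K (absPow p K (-(1 / 2))) (absPow p K (1 / 2))).quotient
    (constantFunctions p K) (constantFunctions_le_comap p K)

/-- The restriction of a representation of `GL₂(E)` to `GL₂(F)`. -/
noncomputable def restrictGL (F : Type*) {E V : Type*} [Field F] [Field E] [Algebra F E]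
    [AddCommGroup V] [Module ℂ V] (π : Representation ℂ (GL (Fin 2) E) V) :
    Representation ℂ (GL (Fin 2) F) V :=
  π.comp (Matrix.GeneralLinearGroup.map (algebraMap F E))

/-- The restriction to `Fˣ` of a character of `Eˣ`. -/
def restrictChar (F : Type*) {E : Type*} [Field F] [Field E] [Algebra F E] (χ : Eˣ →* ℂˣ) :
    Fˣ →* ℂˣ :=
  χ.comp (Units.map (algebraMap F E : F →* E))

/-! Identify B(E)\GL₂(E) with the projective line over `E` through bottom rows. `GL₂(F)` has two
orbits on it: the closed one, which is the projective line over `F`, and an open dense one through γ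
= [τ : 1], whose stabilizer is the nonsplit torus `Eˣ`. An intertwiner from St_F to π is a map Φ
from the smooth functions on P¹(F) to π that kills the constants. As the elements of π are locally
constant, Φ is determined by the functional l(φ) = Φ(φ)(γ) (`eq_zero_of_evalγ`), and `Eˣ` acts on l
by θ(z) = χ₁(N z / z) χ₂(z) (`equivariant_evalγ`, `torusChar_eq`).

Through the torus, `Eˣ` acts transitively on P¹(F) with stabilizer `Fˣ`, so P¹(F) is the compact
group Eˣ/Fˣ. Hence the θ-equivariant functionals form a line, spanned by integration against θ⁻¹, if
θ, that is χ₁χ₂, is trivial on `Fˣ`; otherwise there are none but 0 (`Equivariant.eq_zero`,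
`exists_equivariant`, `exists_equivariant_eq`). Such a nonzero l kills the constants exactly when θ
≠ 1. If χ₁ and χ₂ are both trivial on `Fˣ`, then θ = χ₂/χ₁ and this condition reads χ₁ ≠ χ₂.

It remains to see which l come from a function that extends smoothly across the closed orbit. Since
θ is locally trivial, l is locally a multiple of the additive Haar measure; if moreover l(1) = 0,
then l(diag(a, 1) φ) = C |a| for small a (`exists_dilation_eq`). Near the closed orbit the function
attached to l and φ behaves like χ₁(a)⁻¹ |a|⁻¹ l(diag(a, 1) φ) with a → 0. For χ₁ trivial on `Fˣ`
this is eventually constant, and the extension exists (`exists_evalγ_eq`). Conversely, smoothness of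
Φ(φ) at the closed orbit makes l of a small ball of radius |a| proportional to χ₂(a)⁻¹ |a|
(`exists_evalγ_flagBall`). Additivity over a partition into smaller balls then forces χ₂ to be
trivial on `Fˣ`, unless l = 0 (`evalγ_eq_zero`). -/

open scoped NNReal

set_option linter.unusedSectionVars false

/-! ### The normalized absolute value as an index of balls. -/

open Filter Topology IntermediateField in
theorem normalizedAbs_eq_norm_pow (p : ℕ) [Fact p.Prime] {K : Type*} [NormedField K]
    [NormedAlgebra ℚ_[p] K] [FiniteDimensional ℚ_[p] K] (x : K) :
    normalizedAbs p K x = ‖x‖ ^ Module.finrank ℚ_[p] K := by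
  have hint : IsIntegral ℚ_[p] x := Algebra.IsIntegral.isIntegral x
  -- The norm of `K` is the spectral norm, so both it and the field norm are read off from the
  -- constant coefficient of the minimal polynomial.
  have h1 : ‖x‖ ^ (minpoly ℚ_[p] x).natDegree = ‖(minpoly ℚ_[p] x).coeff 0‖ := by
    rw [NormedAlgebra.norm_eq_spectralNorm ℚ_[p] x, spectralNorm.spectralNorm_eq_norm_coeff_zero_rpow,
      ← Real.rpow_natCast, ← Real.rpow_mul (norm_nonneg _), one_div_mul_cancel, Real.rpow_one]
    exact_mod_cast (minpoly.natDegree_pos hint).ne'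
  have h2 : Algebra.norm ℚ_[p] (AdjoinSimple.gen ℚ_[p] x) =
      (-1) ^ (minpoly ℚ_[p] x).natDegree * (minpoly ℚ_[p] x).coeff 0 := by
    have := Algebra.PowerBasis.norm_gen_eq_coeff_zero_minpoly (adjoin.powerBasis hint)
    rwa [adjoin.powerBasis_dim, adjoin.powerBasis_gen, minpoly_gen] at this
  rw [normalizedAbs, Algebra.norm_eq_norm_adjoin, h2, norm_pow, norm_mul, norm_pow, norm_neg,
    norm_one, one_pow, one_mul, ← h1, ← pow_mul, ← adjoin.finrank hint,
    Module.finrank_mul_finrank]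

theorem isUltrametricDist_of_padic (p : ℕ) [Fact p.Prime] (K : Type*) [NormedField K]
    [NormedAlgebra ℚ_[p] K] : IsUltrametricDist K := by
  refine IsUltrametricDist.isUltrametricDist_of_forall_norm_natCast_le_one fun n => ?_
  rw [← map_natCast (algebraMap ℚ_[p] K), norm_algebraMap']
  exact IsUltrametricDist.norm_natCast_le_one _ _

/-- The closed ball of radius `r` about `0`, as an additive subgroup. -/
def ballSubgroup (K : Type*) [NormedField K] [IsUltrametricDist K] (r : ℝ≥0) :
    AddSubgroup K where
  carrier := {x | ‖x‖₊ ≤ r}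
  zero_mem' := by simp
  add_mem' {x y} hx hy := (IsUltrametricDist.nnnorm_add_le_max x y).trans (max_le hx hy)
  neg_mem' {x} hx := by simpa using hx

theorem mem_ballSubgroup {K : Type*} [NormedField K] [IsUltrametricDist K] {r : ℝ≥0} {x : K} :
    x ∈ ballSubgroup K r ↔ ‖x‖₊ ≤ r := Iff.rfl

theorem ballSubgroup_map {K : Type*} [NormedField K] [IsUltrametricDist K] (r : ℝ≥0)
    {a : K} (ha : a ≠ 0) :
    (ballSubgroup K r).map (AddMonoidHom.mulLeft a) = ballSubgroup K (‖a‖₊ * r) := by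
  ext x
  constructor
  · rintro ⟨y, hy, rfl⟩
    change ‖a * y‖₊ ≤ _
    rw [nnnorm_mul]
    exact mul_le_mul_right hy _
  · intro (hx : ‖x‖₊ ≤ _)
    refine ⟨a⁻¹ * x, ?_, by simp [ha]⟩
    change ‖a⁻¹ * x‖₊ ≤ r
    rw [nnnorm_mul, nnnorm_inv, inv_mul_le_iff₀ (nnnorm_pos.2 ha)]
    exact hx

theorem mulLeft_injective {K : Type*} [Field K] {a : K} (ha : a ≠ 0) :
    Function.Injective (AddMonoidHom.mulLeft a) := fun _ _ h => mul_left_cancel₀ ha h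

theorem ballSubgroup_mono {K : Type*} [NormedField K] [IsUltrametricDist K] {r s : ℝ≥0}
    (h : r ≤ s) : ballSubgroup K r ≤ ballSubgroup K s :=
  fun _ hx => le_trans hx h

/-- The subgroup `ℤ_pⁿ` of `ℚ_pⁿ` has index `pⁿ` over its multiple by `p`. -/
theorem exists_lattice_relIndex (p : ℕ) [Fact p.Prime] (n : ℕ) :
    ∃ L : AddSubgroup (Fin n → ℚ_[p]), (L : Set (Fin n → ℚ_[p])) = Metric.closedBall 0 1 ∧
      (L.map (DistribSMul.toAddMonoidHom (Fin n → ℚ_[p]) (p : ℚ_[p]))).relIndex L = p ^ n := by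
  let i : (Fin n → ℤ_[p]) →+ (Fin n → ℚ_[p]) :=
    { toFun := fun v k => (v k : ℚ_[p])
      map_zero' := by ext; simp
      map_add' := fun _ _ => by ext; simp }
  have hi : Function.Injective i := fun v w h => by
    funext k
    exact Subtype.ext (congrFun h k)
  let q : (Fin n → ℤ_[p]) →+ (Fin n → ZMod p) :=
    { toFun := fun v k => PadicInt.toZMod (v k)
      map_zero' := by ext; simp
      map_add' := fun _ _ => by ext; simp }
  have hq : Function.Surjective q := fun v =>
    ⟨fun k => (ZMod.ringHom_surjective (PadicInt.toZMod (p := p)) (v k)).choose, by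
      ext k
      exact (ZMod.ringHom_surjective (PadicInt.toZMod (p := p)) (v k)).choose_spec⟩
  refine ⟨i.range, ?_, ?_⟩
  · ext v
    simp only [SetLike.mem_coe, AddMonoidHom.mem_range, mem_closedBall_zero_iff]
    rw [pi_norm_le_iff_of_nonneg zero_le_one]
    exact ⟨by rintro ⟨w, rfl⟩ k; exact (w k).2, fun h => ⟨fun k => ⟨v k, h k⟩, rfl⟩⟩
  · have h1 : i.range.map (DistribSMul.toAddMonoidHom (Fin n → ℚ_[p]) (p : ℚ_[p])) =
        q.ker.map i := by
      ext v
      constructor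
      · rintro ⟨_, ⟨w, rfl⟩, rfl⟩
        refine ⟨fun k => p * w k, ?_, ?_⟩
        · change q _ = 0
          ext k
          simp [q]
        · ext k
          simp [i]
      · rintro ⟨w, hw, rfl⟩
        have : ∀ k, ∃ y : ℤ_[p], w k = p * y := fun k => by
          have hk : w k ∈ RingHom.ker (PadicInt.toZMod (p := p)) := congrFun hw k
          rw [PadicInt.ker_toZMod, PadicInt.maximalIdeal_eq_span_p,
            Ideal.mem_span_singleton] at hk
          exact hk
        choose y hy using this
        refine ⟨i y, ⟨y, rfl⟩, ?_⟩
        ext k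
        simp [i, hy]
    rw [h1, AddMonoidHom.range_eq_map, AddSubgroup.relIndex_map_map_of_injective _ _ hi,
      AddSubgroup.relIndex_top_right, AddSubgroup.index_ker,
      AddMonoidHom.range_eq_top.2 hq, Nat.card_congr AddSubgroup.topEquiv.toEquiv]
    simp

open Filter Topology in
theorem exists_small_ne_zero {p : ℕ} [Fact p.Prime] (K : Type*) [NormedField K]
    [NormedAlgebra ℚ_[p] K] {ε : ℝ} (hε : 0 < ε) : ∃ a : K, a ≠ 0 ∧ ‖a‖ ≤ ε := by
  obtain ⟨a, ha, h⟩ := NormedField.exists_norm_lt ℚ_[p] hε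
  exact ⟨algebraMap ℚ_[p] K a, by simpa using ha, by rw [norm_algebraMap']; exact h.le⟩

/-- Open subgroups of compact subgroups have finite index. -/
theorem relIndex_ne_zero_of_isCompact {A : Type*} [AddCommGroup A] [TopologicalSpace A]
    [IsTopologicalAddGroup A] {H L : AddSubgroup A} (hL : IsCompact (L : Set A))
    (hH : IsOpen (H : Set A)) : H.relIndex L ≠ 0 := by
  have : CompactSpace L := isCompact_iff_compactSpace.1 hL
  have : IsOpen ((H.addSubgroupOf L : AddSubgroup L) : Set L) := hH.preimage continuous_subtype_val
  have := AddSubgroup.quotient_finite_of_isOpen _ this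
  exact (AddSubgroup.finiteIndex_of_finite_quotient (H := H.addSubgroupOf L)).index_ne_zero

/-- The index [L : pL] is the same for all compact open subgroups: choose C = cB inside a lattice L
and compute [L : pC] both as [L : pL] [pL : pC] and as [L : C] [C : pC]. Multiplication by p gives
[pL : pC] = [L : C], which is finite and cancels; multiplication by c gives [C : pC] = [B : pB]. -/
theorem relIndex_ballSubgroup_p (p : ℕ) [Fact p.Prime] (K : Type*) [NormedField K]
    [NormedAlgebra ℚ_[p] K] [FiniteDimensional ℚ_[p] K] [IsUltrametricDist K] :
    (ballSubgroup K ‖(p : K)‖₊).relIndex (ballSubgroup K 1) =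
      p ^ Module.finrank ℚ_[p] K := by
  obtain ⟨L₀, hL₀, hidx₀⟩ := exists_lattice_relIndex p (Module.finrank ℚ_[p] K)
  have hp0 : (p : K) ≠ 0 := by
    rw [← map_natCast (algebraMap ℚ_[p] K)]
    rw [Ne, map_eq_zero]
    exact_mod_cast (Fact.out : p.Prime).ne_zero
  let e : (Fin (Module.finrank ℚ_[p] K) → ℚ_[p]) ≃L[ℚ_[p]] K :=
    (Module.finBasis ℚ_[p] K).equivFunL.symm
  let m := AddMonoidHom.mulLeft (p : K)
  have hpe : ∀ v, (p : K) * e v = e ((p : ℚ_[p]) • v) := fun v => by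
    rw [map_smul, Algebra.smul_def, map_natCast]
  have hm := mulLeft_injective hp0
  set L : AddSubgroup K := L₀.map (e : _ →+ K) with hL
  have hLc : IsCompact (L : Set K) := by
    have : (L : Set K) = e '' (Metric.closedBall 0 1) := by rw [← hL₀]; rfl
    rw [this]
    exact (isCompact_closedBall _ _).image e.continuous
  have hLo : (L : Set K) ∈ nhds 0 := by
    have : (L : Set K) = e.symm ⁻¹' (Metric.closedBall 0 1) := by
      rw [← hL₀]
      ext x
      constructor
      · rintro ⟨y, hy, rfl⟩
        simpa using hy
      · intro hx
        exact ⟨e.symm x, hx, by simp⟩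
    rw [this]
    refine e.symm.continuous.continuousAt.preimage_mem_nhds ?_
    rw [map_zero]
    exact Metric.closedBall_mem_nhds _ one_pos
  have hidx : (L.map m).relIndex L = p ^ Module.finrank ℚ_[p] K := by
    rw [← hidx₀, ← AddSubgroup.relIndex_map_map_of_injective _ L₀
      (f := (e : _ →+ K)) e.injective, ← hL, hL, AddSubgroup.map_map, AddSubgroup.map_map]
    congr 2
    refine AddMonoidHom.ext fun v => hpe v
  obtain ⟨ε, hε, hεL⟩ := Metric.mem_nhds_iff.1 hLo
  obtain ⟨c, hc, hcε⟩ := exists_small_ne_zero (p := p) K (half_pos hε)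
  set B := ballSubgroup K 1
  have hcB : B.map (AddMonoidHom.mulLeft c) ≤ L := by
    rw [ballSubgroup_map _ hc]
    intro x (hx : ‖x‖₊ ≤ _)
    rw [mul_one, ← NNReal.coe_le_coe, coe_nnnorm, coe_nnnorm] at hx
    refine hεL ?_
    rw [mem_ball_zero_iff]
    linarith
  set C := B.map (AddMonoidHom.mulLeft c) with hC
  have hCo : IsOpen (C : Set K) := by
    refine AddSubgroup.isOpen_of_mem_nhds _ (g := 0) ?_
    rw [hC, ballSubgroup_map _ hc, mul_one]
    refine Filter.mem_of_superset (Metric.closedBall_mem_nhds _ (norm_pos_iff.2 hc)) fun x hx => ?_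
    rw [SetLike.mem_coe, mem_ballSubgroup, ← NNReal.coe_le_coe]
    simpa using hx
  have hpB : B.map m = ballSubgroup K ‖(p : K)‖₊ := by
    rw [ballSubgroup_map _ hp0]
    simp
  have hple : ‖(p : K)‖ ≤ 1 := IsUltrametricDist.norm_natCast_le_one K p
  have hmC : C.map m = (B.map m).map (AddMonoidHom.mulLeft c) := by
    rw [hC, AddSubgroup.map_map, AddSubgroup.map_map]
    congr 1
    ext x
    simp [m, mul_left_comm]
  have h1 := AddSubgroup.relIndex_mul_relIndex (C.map m) (L.map m) L (AddSubgroup.map_mono hcB) (by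
    rw [hL, AddSubgroup.map_map]
    rintro _ ⟨y, hy, rfl⟩
    refine ⟨(p : ℚ_[p]) • y, ?_, (hpe y).symm⟩
    rw [hL₀, mem_closedBall_zero_iff] at hy ⊢
    rw [norm_smul]
    exact mul_le_one₀ (IsUltrametricDist.norm_natCast_le_one _ _) (norm_nonneg _) hy)
  have h2 := AddSubgroup.relIndex_mul_relIndex (C.map m) C L (by
    rw [hmC]
    refine AddSubgroup.map_mono ?_
    rw [hpB]
    exact ballSubgroup_mono hple) hcB
  rw [AddSubgroup.relIndex_map_map_of_injective _ _ hm, hidx] at h1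
  rw [← h1, hmC, hC, AddSubgroup.relIndex_map_map_of_injective _ _ (mulLeft_injective hc), ← hC,
    mul_comm] at h2
  rw [← hpB]
  exact Nat.eq_of_mul_eq_mul_left (Nat.pos_of_ne_zero (relIndex_ne_zero_of_isCompact hLc hCo)) h2

theorem relIndex_ballSubgroup_mul (K : Type*) [NormedField K] [IsUltrametricDist K] (r s : ℝ≥0)
    {a : K} (ha : a ≠ 0) : (ballSubgroup K (‖a‖₊ * r)).relIndex (ballSubgroup K (‖a‖₊ * s)) =
      (ballSubgroup K r).relIndex (ballSubgroup K s) := by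
  rw [← ballSubgroup_map _ ha, ← ballSubgroup_map _ ha,
    AddSubgroup.relIndex_map_map_of_injective _ _ (mulLeft_injective ha)]

theorem relIndex_ballSubgroup_pow (K : Type*) [NormedField K] [IsUltrametricDist K]
    {a : K} (ha : a ≠ 0) (h : ‖a‖₊ ≤ 1) (k : ℕ) :
    (ballSubgroup K (‖a‖₊ ^ k)).relIndex (ballSubgroup K 1) =
      (ballSubgroup K ‖a‖₊).relIndex (ballSubgroup K 1) ^ k := by
  induction k with
  | zero => simp
  | succ k ih =>
    rw [← AddSubgroup.relIndex_mul_relIndex (ballSubgroup K (‖a‖₊ ^ (k + 1)))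
      (ballSubgroup K (‖a‖₊ ^ k)) (ballSubgroup K 1)
      (ballSubgroup_mono (pow_le_pow_of_le_one zero_le h (Nat.le_succ k)))
      (ballSubgroup_mono (pow_le_one₀ zero_le h)), ih, pow_succ (_ : ℕ), mul_comm]
    congr 1
    have := relIndex_ballSubgroup_mul K ‖a‖₊ 1 (pow_ne_zero k ha)
    rwa [nnnorm_pow, mul_one, ← pow_succ] at this

/-- The normalized absolute value measures the index of balls. -/
theorem relIndex_ballSubgroup (p : ℕ) [Fact p.Prime] (K : Type*) [NormedField K]
    [NormedAlgebra ℚ_[p] K] [FiniteDimensional ℚ_[p] K] [IsUltrametricDist K]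
    {a b : K} (ha : a ≠ 0) (hb : b ≠ 0) (h : ‖b‖₊ ≤ ‖a‖₊) :
    ((ballSubgroup K ‖b‖₊).relIndex (ballSubgroup K ‖a‖₊) : ℝ) * normalizedAbs p K b =
      normalizedAbs p K a := by
  obtain ⟨c, rfl⟩ : ∃ c, b = a * c := ⟨b / a, by field_simp⟩
  have hc : c ≠ 0 := right_ne_zero_of_mul hb
  have hc1 : ‖c‖₊ ≤ 1 := by
    rw [nnnorm_mul] at h
    exact (mul_le_iff_le_one_right (nnnorm_pos.2 ha)).1 h
  have hi := relIndex_ballSubgroup_mul K ‖c‖₊ 1 ha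
  rw [mul_one, ← nnnorm_mul] at hi
  have hn : normalizedAbs p K (a * c) = normalizedAbs p K a * normalizedAbs p K c := by
    simp [normalizedAbs]
  rw [hi, hn, mul_left_comm]
  suffices ((ballSubgroup K ‖c‖₊).relIndex (ballSubgroup K 1) : ℝ) * normalizedAbs p K c = 1 by
    rw [this, mul_one]
  set n := Module.finrank ℚ_[p] K
  have hn0 : n ≠ 0 := Module.finrank_pos.ne'
  have hpp : (0 : ℝ) < p := by exact_mod_cast (Fact.out : p.Prime).pos
  -- The p-adic valuation of the norm of c is an integer k ≥ 0. Consequently c ^ n and p ^ k have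
  -- equal norm in `K` and define the same ball, so the n-th power of the index for c is (p ^ n) ^
  -- k.
  obtain ⟨k, hk⟩ : ∃ k : ℕ, normalizedAbs p K c = (p : ℝ) ^ (-(k : ℤ)) := by
    have h0 : Algebra.norm ℚ_[p] c ≠ 0 := by rwa [Algebra.norm_ne_zero_iff]
    obtain ⟨m, hm⟩ := Padic.padicNormE.image h0
    have hm' : normalizedAbs p K c = (p : ℝ) ^ (-m) := by
      rw [normalizedAbs, hm]
      simp
    have hle : normalizedAbs p K c ≤ 1 := by
      rw [normalizedAbs_eq_norm_pow]
      exact pow_le_one₀ (norm_nonneg _) hc1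
    have : 0 ≤ m := by
      by_contra! hlt
      rw [hm'] at hle
      exact absurd hle (not_le.2 (one_lt_zpow₀ (by exact_mod_cast (Fact.out : p.Prime).one_lt)
        (by omega)))
    lift m to ℕ using this
    exact ⟨m, hm'⟩
  have hpK : (p : K) ≠ 0 := by
    rw [← map_natCast (algebraMap ℚ_[p] K), Ne, map_eq_zero]
    exact_mod_cast (Fact.out : p.Prime).ne_zero
  have hpn : ‖(p : K)‖₊ ^ k = ‖c‖₊ ^ n := by
    rw [← NNReal.coe_inj]
    push_cast
    rw [← normalizedAbs_eq_norm_pow, hk, ← map_natCast (algebraMap ℚ_[p] K), norm_algebraMap',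
      Padic.norm_p]
    simp
  have h1 := relIndex_ballSubgroup_pow K hc hc1 n
  have h2 := relIndex_ballSubgroup_pow K hpK (IsUltrametricDist.norm_natCast_le_one K p) k
  rw [hpn, h1, relIndex_ballSubgroup_p, ← pow_mul, mul_comm n k, pow_mul] at h2
  rw [Nat.pow_left_injective hn0 h2, hk]
  push_cast
  rw [← zpow_natCast, ← zpow_add₀ hpp.ne']
  simp

/-- `s` is a set of representatives of the closed ball of radius `R` modulo that of radius `r`. -/
def IsBallReps {K : Type*} [NormedField K] (s : Finset K) (R r : ℝ) : Prop :=
  (∀ x ∈ s, ‖x‖ ≤ R) ∧ ∀ y, ‖y‖ ≤ R → ∃! x, x ∈ s ∧ ‖y - x‖ ≤ r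

theorem IsBallReps.card_eq {K : Type*} [NormedField K] [IsUltrametricDist K] {s : Finset K}
    {R r : ℝ≥0} (h : IsBallReps s R r) :
    s.card = (ballSubgroup K r).relIndex (ballSubgroup K R) := by
  rw [AddSubgroup.relIndex, AddSubgroup.index, ← Nat.card_eq_finsetCard]
  refine Nat.card_congr (Equiv.ofBijective
    (fun x : s => QuotientAddGroup.mk (⟨x, h.1 x x.2⟩ : ballSubgroup K R)) ⟨?_, ?_⟩)
  · intro x y hxy
    have h1 := QuotientAddGroup.eq.1 hxy
    have h2 : ‖-(x : K) + y‖ ≤ r := h1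
    rw [neg_add_eq_sub] at h2
    exact Subtype.ext ((h.2 y (h.1 y y.2)).unique ⟨x.2, h2⟩ ⟨y.2, by simp⟩)
  · intro q
    induction q using QuotientAddGroup.induction_on with
    | H y =>
      obtain ⟨x, ⟨hx, hxy⟩, -⟩ := h.2 y y.2
      refine ⟨⟨x, hx⟩, QuotientAddGroup.eq.2 ?_⟩
      change ‖-x + y‖ ≤ r
      rwa [neg_add_eq_sub]

theorem IsBallReps.card_mul (p : ℕ) [Fact p.Prime] {K : Type*} [NormedField K]
    [NormedAlgebra ℚ_[p] K] [FiniteDimensional ℚ_[p] K] {s : Finset K}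
    {a b : K} (ha : a ≠ 0) (hb : b ≠ 0) (hba : ‖b‖ ≤ ‖a‖) (h : IsBallReps s ‖a‖ ‖b‖) :
    (s.card : ℝ) * normalizedAbs p K b = normalizedAbs p K a := by
  have := isUltrametricDist_of_padic p K
  rw [IsBallReps.card_eq (R := ‖a‖₊) (r := ‖b‖₊) h]
  exact relIndex_ballSubgroup p K ha hb hba

theorem exists_isBallReps (p : ℕ) [Fact p.Prime] (K : Type*) [NormedField K]
    [NormedAlgebra ℚ_[p] K] [FiniteDimensional ℚ_[p] K] (R : ℝ) {r : ℝ} (hr : 0 < r) :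
    ∃ s : Finset K, IsBallReps s R r := by
  classical
  have := isUltrametricDist_of_padic p K
  have : ProperSpace K := FiniteDimensional.proper ℚ_[p] K
  rcases lt_or_ge R 0 with hR | hR
  · exact ⟨∅, by simp, fun y hy => absurd (norm_nonneg y) (by linarith)⟩
  lift R to ℝ≥0 using hR
  lift r to ℝ≥0 using hr.le
  set B := ballSubgroup K R
  set C := (ballSubgroup K r).addSubgroupOf B
  have hfin : (ballSubgroup K r).relIndex B ≠ 0 := by
    refine relIndex_ne_zero_of_isCompact ?_ (AddSubgroup.isOpen_of_mem_nhds _ (g := 0) ?_)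
    · convert! isCompact_closedBall (0 : K) R using 1
      ext x
      rw [mem_closedBall_zero_iff]
      rfl
    · refine Filter.mem_of_superset (Metric.closedBall_mem_nhds _ hr) fun x hx => ?_
      rw [mem_closedBall_zero_iff] at hx
      exact hx
  have : Finite (B ⧸ C) := 
    have : C.FiniteIndex := ⟨hfin⟩
    AddSubgroup.finite_quotient_of_finiteIndex
  have := Fintype.ofFinite (B ⧸ C)
  have key : ∀ x y : B, (x : B ⧸ C) = y ↔ ‖(y : K) - x‖ ≤ r := fun x y => by
    rw [QuotientAddGroup.eq, ← neg_add_eq_sub]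
    rfl
  refine ⟨Finset.univ.image fun q : B ⧸ C => ((q.out : B) : K), ?_, ?_⟩
  · intro x hx
    obtain ⟨q, -, rfl⟩ := Finset.mem_image.1 hx
    exact q.out.2
  · intro y hy
    refine ⟨((QuotientAddGroup.mk ⟨y, hy⟩ : B ⧸ C).out : B), ⟨Finset.mem_image.2
      ⟨_, Finset.mem_univ _, rfl⟩, ?_⟩, ?_⟩
    · exact (key _ ⟨y, hy⟩).1 (QuotientAddGroup.out_eq' _)
    · rintro x ⟨hx, hxy⟩
      obtain ⟨q, -, rfl⟩ := Finset.mem_image.1 hx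
      rw [← (key q.out ⟨y, hy⟩).2 hxy]
      rw [QuotientAddGroup.out_eq']

/-! ### Matrices and their bottom rows. -/

section GL2

/-- The invertible matrix with the given entries. -/
noncomputable def mkGL {K : Type*} [Field K] (a b c d : K) (h : a * d - b * c ≠ 0) :
    GL (Fin 2) K :=
  Matrix.GeneralLinearGroup.mkOfDetNeZero !![a, b; c, d] (by rwa [Matrix.det_fin_two_of])

variable {K : Type*} [Field K]

theorem gl_mul_apply (g h : GL (Fin 2) K) (i j : Fin 2) :
    (g * h) i j = g i 0 * h 0 j + g i 1 * h 1 j := by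
  rw [Units.val_mul, Matrix.mul_apply, Fin.sum_univ_two]

theorem gl_ext {g h : GL (Fin 2) K} (h00 : g 0 0 = h 0 0) (h01 : g 0 1 = h 0 1)
    (h10 : g 1 0 = h 1 0) (h11 : g 1 1 = h 1 1) : g = h := by
  ext i j
  fin_cases i <;> fin_cases j <;> assumption

theorem gl_det_eq (g : GL (Fin 2) K) : g.det.val = g 0 0 * g 1 1 - g 0 1 * g 1 0 := by
  rw [Matrix.GeneralLinearGroup.val_det_apply, Matrix.det_fin_two]

theorem gl_row_ne_zero (g : GL (Fin 2) K) (h : g 1 1 = 0) : g 1 0 ≠ 0 := fun h' => by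
  have := g.det.ne_zero
  rw [gl_det_eq] at this
  simp [h, h'] at this

/-- The lower unipotent matrix with entry `x`. -/
noncomputable def lowerGL (x : K) : GL (Fin 2) K := mkGL 1 0 x 1 (by simp)

/-- The diagonal matrix with entries `a`, `d`. -/
noncomputable def diagGL (a d : Kˣ) : GL (Fin 2) K := mkGL a 0 0 d (by simp)

/-- The matrix that swaps the two coordinates. -/
noncomputable def swapGL (K : Type*) [Field K] : GL (Fin 2) K := mkGL 0 1 1 0 (by simp)

@[simp] theorem lowerGL_00 (x : K) : lowerGL x 0 0 = 1 := rfl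
@[simp] theorem lowerGL_01 (x : K) : lowerGL x 0 1 = 0 := rfl
@[simp] theorem lowerGL_10 (x : K) : lowerGL x 1 0 = x := rfl
@[simp] theorem lowerGL_11 (x : K) : lowerGL x 1 1 = 1 := rfl
@[simp] theorem diagGL_00 (a d : Kˣ) : diagGL a d 0 0 = a := rfl
@[simp] theorem diagGL_01 (a d : Kˣ) : diagGL a d 0 1 = 0 := rfl
@[simp] theorem diagGL_10 (a d : Kˣ) : diagGL a d 1 0 = 0 := rfl
@[simp] theorem diagGL_11 (a d : Kˣ) : diagGL a d 1 1 = d := rfl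
@[simp] theorem swapGL_00 : swapGL K 0 0 = 0 := rfl
@[simp] theorem swapGL_01 : swapGL K 0 1 = 1 := rfl
@[simp] theorem swapGL_10 : swapGL K 1 0 = 1 := rfl
@[simp] theorem swapGL_11 : swapGL K 1 1 = 0 := rfl

theorem lowerGL_add (x y : K) : lowerGL (x + y) = lowerGL x * lowerGL y := by
  apply gl_ext <;> simp [gl_mul_apply]

theorem lowerGL_zero : lowerGL (0 : K) = 1 := by
  apply gl_ext <;> simp

theorem lowerGL_det (x : K) : (lowerGL x).det = 1 := by
  ext
  rw [gl_det_eq]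
  simp

theorem swapGL_det : (swapGL K).det = -1 := by
  ext
  rw [gl_det_eq]
  simp

theorem diagGL_det (a d : Kˣ) : (diagGL a d).det = a * d := by
  ext
  rw [gl_det_eq]
  simp

/-- Two matrices with proportional bottom rows differ by an upper triangular matrix. -/
theorem exists_upper_mul {h h' : GL (Fin 2) K} {d : Kˣ} (h0 : h 1 0 = d * h' 1 0)
    (h1 : h 1 1 = d * h' 1 1) :
    ∃ b : GL (Fin 2) K, h = b * h' ∧ b 1 0 = 0 ∧ b 0 0 = (h.det * h'.det⁻¹ * d⁻¹ : Kˣ) ∧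
      b 1 1 = d := by
  obtain ⟨b, hbdef⟩ : ∃ b, b = h * h'⁻¹ := ⟨_, rfl⟩
  have hb : h = b * h' := by rw [hbdef]; group
  have hdet' := h'.det.ne_zero
  rw [gl_det_eq] at hdet'
  have e0 : h 1 0 = b 1 0 * h' 0 0 + b 1 1 * h' 1 0 := by
    conv_lhs => rw [hb]
    rw [gl_mul_apply]
  have e1 : h 1 1 = b 1 0 * h' 0 1 + b 1 1 * h' 1 1 := by
    conv_lhs => rw [hb]
    rw [gl_mul_apply]
  have b10 : b 1 0 = 0 := by
    have : b 1 0 * (h' 0 0 * h' 1 1 - h' 0 1 * h' 1 0) = 0 := by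
      linear_combination (-h' 1 1) * e0 + h' 1 0 * e1 + h' 1 1 * h0 - h' 1 0 * h1
    exact (mul_eq_zero.1 this).resolve_right hdet'
  have b11 : b 1 1 = d := by
    have : (b 1 1 - d) * (h' 0 0 * h' 1 1 - h' 0 1 * h' 1 0) = 0 := by
      linear_combination (h' 0 1) * e0 - h' 0 0 * e1 - h' 0 1 * h0 + h' 0 0 * h1
    exact sub_eq_zero.1 ((mul_eq_zero.1 this).resolve_right hdet')
  refine ⟨b, hb, b10, ?_, b11⟩
  have hd : b.det = h.det * h'.det⁻¹ := by rw [hbdef, map_mul, map_inv]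
  rw [← hd, Units.val_mul, gl_det_eq, b10, b11, mul_zero, sub_zero, Units.mul_inv_cancel_right]

end GL2

/-! ### The topology of `GL₂`. -/

section Topology

open Filter Topology

variable {K : Type*} [NormedField K]

/-- The topology on units also involves the inverse, but the inverse is the adjugate divided by the
determinant, hence continuous in the entries. -/
theorem tendsto_gl {X : Type*} {l : Filter X} {f : X → GL (Fin 2) K} {g : GL (Fin 2) K}
    (h : ∀ i j, Tendsto (fun x => f x i j) l (𝓝 (g i j))) : Tendsto f l (𝓝 g) := by
  rw [Units.isInducing_embedProduct.tendsto_nhds_iff]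
  have h1 : Tendsto (fun x => (f x).val) l (𝓝 g.val) :=
    tendsto_pi_nhds.2 fun i => tendsto_pi_nhds.2 fun j => h i j
  refine Tendsto.prodMk_nhds h1 ((MulOpposite.continuous_op.tendsto _).comp ?_)
  have hinv : ∀ k : GL (Fin 2) K, (k⁻¹).val = (k.val.det)⁻¹ • k.val.adjugate := fun k => by
    rw [Matrix.coe_units_inv, Matrix.inv_def, Ring.inverse_eq_inv]
  simp only [hinv]
  have hdet : Continuous fun M : Matrix (Fin 2) (Fin 2) K => M.det := by fun_prop
  have hadj : Continuous fun M : Matrix (Fin 2) (Fin 2) K => M.adjugate := by fun_prop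
  refine Tendsto.smul (((hdet.tendsto _).comp h1).inv₀ ?_) ((hadj.tendsto _).comp h1)
  exact g.det.ne_zero

theorem continuous_gl_apply (i j : Fin 2) : Continuous fun g : GL (Fin 2) K => g i j := by
  fun_prop

theorem continuous_lowerGL : Continuous (lowerGL : K → GL (Fin 2) K) := by
  refine continuous_iff_continuousAt.2 fun x => tendsto_gl fun i j => ?_
  fin_cases i <;> fin_cases j
  · exact tendsto_const_nhds
  · exact tendsto_const_nhds
  · exact tendsto_id
  · exact tendsto_const_nhds

/-- The matrices that fix `f` under right translation form a subgroup, which is open once it is a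
neighbourhood of 1. -/
theorem exists_openSubgroup_iff (f : GL (Fin 2) K → ℂ) :
    (∃ U : OpenSubgroup (GL (Fin 2) K), ∀ g : GL (Fin 2) K, ∀ u ∈ U, f (g * u) = f g) ↔
      ∀ᶠ u in 𝓝 (1 : GL (Fin 2) K), ∀ g, f (g * u) = f g := by
  constructor
  · rintro ⟨U, hU⟩
    filter_upwards [U.mem_nhds_one] with u hu g using hU g u hu
  · intro h
    let S : Subgroup (GL (Fin 2) K) :=
      { carrier := {u | ∀ g, f (g * u) = f g}
        one_mem' := fun g => by rw [mul_one]
        mul_mem' := fun {u v} hu hv g => by rw [← mul_assoc, hv, hu]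
        inv_mem' := fun {u} hu g => by rw [← hu, inv_mul_cancel_right] }
    exact ⟨⟨S, S.isOpen_of_mem_nhds h⟩, fun g u hu => hu g⟩

end Topology

/-! ### The inducing character. -/

section Characters

open Filter Topology

variable (p : ℕ) [Fact p.Prime] {K : Type*} [NormedField K]

/-- The character by which the torus acts in the normalized induction. -/
noncomputable def borelChar [Algebra ℚ_[p] K] (χ₁ χ₂ : Kˣ →* ℂˣ) (a d : Kˣ) : ℂˣ :=
  χ₁ a * χ₂ d * absPow p K (1 / 2) (a / d)

theorem borelChar_mul [Algebra ℚ_[p] K] (χ₁ χ₂ : Kˣ →* ℂˣ) (a d a' d' : Kˣ) :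
    borelChar p χ₁ χ₂ (a * a') (d * d') = borelChar p χ₁ χ₂ a d * borelChar p χ₁ χ₂ a' d' := by
  simp only [borelChar, map_mul, map_div]
  simp only [div_eq_mul_inv, mul_inv]
  ac_rfl

theorem absPow_apply [Algebra ℚ_[p] K] (s : ℝ) (x : Kˣ) :
    (absPow p K s x : ℂ) = ((normalizedAbs p K (x : K) ^ s : ℝ) : ℂ) := rfl

theorem normalizedAbs_pos [Algebra ℚ_[p] K] [FiniteDimensional ℚ_[p] K] (x : Kˣ) :
    0 < normalizedAbs p K (x : K) := by
  rw [normalizedAbs, norm_pos_iff, Algebra.norm_ne_zero_iff]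
  exact x.ne_zero

theorem normalizedAbs_mul [Algebra ℚ_[p] K] (x y : K) :
    normalizedAbs p K (x * y) = normalizedAbs p K x * normalizedAbs p K y := by
  simp [normalizedAbs]

theorem borelChar_flag [Algebra ℚ_[p] K] [FiniteDimensional ℚ_[p] K] (a d : Kˣ) :
    borelChar p (absPow p K (-(1 / 2))) (absPow p K (1 / 2)) a d = 1 := by
  have h : absPow p K (-(1 / 2)) = (absPow p K (1 / 2))⁻¹ := by
    ext x
    simp [absPow, normalizedAbs, Real.rpow_neg]
  rw [borelChar, h, map_div, MonoidHom.inv_apply, inv_mul_eq_div, div_mul_div_cancel, div_self']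

theorem IsSmoothChar.eventually_eq_one {χ : Kˣ →* ℂˣ} (h : IsSmoothChar χ) :
    ∀ᶠ x in 𝓝 (1 : Kˣ), χ x = 1 :=
  h.mem_nhds (one_mem χ.ker)

variable [NormedAlgebra ℚ_[p] K] [FiniteDimensional ℚ_[p] K]

/-- By the ultrametric inequality the whole ball |x - 1| < 1 has norm 1. -/
theorem isSmoothChar_absPow (s : ℝ) : IsSmoothChar (absPow p K s) := by
  have := isUltrametricDist_of_padic p K
  refine Subgroup.isOpen_of_mem_nhds _ (g := 1) ?_
  have h1 : ∀ᶠ x : Kˣ in 𝓝 1, ‖(x : K) - 1‖ < 1 := by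
    have : Tendsto (fun x : Kˣ => ‖(x : K) - 1‖) (𝓝 1) (𝓝 ‖((1 : Kˣ) : K) - 1‖) :=
      ((Units.continuous_val.sub continuous_const).norm).tendsto _
    rw [Units.val_one, sub_self, norm_zero] at this
    exact this.eventually_lt_const one_pos
  filter_upwards [h1] with x hx
  have hx1 : ‖(x : K)‖ = 1 := by
    have := IsUltrametricDist.norm_add_eq_max_of_norm_ne_norm (x := (x : K) - 1) (y := 1)
      (by rw [norm_one]; exact hx.ne)
    rwa [sub_add_cancel, norm_one, max_eq_right hx.le] at this
  change absPow p K s x = 1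
  ext
  rw [absPow_apply, normalizedAbs_eq_norm_pow, hx1]
  simp

theorem eventually_borelChar {χ₁ χ₂ : Kˣ →* ℂˣ} (h₁ : IsSmoothChar χ₁) (h₂ : IsSmoothChar χ₂) :
    ∀ᶠ x in 𝓝 (1 : Kˣ × Kˣ), borelChar p χ₁ χ₂ x.1 x.2 = 1 := by
  have t1 : Tendsto Prod.fst (𝓝 (1 : Kˣ × Kˣ)) (𝓝 1) := continuous_fst.tendsto _
  have t2 : Tendsto Prod.snd (𝓝 (1 : Kˣ × Kˣ)) (𝓝 1) := continuous_snd.tendsto _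
  have t3 : Tendsto (fun x : Kˣ × Kˣ => x.1 / x.2) (𝓝 1) (𝓝 1) := by
    have : Continuous fun x : Kˣ × Kˣ => x.1 / x.2 := by fun_prop
    simpa using this.tendsto 1
  filter_upwards [t1.eventually h₁.eventually_eq_one, t2.eventually h₂.eventually_eq_one,
    t3.eventually (isSmoothChar_absPow p (K := K) (1 / 2)).eventually_eq_one] with x e1 e2 e3
  rw [borelChar, e1, e2, e3, one_mul, one_mul]

end Characters

/-! ### Principal series as functions of the bottom row. -/

section PrincipalSeries

open Filter Topology

variable (p : ℕ) [Fact p.Prime] {K : Type*} [NormedField K] [Algebra ℚ_[p] K] {χ₁ χ₂ : Kˣ →* ℂˣ}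

theorem mem_principalSeriesSpace {f : GL (Fin 2) K → ℂ} :
    f ∈ principalSeriesSpace p K χ₁ χ₂ ↔
      (∀ (b g : GL (Fin 2) K) (a d : Kˣ), b 1 0 = 0 → b 0 0 = (a : K) → b 1 1 = (d : K) →
        f (b * g) = borelChar p χ₁ χ₂ a d * f g) ∧
      ∀ᶠ u in 𝓝 (1 : GL (Fin 2) K), ∀ g, f (g * u) = f g := by
  rw [← exists_openSubgroup_iff]
  simp only [borelChar, Units.val_mul]
  rfl

/-- An element of the principal series is controlled by the bottom row and the determinant. All
later comparisons of values go through this formula. -/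
theorem apply_of_row {f : GL (Fin 2) K → ℂ} (hf : f ∈ principalSeriesSpace p K χ₁ χ₂)
    {h h' : GL (Fin 2) K} {d : Kˣ} (h0 : h 1 0 = d * h' 1 0) (h1 : h 1 1 = d * h' 1 1) :
    f h = borelChar p χ₁ χ₂ (h.det * h'.det⁻¹ * d⁻¹) d * f h' := by
  obtain ⟨b, rfl, b10, b00, b11⟩ := exists_upper_mul h0 h1
  exact ((mem_principalSeriesSpace p).1 hf).1 b h' _ _ b10 b00 b11

end PrincipalSeries

/-! ### Smooth functions on the projective line over `F`. -/

section Flag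

open Filter Topology

variable (p : ℕ) [Fact p.Prime] (F : Type*) [NormedField F]

/-- The smooth functions on `B(F) \ GL₂(F)`. -/
noncomputable abbrev FlagSpace [Algebra ℚ_[p] F] : Submodule ℂ (GL (Fin 2) F → ℂ) :=
  principalSeriesSpace p F (absPow p F (-(1 / 2))) (absPow p F (1 / 2))

/-- Right translation on the smooth functions on `B(F) \ GL₂(F)`. -/
noncomputable abbrev flagRep [Algebra ℚ_[p] F] : Representation ℂ (GL (Fin 2) F) (FlagSpace p F) :=
  principalSeries p F (absPow p F (-(1 / 2))) (absPow p F (1 / 2))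

theorem flagRep_apply [Algebra ℚ_[p] F] (g : GL (Fin 2) F) (φ : FlagSpace p F) (h : GL (Fin 2) F) :
    (flagRep p F g φ).1 h = φ.1 (h * g) := rfl

variable {F} [NormedAlgebra ℚ_[p] F] [FiniteDimensional ℚ_[p] F]

theorem mem_flagSpace {φ : GL (Fin 2) F → ℂ} (h : ∀ (g g' : GL (Fin 2) F) (d : Fˣ),
    g 1 0 = d * g' 1 0 → g 1 1 = d * g' 1 1 → φ g = φ g')
    (hs : ∀ᶠ u in 𝓝 (1 : GL (Fin 2) F), ∀ g, φ (g * u) = φ g) : φ ∈ FlagSpace p F := by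
  refine (mem_principalSeriesSpace p).2 ⟨fun b g a d h10 h00 h11 => ?_, hs⟩
  rw [borelChar_flag, Units.val_one, one_mul]
  refine h _ _ d ?_ ?_ <;> rw [gl_mul_apply, h10, h11] <;> ring

theorem flag_apply_of_row (φ : FlagSpace p F) {g g' : GL (Fin 2) F} {d : F} (hd : d ≠ 0)
    (h0 : g 1 0 = d * g' 1 0) (h1 : g 1 1 = d * g' 1 1) : φ.1 g = φ.1 g' := by
  rw [apply_of_row p φ.2 (d := Units.mk0 d hd) h0 h1, borelChar_flag, Units.val_one, one_mul]

omit [FiniteDimensional ℚ_[p] F] in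
theorem flag_eventually (φ : FlagSpace p F) : ∀ᶠ u in 𝓝 (1 : GL (Fin 2) F), flagRep p F u φ = φ := by
  filter_upwards [((mem_principalSeriesSpace p).1 φ.2).2] with u hu
  exact Subtype.ext (funext hu)

/-- The indicator function of the points `[c : d]` of the projective line with
`|c / d - x| ≤ |a|`. -/
noncomputable def ballFun (x : F) (a : Fˣ) (g : GL (Fin 2) F) : ℂ :=
  if ‖g 1 0 - x * g 1 1‖ ≤ ‖(a : F)‖ * ‖g 1 1‖ then 1 else 0

end Flag

/-! ### Indicator functions of balls in the affine chart. -/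

section FlagBalls

open Filter Topology

variable (p : ℕ) [Fact p.Prime] {F : Type*} [NormedField F] [NormedAlgebra ℚ_[p] F]
  [FiniteDimensional ℚ_[p] F]

include p in
omit [FiniteDimensional ℚ_[p] F] in
theorem exists_unit_norm_le {ε : ℝ} (hε : 0 < ε) : ∃ a : Fˣ, ‖(a : F)‖ ≤ ε := by
  obtain ⟨a, ha, h⟩ := exists_small_ne_zero (p := p) F hε
  exact ⟨Units.mk0 a ha, h⟩

theorem norm_sub_le_max_of_ultrametric {K : Type*} [NormedField K] [IsUltrametricDist K] (x y : K) :
    ‖x - y‖ ≤ max ‖x‖ ‖y‖ := by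
  simpa [sub_eq_add_neg] using IsUltrametricDist.norm_add_le_max x (-y)

-- On the ball, the first entry of the row is at most `M` times the second, so multiplication by `u`
-- moves each entry by at most `ε * M` times the second entry. The norm of the second entry is
-- therefore unchanged, and the inequality survives by ultrametricity.
omit [NormedAlgebra ℚ_[p] F] [FiniteDimensional ℚ_[p] F] in
theorem ball_row_mul [IsUltrametricDist F] {x : F} {r M ε : ℝ} (hM : 1 ≤ M) (hxM : ‖x‖ ≤ M)
    (hrM : r ≤ M) (hε : 0 ≤ ε) (hε1 : ε * M < 1) (hεr : M * (ε * M) ≤ r) {u g : GL (Fin 2) F}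
    (h00 : ‖u 0 0 - 1‖ ≤ ε) (h01 : ‖u 0 1‖ ≤ ε) (h10 : ‖u 1 0‖ ≤ ε) (h11 : ‖u 1 1 - 1‖ ≤ ε)
    (h : ‖g 1 0 - x * g 1 1‖ ≤ r * ‖g 1 1‖) :
    ‖(g * u) 1 0 - x * (g * u) 1 1‖ ≤ r * ‖(g * u) 1 1‖ := by
  have hd : g 1 1 ≠ 0 := fun h0 => gl_row_ne_zero g h0 (by simpa [h0] using h)
  have hd' := norm_pos_iff.2 hd
  have hc : ‖g 1 0‖ ≤ M * ‖g 1 1‖ := by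
    have := IsUltrametricDist.norm_add_le_max (g 1 0 - x * g 1 1) (x * g 1 1)
    rw [sub_add_cancel, norm_mul] at this
    refine this.trans (max_le (h.trans ?_) ?_) <;> gcongr
  have hM0 : 0 ≤ M := by linarith
  have key : ∀ v w : F, ‖v‖ ≤ ε → ‖w‖ ≤ ε → ‖g 1 0 * v + g 1 1 * w‖ ≤ ε * M * ‖g 1 1‖ := by
    intro v w hv hw
    refine (IsUltrametricDist.norm_add_le_max _ _).trans (max_le ?_ ?_) <;> rw [norm_mul]
    · calc ‖g 1 0‖ * ‖v‖ ≤ (M * ‖g 1 1‖) * ε := by gcongr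
        _ = ε * M * ‖g 1 1‖ := by ring
    · calc ‖g 1 1‖ * ‖w‖ ≤ (M * ‖g 1 1‖) * ε := by
            gcongr
            nlinarith
        _ = ε * M * ‖g 1 1‖ := by ring
  have hr : 0 ≤ r := le_trans (by positivity) hεr
  have e1 : (g * u) 1 1 = g 1 1 + (g 1 0 * u 0 1 + g 1 1 * (u 1 1 - 1)) := by
    rw [gl_mul_apply]
    ring
  have e0 : (g * u) 1 0 - x * (g * u) 1 1 = (g 1 0 - x * g 1 1) +
      ((g 1 0 * (u 0 0 - 1) + g 1 1 * u 1 0) -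
        x * (g 1 0 * u 0 1 + g 1 1 * (u 1 1 - 1))) := by
    rw [gl_mul_apply, gl_mul_apply]
    ring
  have n1 : ‖(g * u) 1 1‖ = ‖g 1 1‖ := by
    have hlt : ‖g 1 0 * u 0 1 + g 1 1 * (u 1 1 - 1)‖ < ‖g 1 1‖ := by
      refine (key _ _ h01 h11).trans_lt ?_
      nlinarith
    rw [e1, IsUltrametricDist.norm_add_eq_max_of_norm_ne_norm hlt.ne', max_eq_left hlt.le]
  rw [n1, e0]
  refine (IsUltrametricDist.norm_add_le_max _ _).trans (max_le h ?_)
  refine (norm_sub_le_max_of_ultrametric _ _).trans (max_le ?_ ?_)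
  · refine (key _ _ h00 h10).trans (mul_le_mul_of_nonneg_right ?_ hd'.le)
    nlinarith [mul_nonneg hε hM0]
  · rw [norm_mul]
    calc ‖x‖ * ‖g 1 0 * u 0 1 + g 1 1 * (u 1 1 - 1)‖ ≤ M * (ε * M * ‖g 1 1‖) := by
          gcongr
          exact key _ _ h01 h11
      _ = M * (ε * M) * ‖g 1 1‖ := by ring
      _ ≤ r * ‖g 1 1‖ := by gcongr

omit [NormedAlgebra ℚ_[p] F] [FiniteDimensional ℚ_[p] F] in
theorem eventually_near_one {ε : ℝ} (hε : 0 < ε) : ∀ᶠ u in 𝓝 (1 : GL (Fin 2) F),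
    ‖u 0 0 - 1‖ ≤ ε ∧ ‖u 0 1‖ ≤ ε ∧ ‖u 1 0‖ ≤ ε ∧ ‖u 1 1 - 1‖ ≤ ε := by
  have key : ∀ (i j : Fin 2) (c : F), (1 : GL (Fin 2) F) i j = c →
      ∀ᶠ u in 𝓝 (1 : GL (Fin 2) F), ‖u i j - c‖ ≤ ε := by
    intro i j c hc
    have : Tendsto (fun u : GL (Fin 2) F => ‖u i j - c‖) (𝓝 1) (𝓝 ‖(1 : GL (Fin 2) F) i j - c‖) :=
      (((continuous_gl_apply i j).sub continuous_const).norm).tendsto _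
    rw [hc, sub_self, norm_zero] at this
    exact (this.eventually_lt_const hε).mono fun _ h => h.le
  filter_upwards [key 0 0 1 (by simp), key 0 1 0 (by simp), key 1 0 0 (by simp),
    key 1 1 1 (by simp)] with u h1 h2 h3 h4
  exact ⟨h1, by simpa using h2, by simpa using h3, h4⟩

theorem ballFun_mem (x : F) (a : Fˣ) : ballFun x a ∈ FlagSpace p F := by
  have := isUltrametricDist_of_padic p F
  refine mem_flagSpace p (fun g g' d h0 h1 => ?_) ?_
  · have : ‖g 1 0 - x * g 1 1‖ ≤ ‖(a : F)‖ * ‖g 1 1‖ ↔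
        ‖g' 1 0 - x * g' 1 1‖ ≤ ‖(a : F)‖ * ‖g' 1 1‖ := by
      rw [h0, h1, show (d : F) * g' 1 0 - x * (d * g' 1 1) = d * (g' 1 0 - x * g' 1 1) by ring,
        norm_mul, norm_mul, mul_left_comm, mul_le_mul_iff_right₀ (norm_pos_iff.2 d.ne_zero)]
    simp only [ballFun, this]
  · set r := ‖(a : F)‖
    have hr : 0 < r := norm_pos_iff.2 a.ne_zero
    set M := max 1 (max ‖x‖ r)
    have hM : 1 ≤ M := le_max_left _ _
    have hM0 : 0 < M := by linarith
    have hxM : ‖x‖ ≤ M := (le_max_left _ _).trans (le_max_right _ _)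
    have hrM : r ≤ M := (le_max_right _ _).trans (le_max_right _ _)
    -- This choice makes `M * (ε * M)` equal to `min r (1 / 2)`, which gives both smallness
    -- conditions of `ball_row_mul`. Applying that lemma to `u` and to its inverse gives the
    -- equivalence.
    set ε := min r (1 / 2) / (M * M)
    have hε : 0 < ε := by positivity
    have hεM : M * (ε * M) = min r (1 / 2) := by
      simp only [ε]
      field_simp
    have hε1 : ε * M < 1 := by
      have : ε * M ≤ M * (ε * M) := by nlinarith [mul_pos hε hM0]
      have := min_le_right r (1 / 2)
      linarith
    have hεr : M * (ε * M) ≤ r := hεM.trans_le (min_le_left _ _)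
    have hinv : Tendsto (fun u : GL (Fin 2) F => u⁻¹) (𝓝 1) (𝓝 1) := by
      simpa using (continuous_inv (G := GL (Fin 2) F)).tendsto 1
    filter_upwards [eventually_near_one (F := F) hε, hinv.eventually (eventually_near_one hε)]
      with u ⟨a1, a2, a3, a4⟩ ⟨b1, b2, b3, b4⟩ g
    have : ‖(g * u) 1 0 - x * (g * u) 1 1‖ ≤ r * ‖(g * u) 1 1‖ ↔
        ‖g 1 0 - x * g 1 1‖ ≤ r * ‖g 1 1‖ := by
      refine ⟨fun h => ?_, ball_row_mul hM hxM hrM hε.le hε1 hεr a1 a2 a3 a4⟩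
      have := ball_row_mul hM hxM hrM hε.le hε1 hεr b1 b2 b3 b4 h
      rwa [mul_inv_cancel_right] at this
    simp only [ballFun, r] at this ⊢
    simp only [this]

/-- `ballFun` as a smooth function on `B(F) \ GL₂(F)`. -/
noncomputable def flagBall (x : F) (a : Fˣ) : FlagSpace p F := ⟨ballFun x a, ballFun_mem p x a⟩

theorem flagBall_apply (x : F) (a : Fˣ) (g : GL (Fin 2) F) : (flagBall p x a).1 g =
    if ‖g 1 0 - x * g 1 1‖ ≤ ‖(a : F)‖ * ‖g 1 1‖ then 1 else 0 := rfl

theorem flagRep_flagBall {g : GL (Fin 2) F} {x y : F} {a b : Fˣ}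
    (h : ∀ k : GL (Fin 2) F, ‖(k * g) 1 0 - x * (k * g) 1 1‖ ≤ ‖(a : F)‖ * ‖(k * g) 1 1‖ ↔
      ‖k 1 0 - y * k 1 1‖ ≤ ‖(b : F)‖ * ‖k 1 1‖) :
    flagRep p F g (flagBall p x a) = flagBall p y b := by
  refine Subtype.ext (funext fun k => ?_)
  rw [flagRep_apply, flagBall_apply, flagBall_apply]
  simp only [h k]

omit [FiniteDimensional ℚ_[p] F] in
theorem exists_flagRep_lowerGL_eq (φ : FlagSpace p F) :
    ∃ δ > 0, ∀ y : F, ‖y‖ ≤ δ → flagRep p F (lowerGL y) φ = φ := by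
  have h : Tendsto (lowerGL : F → GL (Fin 2) F) (𝓝 0) (𝓝 1) := by
    rw [← lowerGL_zero]
    exact continuous_lowerGL.tendsto 0
  obtain ⟨ε, hε, h⟩ := Metric.eventually_nhds_iff.1 (h.eventually (flag_eventually p φ))
  exact ⟨ε / 2, by positivity, fun y hy => h (by rw [dist_zero_right]; linarith)⟩

/-- `swapGL F` represents the point at infinity, and its neighbours [1 : z] are represented by
`lowerGL z * swapGL F`. A function that vanishes at infinity thus vanishes where |d / c| is small.
-/
theorem exists_support_bound {φ : FlagSpace p F} (h : φ.1 (swapGL F) = 0) :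
    ∃ R > 0, ∀ g : GL (Fin 2) F, R * ‖g 1 1‖ < ‖g 1 0‖ → φ.1 g = 0 := by
  obtain ⟨δ, hδ, hφ⟩ := exists_flagRep_lowerGL_eq p (flagRep p F (swapGL F) φ)
  refine ⟨δ⁻¹, by positivity, fun g hg => ?_⟩
  have hc : g 1 0 ≠ 0 := norm_pos_iff.1 (lt_of_le_of_lt (by positivity) hg)
  have hz : ‖g 1 1 / g 1 0‖ ≤ δ := by
    rw [norm_div, div_le_iff₀ (norm_pos_iff.2 hc)]
    rw [inv_mul_lt_iff₀ hδ] at hg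
    exact hg.le
  have := congrArg (fun ψ => ψ.1 1) (hφ _ hz)
  simp only [flagRep_apply, one_mul] at this
  rw [← h, ← this]
  refine flag_apply_of_row p φ hc ?_ ?_ <;> simp [gl_mul_apply]
  field_simp

omit [FiniteDimensional ℚ_[p] F] in
theorem flag_ext_of_support {φ : FlagSpace p F} {R : ℝ}
    (h : ∀ g : GL (Fin 2) F, R * ‖g 1 1‖ < ‖g 1 0‖ → φ.1 g = 0) (g : GL (Fin 2) F)
    (h1 : g 1 1 = 0) : φ.1 g = 0 :=
  h g (by simpa [h1] using gl_row_ne_zero g h1)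

omit [NormedAlgebra ℚ_[p] F] [FiniteDimensional ℚ_[p] F] in
theorem ball_row_iff {g : GL (Fin 2) F} (h : g 1 1 ≠ 0) (x : F) (r : ℝ) :
    ‖g 1 0 - x * g 1 1‖ ≤ r * ‖g 1 1‖ ↔ ‖g 1 0 / g 1 1 - x‖ ≤ r := by
  rw [← div_le_iff₀ (norm_pos_iff.2 h), ← norm_div, sub_div, mul_div_cancel_right₀ _ h]

/-- A function supported on a ball and constant on smaller balls is a sum of indicator functions. -/
theorem flag_eq_sum_flagBall {φ : FlagSpace p F} {R : ℝ} {r : Fˣ} {s : Finset F}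
    (hs : IsBallReps s R ‖(r : F)‖) (hr : ‖(r : F)‖ ≤ R)
    (hsupp : ∀ g : GL (Fin 2) F, R * ‖g 1 1‖ < ‖g 1 0‖ → φ.1 g = 0)
    (hinv : ∀ y : F, ‖y‖ ≤ ‖(r : F)‖ → flagRep p F (lowerGL y) φ = φ) :
    φ = ∑ x ∈ s, φ.1 (lowerGL x) • flagBall p x r := by
  have := isUltrametricDist_of_padic p F
  have hr0 : 0 < ‖(r : F)‖ := norm_pos_iff.2 r.ne_zero
  refine Subtype.ext (funext fun g => ?_)
  rw [AddSubmonoidClass.coe_finsetSum, Finset.sum_apply]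
  simp only [SetLike.val_smul, Pi.smul_apply, smul_eq_mul, flagBall_apply, mul_ite, mul_one,
    mul_zero]
  by_cases hd : g 1 1 = 0
  · rw [flag_ext_of_support p hsupp g hd, Finset.sum_eq_zero]
    intro x _
    rw [if_neg]
    simpa [hd] using gl_row_ne_zero g hd
  simp only [ball_row_iff hd]
  set y := g 1 0 / g 1 1 with hy
  -- Translation by y - x carries the point x of the affine line to y, and φ is invariant under it.
  have hgy : ∀ x, ‖y - x‖ ≤ ‖(r : F)‖ → φ.1 g = φ.1 (lowerGL x) := by
    intro x hx
    rw [← hinv (y - x) hx, flagRep_apply, flagRep_apply, ← lowerGL_add, ← flagRep_apply, hinv _ hx,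
      add_sub_cancel]
    refine flag_apply_of_row p φ hd ?_ ?_ <;> simp [hy]
    field_simp
  by_cases hyR : ‖y‖ ≤ R
  · obtain ⟨x, ⟨hx, hxy⟩, huniq⟩ := hs.2 y hyR
    rw [Finset.sum_eq_single_of_mem x hx, if_pos hxy, hgy x hxy]
    intro x' hx' hne
    rw [if_neg]
    exact fun h => hne (huniq x' ⟨hx', h⟩)
  · rw [hsupp, Finset.sum_eq_zero]
    · intro x hx
      rw [if_neg]
      intro h
      have := IsUltrametricDist.norm_add_le_max (y - x) x
      rw [sub_add_cancel] at this
      exact hyR (this.trans (max_le (h.trans hr) (hs.1 x hx)))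
    · rw [not_le, hy, norm_div, lt_div_iff₀ (norm_pos_iff.2 hd)] at hyR
      exact hyR

theorem flagBall_support {x : F} {a : Fˣ} {R : ℝ} (hx : ‖x‖ ≤ R) (ha : ‖(a : F)‖ ≤ R)
    (g : GL (Fin 2) F) (hg : R * ‖g 1 1‖ < ‖g 1 0‖) : (flagBall p x a).1 g = 0 := by
  have := isUltrametricDist_of_padic p F
  rw [flagBall_apply, if_neg]
  intro h
  have := IsUltrametricDist.norm_add_le_max (g 1 0 - x * g 1 1) (x * g 1 1)
  rw [sub_add_cancel, norm_mul] at this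
  refine hg.not_ge (this.trans (max_le (h.trans ?_) ?_)) <;> gcongr

theorem flagRep_lowerGL_flagBall {x y : F} {a : Fˣ} (hy : ‖y‖ ≤ ‖(a : F)‖) :
    flagRep p F (lowerGL y) (flagBall p x a) = flagBall p x a := by
  have := isUltrametricDist_of_padic p F
  refine flagRep_flagBall p fun k => ?_
  have e0 : (k * lowerGL y) 1 0 = k 1 0 + k 1 1 * y := by simp [gl_mul_apply]
  have e1 : (k * lowerGL y) 1 1 = k 1 1 := by simp [gl_mul_apply]
  rw [e0, e1]
  have hky : ‖k 1 1 * y‖ ≤ ‖(a : F)‖ * ‖k 1 1‖ := by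
    rw [norm_mul, mul_comm]
    gcongr
  constructor <;> intro h
  · have := norm_sub_le_max_of_ultrametric (k 1 0 + k 1 1 * y - x * k 1 1) (k 1 1 * y)
    rw [show k 1 0 + k 1 1 * y - x * k 1 1 - k 1 1 * y = k 1 0 - x * k 1 1 by ring] at this
    exact this.trans (max_le h hky)
  · have := IsUltrametricDist.norm_add_le_max (k 1 0 - x * k 1 1) (k 1 1 * y)
    rw [show k 1 0 - x * k 1 1 + k 1 1 * y = k 1 0 + k 1 1 * y - x * k 1 1 by ring] at this
    exact this.trans (max_le h hky)

theorem flagBall_eq_sum {a b : Fˣ} {s : Finset F} (hs : IsBallReps s ‖(a : F)‖ ‖(b : F)‖)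
    (hba : ‖(b : F)‖ ≤ ‖(a : F)‖) : flagBall p 0 a = ∑ x ∈ s, flagBall p x b := by
  rw [flag_eq_sum_flagBall p (φ := flagBall p 0 a) hs hba (flagBall_support p (by simp) le_rfl)
    fun y hy => flagRep_lowerGL_flagBall p (hy.trans hba)]
  refine Finset.sum_congr rfl fun x hx => ?_
  have : (flagBall p 0 a).1 (lowerGL x) = 1 := by
    rw [flagBall_apply, if_pos]
    simpa using hs.1 x hx
  rw [this, one_smul]

end FlagBalls

/-! ### The quadratic extension and its torus in `GL₂(F)`. -/

/-- A basis `(τ, 1)` of a quadratic extension `E/F` with `τ ^ 2 = D ∈ F`. -/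
structure QuadraticBasis (F E : Type*) [Field F] [Field E] [Algebra F E] where
  /-- The basis `(τ, 1)`. -/
  b : Module.Basis (Fin 2) F E
  /-- The square of `τ`. -/
  D : F
  b_one : b 1 = 1
  b_sq : b 0 * b 0 = algebraMap F E D

namespace QuadraticBasis

section Algebra

variable {F E : Type*} [Field F] [Field E] [Algebra F E]

/-- Complete the square: subtract from a generator half of its trace. -/
theorem exists_of_finrank [CharZero F] (h : Module.finrank F E = 2) :
    Nonempty (QuadraticBasis F E) := by
  have hne : ∃ t : E, t ∉ (algebraMap F E).range := by
    by_contra! hall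
    have h1 : Module.finrank F E ≤ 1 := finrank_le_one (1 : E) fun w => by
      obtain ⟨c, hc⟩ := hall w
      exact ⟨c, by rw [Algebra.smul_def, mul_one, hc]⟩
    omega
  obtain ⟨t, ht⟩ := hne
  have hind : ∀ s : E, s ∉ (algebraMap F E).range → LinearIndependent F ![s, 1] := by
    intro s hs
    rw [LinearIndependent.pair_iff]
    intro x y hxy
    have hx : x = 0 := by
      by_contra hx
      refine hs ⟨-y / x, ?_⟩
      have hx' : algebraMap F E x ≠ 0 := by simpa using hx
      rw [Algebra.smul_def, Algebra.smul_def, mul_one] at hxy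
      rw [map_div₀, map_neg, div_eq_iff hx']
      linear_combination -hxy
    subst hx
    simpa [Algebra.smul_def] using hxy
  let b₀ := basisOfLinearIndependentOfCardEqFinrank (hind t ht) (by simp [h])
  have hb₀ : ∀ i, b₀ i = ![t, 1] i := fun i => by simp [b₀]
  obtain ⟨s, n, hsn⟩ : ∃ s n : F, t * t = algebraMap F E s * t + algebraMap F E n := by
    refine ⟨b₀.repr (t * t) 0, b₀.repr (t * t) 1, ?_⟩
    conv_lhs => rw [← b₀.sum_repr (t * t)]
    rw [Fin.sum_univ_two, hb₀, hb₀]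
    simp [Algebra.smul_def]
  set τ := t - algebraMap F E (s / 2) with hτ
  have hτn : τ ∉ (algebraMap F E).range := fun h' => ht (by
    have := add_mem h' ⟨s / 2, rfl⟩
    rwa [hτ, sub_add_cancel] at this)
  let b := basisOfLinearIndependentOfCardEqFinrank (hind τ hτn) (by simp [h])
  have hb : ∀ i, b i = ![τ, 1] i := fun i => by simp [b]
  refine ⟨⟨b, n + s / 2 * (s / 2), by simp [hb], ?_⟩⟩
  rw [hb]
  simp only [Matrix.cons_val_zero, hτ, map_add, map_mul]
  have h2 : algebraMap F E (s / 2) + algebraMap F E (s / 2) = algebraMap F E s := by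
    rw [← map_add, add_halves]
  linear_combination hsn - t * h2

variable (B : QuadraticBasis F E)

/-- The square root `τ`. -/
noncomputable def τ : E := B.b 0

/-- The coordinate of `τ`. -/
noncomputable def im (z : E) : F := B.b.repr z 0

/-- The coordinate of `1`. -/
noncomputable def re (z : E) : F := B.b.repr z 1

theorem τ_mul : B.τ * B.τ = algebraMap F E B.D := B.b_sq

theorem eq_re_im (z : E) : z = algebraMap F E (B.re z) + algebraMap F E (B.im z) * B.τ := by
  conv_lhs => rw [← B.b.sum_repr z]
  rw [Fin.sum_univ_two, B.b_one, Algebra.smul_def, Algebra.smul_def, mul_one, add_comm]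
  rfl

theorem re_im_add (x y : F) : B.re (algebraMap F E x + algebraMap F E y * B.τ) = x ∧
    B.im (algebraMap F E x + algebraMap F E y * B.τ) = y := by
  have : algebraMap F E x + algebraMap F E y * B.τ = y • B.b 0 + x • B.b 1 := by
    rw [B.b_one, Algebra.smul_def, Algebra.smul_def, mul_one, add_comm]
    rfl
  constructor
  · rw [re, this]
    simp
  · rw [im, this]
    simp

theorem re_add (x y : F) : B.re (algebraMap F E x + algebraMap F E y * B.τ) = x :=
  (B.re_im_add x y).1

theorem im_add (x y : F) : B.im (algebraMap F E x + algebraMap F E y * B.τ) = y :=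
  (B.re_im_add x y).2

theorem re_mul_τ (z : E) : B.re (z * B.τ) = B.D * B.im z := by
  have : z * B.τ = algebraMap F E (B.D * B.im z) + algebraMap F E (B.re z) * B.τ := by
    conv_lhs => rw [B.eq_re_im z]
    rw [map_mul]
    linear_combination algebraMap F E (B.im z) * B.τ_mul
  rw [this, re_add]

theorem im_mul_τ (z : E) : B.im (z * B.τ) = B.re z := by
  have : z * B.τ = algebraMap F E (B.D * B.im z) + algebraMap F E (B.re z) * B.τ := by
    conv_lhs => rw [B.eq_re_im z]
    rw [map_mul]
    linear_combination algebraMap F E (B.im z) * B.τ_mul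
  rw [this, im_add]

theorem τ_ne_zero : B.τ ≠ 0 := B.b.ne_zero 0

theorem D_ne_zero : B.D ≠ 0 := fun h => B.τ_ne_zero (by
  have := B.τ_mul
  rw [h, map_zero] at this
  exact mul_self_eq_zero.1 this)

theorem add_ne_zero_of_right {x y : F} (h : y ≠ 0) :
    algebraMap F E x + algebraMap F E y * B.τ ≠ 0 := fun h0 => h (by
  rw [← B.im_add x y, h0, im]
  simp)

theorem add_ne_zero_of_left {x y : F} (h : x ≠ 0) :
    algebraMap F E x + algebraMap F E y * B.τ ≠ 0 := fun h0 => h (by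
  rw [← B.re_add x y, h0, re]
  simp)

/-- The embedding of `Eˣ` in `GL₂(F)`. -/
noncomputable def torus : Eˣ →* GL (Fin 2) F :=
  Units.map (Algebra.leftMulMatrix B.b : E →* Matrix (Fin 2) (Fin 2) F)

theorem torus_apply (z : Eˣ) (i j : Fin 2) : B.torus z i j = B.b.repr (z * B.b j) i :=
  Algebra.leftMulMatrix_eq_repr_mul _ _ _ _

@[simp] theorem torus_00 (z : Eˣ) : B.torus z 0 0 = B.re z := by
  rw [torus_apply]
  exact B.im_mul_τ z

@[simp] theorem torus_01 (z : Eˣ) : B.torus z 0 1 = B.im z := by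
  rw [torus_apply, B.b_one, mul_one]
  rfl

@[simp] theorem torus_10 (z : Eˣ) : B.torus z 1 0 = B.D * B.im z := by
  rw [torus_apply]
  exact B.re_mul_τ z

@[simp] theorem torus_11 (z : Eˣ) : B.torus z 1 1 = B.re z := by
  rw [torus_apply, B.b_one, mul_one]
  rfl

theorem torus_det (z : Eˣ) : (B.torus z).det = Units.map (Algebra.norm F (S := E)) z := by
  ext
  exact (Algebra.norm_eq_matrix_det B.b (z : E)).symm

/-- The element of `E` attached to the bottom row of a matrix. -/
noncomputable def rowElt (g : GL (Fin 2) F) : Eˣ :=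
  Units.mk0 (algebraMap F E (g 1 1) + algebraMap F E (g 1 0 / B.D) * B.τ) (by
    by_cases h : g 1 1 = 0
    · exact B.add_ne_zero_of_right (div_ne_zero (gl_row_ne_zero g h) B.D_ne_zero)
    · exact B.add_ne_zero_of_left h)

theorem rowElt_val (g : GL (Fin 2) F) :
    (B.rowElt g : E) = algebraMap F E (g 1 1) + algebraMap F E (g 1 0 / B.D) * B.τ := rfl

theorem torus_rowElt_10 (g : GL (Fin 2) F) : B.torus (B.rowElt g) 1 0 = g 1 0 := by
  rw [torus_10, rowElt_val, im_add, mul_div_cancel₀ _ B.D_ne_zero]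

theorem torus_rowElt_11 (g : GL (Fin 2) F) : B.torus (B.rowElt g) 1 1 = g 1 1 := by
  rw [torus_11, rowElt_val, re_add]

theorem rowElt_eq {g g' : GL (Fin 2) F} (d : Fˣ) (h0 : g 1 0 = d * g' 1 0)
    (h1 : g 1 1 = d * g' 1 1) :
    B.rowElt g = Units.map (algebraMap F E : F →* E) d * B.rowElt g' := by
  ext
  rw [Units.val_mul, rowElt_val, rowElt_val, h0, h1, Units.coe_map, mul_div_assoc]
  simp only [MonoidHom.coe_coe, map_mul]
  ring

theorem rowElt_torus (z : Eˣ) : B.rowElt (B.torus z) = z := by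
  ext
  rw [rowElt_val, torus_10, torus_11, mul_div_cancel_left₀ _ B.D_ne_zero, ← eq_re_im]

end Algebra

/-! ### Continuity of the torus and compactness of Eˣ/Fˣ. -/

section Topology

open Filter Topology

variable (p : ℕ) [Fact p.Prime] {F E : Type*} [NormedField F] [NormedField E]
  [NormedAlgebra ℚ_[p] F] [FiniteDimensional ℚ_[p] F] [NormedAlgebra ℚ_[p] E]
  [FiniteDimensional ℚ_[p] E] [NormedAlgebra F E] [IsScalarTower ℚ_[p] F E]
  (B : QuadraticBasis F E)

include p in
omit [FiniteDimensional ℚ_[p] F] in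
theorem continuous_repr (i : Fin 2) : Continuous fun z : E => B.b.repr z i :=
  ((B.b.coord i).restrictScalars ℚ_[p]).continuous_of_finiteDimensional

include p in
omit [FiniteDimensional ℚ_[p] F] in
theorem exists_repr_bound : ∃ C > 0, ∀ (z : E) (i : Fin 2), ‖B.b.repr z i‖ ≤ C * ‖z‖ := by
  have h : ∀ i : Fin 2, ∃ C > 0, ∀ z : E, ‖B.b.repr z i‖ ≤ C * ‖z‖ := fun i =>
    (LinearMap.toContinuousLinearMap ((B.b.coord i).restrictScalars ℚ_[p])).bound
  choose C hC h using h
  refine ⟨max (C 0) (C 1), lt_max_of_lt_left (hC 0), fun z i => (h i z).trans ?_⟩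
  refine mul_le_mul_of_nonneg_right ?_ (norm_nonneg _)
  fin_cases i
  · exact le_max_left _ _
  · exact le_max_right _ _

include p in
omit [FiniteDimensional ℚ_[p] F] in
theorem continuous_torus : Continuous B.torus := by
  refine continuous_iff_continuousAt.2 fun z => tendsto_gl fun i j => ?_
  simp only [torus_apply]
  exact ((B.continuous_repr p i).comp
    (Units.continuous_val.mul continuous_const)).tendsto z

theorem exists_unit_nhds {K : Type*} [NormedField K] {P : Kˣ → Prop} (h : ∀ᶠ z in 𝓝 1, P z) :
    ∃ ε > 0, ∀ z : Kˣ, ‖(z : K) - 1‖ ≤ ε → P z := by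
  rw [Units.isEmbedding_val₀.isInducing.nhds_eq_comap, eventually_comap] at h
  obtain ⟨ε, hε, h⟩ := Metric.eventually_nhds_iff.1 h
  refine ⟨ε / 2, by positivity, fun z hz => h (y := z) ?_ z rfl⟩
  rw [dist_eq_norm, Units.val_one]
  linarith

include p in
omit [FiniteDimensional ℚ_[p] F] in
/-- Matrices near `1` change the element attached to a row by a factor near `1`. -/
theorem eventually_rowElt {P : Eˣ → Prop} (h : ∀ᶠ z in 𝓝 1, P z) :
    ∀ᶠ u in 𝓝 (1 : GL (Fin 2) F), ∀ g, P (B.rowElt (g * u) / B.rowElt g) := by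
  have := isUltrametricDist_of_padic p E
  obtain ⟨ε, hε, h⟩ := exists_unit_nhds h
  obtain ⟨C, hC, hB⟩ := B.exists_repr_bound p
  set C' := max C (‖B.D‖ * C)
  have hC' : 0 < C' := lt_max_of_lt_left hC
  set T := max 1 ‖B.τ / algebraMap F E B.D‖
  have hT : 0 < T := lt_max_of_lt_left one_pos
  -- `C'` bounds the row entries in terms of the norm of `rowElt g`, and `T` bounds the coefficients
  -- 1 and τ/D through which a row perturbation enters `rowElt`.
  filter_upwards [eventually_near_one (F := F) (ε := ε / (C' * T)) (by positivity)] with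
    u ⟨h1, h2, h3, h4⟩ g
  refine h _ ?_
  set z := B.rowElt g with hz
  have hzp : 0 < ‖(z : E)‖ := norm_pos_iff.2 z.ne_zero
  have g1 : ‖g 1 1‖ ≤ C' * ‖(z : E)‖ := by
    rw [← B.torus_rowElt_11 g, torus_11]
    exact (hB _ 1).trans (mul_le_mul_of_nonneg_right (le_max_left _ _) hzp.le)
  have g0 : ‖g 1 0‖ ≤ C' * ‖(z : E)‖ := by
    rw [← B.torus_rowElt_10 g, torus_10, norm_mul]
    calc ‖B.D‖ * ‖B.im z‖ ≤ ‖B.D‖ * (C * ‖(z : E)‖) :=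
          mul_le_mul_of_nonneg_left (hB _ 0) (norm_nonneg _)
      _ = (‖B.D‖ * C) * ‖(z : E)‖ := by ring
      _ ≤ C' * ‖(z : E)‖ := mul_le_mul_of_nonneg_right (le_max_right _ _) hzp.le
  have key : ∀ v w : F, ‖v‖ ≤ ε / (C' * T) → ‖w‖ ≤ ε / (C' * T) → ∀ c : E, ‖c‖ ≤ T →
      ‖algebraMap F E (g 1 0 * v + g 1 1 * w) * c‖ ≤ ε * ‖(z : E)‖ := by
    intro v w hv hw c hc
    have := isUltrametricDist_of_padic p F
    rw [norm_mul, norm_algebraMap']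
    have h5 : ‖g 1 0 * v + g 1 1 * w‖ ≤ C' * ‖(z : E)‖ * (ε / (C' * T)) := by
      refine (IsUltrametricDist.norm_add_le_max _ _).trans (max_le ?_ ?_) <;> rw [norm_mul] <;>
        gcongr
    calc _ ≤ C' * ‖(z : E)‖ * (ε / (C' * T)) * T := by gcongr
      _ = ε * ‖(z : E)‖ := by field_simp
  have hdiff : (B.rowElt (g * u) : E) - z =
      algebraMap F E (g 1 0 * u 0 1 + g 1 1 * (u 1 1 - 1)) * 1 +
        algebraMap F E (g 1 0 * (u 0 0 - 1) + g 1 1 * u 1 0) *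
          (B.τ / algebraMap F E B.D) := by
    rw [hz, rowElt_val, rowElt_val, gl_mul_apply, gl_mul_apply]
    simp only [map_div₀, map_add, map_mul, map_sub, map_one]
    ring
  rw [Units.val_div_eq_div_val, div_sub_one z.ne_zero, norm_div, div_le_iff₀ hzp, hdiff]
  refine (IsUltrametricDist.norm_add_le_max _ _).trans (max_le ?_ ?_)
  · exact key _ _ h2 h4 _ (by rw [norm_one]; exact le_max_left _ _)
  · exact key _ _ h1 h3 _ (le_max_right _ _)

include p in
omit [FiniteDimensional ℚ_[p] F] [IsScalarTower ℚ_[p] F E] in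
variable (F) in
/-- Open subgroups of `Eˣ` that contain `Fˣ` have finite index. -/
theorem finite_quotient {U : Subgroup Eˣ} (hU : IsOpen (U : Set Eˣ))
    (hF : ∀ x : Fˣ, Units.map (algebraMap F E : F →* E) x ∈ U) : Finite (Eˣ ⧸ U) := by
  have : ProperSpace E := FiniteDimensional.proper ℚ_[p] E
  have : DiscreteTopology (Eˣ ⧸ U) := QuotientGroup.discreteTopology hU
  have hpF : (p : F) ≠ 0 := by
    rw [← map_natCast (algebraMap ℚ_[p] F), Ne, map_eq_zero]
    exact_mod_cast (Fact.out : p.Prime).ne_zero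
  have hpn : ‖(p : F)‖ = (p : ℝ)⁻¹ := by
    rw [← map_natCast (algebraMap ℚ_[p] F), norm_algebraMap', Padic.norm_p]
  have hp1 : (1 : ℝ) < p := by exact_mod_cast (Fact.out : p.Prime).one_lt
  -- Scaling by a power of p, which lies in `Fˣ`, moves every element into this compact annulus. The
  -- quotient is thus both compact and discrete.
  set A : Set Eˣ := {z | 1 ≤ ‖(z : E)‖ ∧ ‖(z : E)‖ ≤ p}
  have hA : IsCompact A := by
    rw [Units.isEmbedding_val₀.isCompact_iff]
    have : Units.val '' A = Metric.closedBall (0 : E) p ∩ {z | 1 ≤ ‖z‖} := by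
      ext z
      constructor
      · rintro ⟨z, hz, rfl⟩
        exact ⟨by simpa using hz.2, hz.1⟩
      · rintro ⟨h1, h2⟩
        have hz : z ≠ 0 := norm_pos_iff.1 (lt_of_lt_of_le one_pos h2)
        exact ⟨Units.mk0 z hz, ⟨h2, by simpa using h1⟩, rfl⟩
    rw [this]
    exact (isCompact_closedBall _ _).inter_right (isClosed_le continuous_const continuous_norm)
  have himg : (QuotientGroup.mk '' A : Set (Eˣ ⧸ U)) = Set.univ := by
    refine Set.eq_univ_of_forall fun q => ?_
    induction q using QuotientGroup.induction_on with
    | H z =>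
      obtain ⟨n, hn1, hn2⟩ := exists_mem_Ico_zpow (norm_pos_iff.2 z.ne_zero) hp1
      set x : Fˣ := (Units.mk0 (p : F) hpF) ^ n
      refine ⟨z * Units.map (algebraMap F E : F →* E) x, ?_, ?_⟩
      · have hx : ‖((Units.map (algebraMap F E : F →* E) x : Eˣ) : E)‖ = ((p : ℝ) ^ n)⁻¹ := by
          rw [Units.coe_map]
          simp only [MonoidHom.coe_coe, norm_algebraMap']
          simp only [x, Units.val_zpow_eq_zpow_val, Units.val_mk0, norm_zpow, hpn, inv_zpow]
        have hpp : 0 < (p : ℝ) ^ n := zpow_pos (by linarith) _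
        change 1 ≤ ‖(z : E) * _‖ ∧ ‖(z : E) * _‖ ≤ p
        rw [norm_mul, hx]
        refine ⟨?_, ?_⟩
        · rw [le_mul_inv_iff₀ hpp, one_mul]
          exact hn1
        · rw [mul_inv_le_iff₀ hpp, mul_comm, ← zpow_add_one₀ (by linarith)]
          exact hn2.le
      · rw [eq_comm, QuotientGroup.eq]
        simpa using hF x
  have hc : IsCompact (QuotientGroup.mk '' A : Set (Eˣ ⧸ U)) := hA.image continuous_quot_mk
  rw [himg] at hc
  exact Set.finite_univ_iff.1 (isCompact_iff_finite.1 hc)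

end Topology

end QuadraticBasis

/-! ### Equivariant functionals for the torus. -/

namespace QuadraticBasis

open Filter Topology

variable (p : ℕ) [Fact p.Prime] {F E : Type*} [NormedField F] [NormedField E]
  [NormedAlgebra ℚ_[p] F] [FiniteDimensional ℚ_[p] F] [NormedAlgebra ℚ_[p] E]
  [FiniteDimensional ℚ_[p] E] [NormedAlgebra F E] [IsScalarTower ℚ_[p] F E]
  (B : QuadraticBasis F E)

omit [FiniteDimensional ℚ_[p] E] in
theorem normalizedAbs_algebraMap (h2 : Module.finrank F E = 2) (x : F) :
    normalizedAbs p E (algebraMap F E x) = normalizedAbs p F x ^ 2 := by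
  have : FiniteDimensional F E := FiniteDimensional.of_finrank_pos (by omega)
  rw [normalizedAbs, ← Algebra.norm_norm (S := F), Algebra.norm_algebraMap, h2, map_pow, norm_pow]
  rfl

omit [FiniteDimensional ℚ_[p] E] in
theorem normalizedAbs_algebraMap_norm (h2 : Module.finrank F E = 2) (z : E) :
    normalizedAbs p E (algebraMap F E (Algebra.norm F z)) = normalizedAbs p E z ^ 2 := by
  have : FiniteDimensional F E := FiniteDimensional.of_finrank_pos (by omega)
  rw [normalizedAbs_algebraMap p h2, normalizedAbs, Algebra.norm_norm]
  rfl

/-- The inclusion of `Fˣ` in `Eˣ`. -/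
abbrev incl (F E : Type*) [Field F] [Field E] [Algebra F E] : Fˣ →* Eˣ :=
  Units.map (algebraMap F E : F →* E)

/-- The torus sends `Fˣ` to the scalar matrices, which fix every point of the projective line. -/
theorem flagRep_torus_incl (x : Fˣ) (φ : FlagSpace p F) :
    flagRep p F (B.torus (incl F E x)) φ = φ := by
  refine Subtype.ext (funext fun g => ?_)
  rw [flagRep_apply]
  have hx : ((incl F E x : Eˣ) : E) = algebraMap F E (x : F) + algebraMap F E 0 * B.τ := by
    simp [incl]
  refine flag_apply_of_row p φ x.ne_zero ?_ ?_ <;> rw [gl_mul_apply]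
  · rw [torus_00, torus_10, hx, re_add, im_add]
    ring
  · rw [torus_01, torus_11, hx, re_add, im_add]
    ring

/-- The subgroup of `Eˣ` of elements that fix `φ` and lie in the kernel of `θ`. -/
noncomputable def fixer (θ : Eˣ →* ℂˣ) (φ : FlagSpace p F) : Subgroup Eˣ where
  carrier := {z | flagRep p F (B.torus z) φ = φ ∧ θ z = 1}
  one_mem' := by simp
  mul_mem' {x y} hx hy := by
    refine ⟨?_, by rw [map_mul, hx.2, hy.2, one_mul]⟩
    rw [map_mul, map_mul, Module.End.mul_apply, hy.1, hx.1]
  inv_mem' {x} hx := by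
    refine ⟨?_, by rw [map_inv, hx.2, inv_one]⟩
    conv_lhs => rw [← hx.1]
    rw [← Module.End.mul_apply, ← map_mul, ← map_mul, inv_mul_cancel, map_one, map_one]
    rfl

theorem isOpen_fixer {θ : Eˣ →* ℂˣ} (hθ : IsSmoothChar θ) (φ : FlagSpace p F) :
    IsOpen (B.fixer p θ φ : Set Eˣ) := by
  refine Subgroup.isOpen_of_mem_nhds _ (g := 1) ?_
  have h : Tendsto B.torus (𝓝 1) (𝓝 1) := by
    simpa using (B.continuous_torus p).tendsto 1
  filter_upwards [h.eventually (flag_eventually p φ), hθ.eventually_eq_one] with z h1 h2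
  exact ⟨h1, h2⟩

theorem incl_mem_fixer {θ : Eˣ →* ℂˣ} (hF : ∀ x : Fˣ, θ (incl F E x) = 1) (φ : FlagSpace p F)
    (x : Fˣ) : incl F E x ∈ B.fixer p θ φ :=
  ⟨B.flagRep_torus_incl p x φ, hF x⟩

/-- The function `b t_z ↦ θ(z)` on `B(F) \ GL₂(F)`. -/
noncomputable def charFun {θ : Eˣ →* ℂˣ} (hθ : IsSmoothChar θ)
    (hF : ∀ x : Fˣ, θ (incl F E x) = 1) : FlagSpace p F :=
  ⟨fun g => θ (B.rowElt g), by
    refine mem_flagSpace p (fun g g' d h0 h1 => ?_) ?_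
    · rw [B.rowElt_eq d h0 h1, map_mul, hF, one_mul]
    · filter_upwards [B.eventually_rowElt p hθ.eventually_eq_one] with u hu g
      have := hu g
      rw [map_div, div_eq_one] at this
      rw [this]⟩

theorem charFun_apply {θ : Eˣ →* ℂˣ} (hθ : IsSmoothChar θ)
    (hF : ∀ x : Fˣ, θ (incl F E x) = 1) (g : GL (Fin 2) F) :
    (B.charFun p hθ hF).1 g = θ (B.rowElt g) := rfl

theorem flag_apply_eq_torus (φ : FlagSpace p F) (g : GL (Fin 2) F) :
    φ.1 g = φ.1 (B.torus (B.rowElt g)) :=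
  flag_apply_of_row p φ one_ne_zero (by rw [torus_rowElt_10, one_mul])
    (by rw [torus_rowElt_11, one_mul])

/-- A functional on the smooth functions on `B(F) \ GL₂(F)` is `θ`-equivariant if `Eˣ` acts on it
by `θ`. -/
def Equivariant (θ : Eˣ →* ℂˣ) (l : FlagSpace p F →ₗ[ℂ] ℂ) : Prop :=
  ∀ (z : Eˣ) (φ : FlagSpace p F), l (flagRep p F (B.torus z) φ) = θ z * l φ

/-- A `θ`-equivariant functional vanishes unless `θ` is trivial on `Fˣ`. -/
theorem Equivariant.eq_zero {θ : Eˣ →* ℂˣ} {l : FlagSpace p F →ₗ[ℂ] ℂ}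
    (hl : B.Equivariant p θ l) {x : Fˣ} (hx : θ (incl F E x) ≠ 1) : l = 0 := by
  ext φ
  have := hl (incl F E x) φ
  rw [flagRep_torus_incl] at this
  have h2 : ((θ (incl F E x) : ℂ) - 1) * l φ = 0 := by rw [sub_mul, one_mul, ← this, sub_self]
  refine (mul_eq_zero.1 h2).resolve_left fun h => hx ?_
  ext
  simpa [sub_eq_zero] using h

/-- The function on a quotient of `Eˣ` induced by `z ↦ θ(z)⁻¹ φ(t_z)`. -/
noncomputable def twist (θ : Eˣ →* ℂˣ) (φ : FlagSpace p F) (U : Subgroup Eˣ) (q : Eˣ ⧸ U) : ℂ :=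
  ((θ q.out)⁻¹ : ℂˣ) * φ.1 (B.torus q.out)

theorem twist_mk (θ : Eˣ →* ℂˣ) (φ : FlagSpace p F) {U : Subgroup Eˣ} (hU : U ≤ B.fixer p θ φ)
    (z : Eˣ) : B.twist p θ φ U z = ((θ z)⁻¹ : ℂˣ) * φ.1 (B.torus z) := by
  have h : (z : Eˣ ⧸ U).out⁻¹ * z ∈ U := by
    rw [← QuotientGroup.eq]
    exact QuotientGroup.out_eq' _
  obtain ⟨h1, h2⟩ := hU h
  set y := (z : Eˣ ⧸ U).out with hy
  have h3 : θ z = θ y := by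
    rw [map_mul, map_inv, inv_mul_eq_one] at h2
    exact h2.symm
  have h4 : φ.1 (B.torus z) = φ.1 (B.torus y) := by
    conv_rhs => rw [← h1]
    rw [flagRep_apply, ← map_mul, mul_inv_cancel_left]
  rw [twist, ← hy, h3, h4]

/-- A `θ`-equivariant functional is determined by its value at `charFun`. -/
theorem exists_equivariant_eq {θ : Eˣ →* ℂˣ} (hθ : IsSmoothChar θ)
    (hF : ∀ x : Fˣ, θ (incl F E x) = 1) (φ : FlagSpace p F) :
    ∃ c : ℂ, ∀ l, B.Equivariant p θ l → l φ = c * l (B.charFun p hθ hF) := by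
  set U := B.fixer p θ φ
  have : Finite (Eˣ ⧸ U) := finite_quotient p F (B.isOpen_fixer p hθ φ) (B.incl_mem_fixer p hF φ)
  have := Fintype.ofFinite (Eˣ ⧸ U)
  -- The projection of φ to the θ-isotypic part, up to the number of cosets. That part is spanned by
  -- `charFun` because the torus is transitive, while every equivariant l takes on `S` the value l φ
  -- times the number of cosets.
  set S : FlagSpace p F := ∑ q : Eˣ ⧸ U, (((θ q.out)⁻¹ : ℂˣ) : ℂ) • flagRep p F (B.torus q.out) φ
  set s : ℂ := ∑ q : Eˣ ⧸ U, B.twist p θ φ U q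
  have hS : S = s • B.charFun p hθ hF := by
    refine Subtype.ext (funext fun g => ?_)
    rw [B.flag_apply_eq_torus p S, B.flag_apply_eq_torus p (s • _)]
    set z := B.rowElt g
    rw [SetLike.val_smul, Pi.smul_apply, charFun_apply, rowElt_torus, smul_eq_mul,
      AddSubmonoidClass.coe_finsetSum, Finset.sum_apply, Finset.sum_mul]
    rw [← Equiv.sum_comp (Equiv.mulLeft (z : Eˣ ⧸ U)) fun q => B.twist p θ φ U q * (θ z : ℂ)]
    refine Finset.sum_congr rfl fun q _ => ?_
    change _ = B.twist p θ φ U (z * q) * _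
    conv_rhs => rw [← QuotientGroup.out_eq' q, ← QuotientGroup.mk_mul, B.twist_mk p θ φ le_rfl]
    rw [SetLike.val_smul, Pi.smul_apply, flagRep_apply, smul_eq_mul, ← map_mul, map_mul θ]
    have := (θ z).ne_zero
    have := (θ q.out).ne_zero
    simp only [mul_inv, Units.val_mul, Units.val_inv_eq_inv_val]
    field_simp
  have hn : (Fintype.card (Eˣ ⧸ U) : ℂ) ≠ 0 := by exact_mod_cast Fintype.card_ne_zero
  refine ⟨s / Fintype.card (Eˣ ⧸ U), fun l hl => ?_⟩
  have h1 : l S = Fintype.card (Eˣ ⧸ U) * l φ := by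
    rw [map_sum]
    simp only [map_smul, hl _ φ, smul_eq_mul, ← mul_assoc, Units.inv_mul, one_mul]
    rw [Finset.sum_const, nsmul_eq_mul]
    rfl
  rw [hS, map_smul, smul_eq_mul] at h1
  rw [div_mul_eq_mul_div, h1, mul_div_cancel_left₀ _ hn]

/-- The existence of `θ`-equivariant functionals. -/
theorem exists_equivariant {θ : Eˣ →* ℂˣ} (hθ : IsSmoothChar θ)
    (hF : ∀ x : Fˣ, θ (incl F E x) = 1) :
    ∃ l, B.Equivariant p θ l ∧ l (B.charFun p hθ hF) ≠ 0 := by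
  -- Equivariant functionals are the functionals that vanish on `W`, so it suffices that `charFun`
  -- survives in the quotient by `W`.
  set W : Submodule ℂ (FlagSpace p F) := Submodule.span ℂ
    (Set.range fun x : Eˣ × FlagSpace p F => flagRep p F (B.torus x.1) x.2 - (θ x.1 : ℂ) • x.2)
  suffices h : B.charFun p hθ hF ∉ W by
    obtain ⟨l, h1, h2⟩ := Submodule.exists_le_ker_of_notMem h
    refine ⟨l, fun z φ => ?_, h1⟩
    have := h2 (Submodule.subset_span ⟨(z, φ), rfl⟩)
    rw [LinearMap.mem_ker, map_sub, map_smul, sub_eq_zero] at this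
    exact this
  -- The sum of `twist` over a fine enough finite quotient is the integral of θ⁻¹ w. It vanishes on
  -- `W` by translation invariance, whereas for `charFun` every term is 1. Allowing every smaller
  -- `U` makes the claim stable under sums.
  have key : ∀ w ∈ W, ∃ U₀ : Subgroup Eˣ, (IsOpen (U₀ : Set Eˣ) ∧ ∀ x, incl F E x ∈ U₀) ∧
      ∀ U : Subgroup Eˣ, U ≤ U₀ → Finite (Eˣ ⧸ U) → ∑ᶠ q, B.twist p θ w U q = 0 := by
    intro w hw
    induction hw using Submodule.span_induction with
    | mem w hw =>
      obtain ⟨⟨z, φ⟩, rfl⟩ := hw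
      refine ⟨B.fixer p θ φ, ⟨B.isOpen_fixer p hθ φ, B.incl_mem_fixer p hF φ⟩,
        fun U hU hfin => ?_⟩
      have := Fintype.ofFinite (Eˣ ⧸ U)
      have h1 : ∀ q, B.twist p θ (flagRep p F (B.torus z) φ - (θ z : ℂ) • φ) U q =
          θ z * B.twist p θ φ U (q * z) - θ z * B.twist p θ φ U q := by
        intro q
        conv_rhs =>
          enter [1]
          rw [← QuotientGroup.out_eq' q, ← QuotientGroup.mk_mul, B.twist_mk p θ φ hU]
        rw [twist, twist]
        change _ * (φ.1 (B.torus q.out * B.torus z) - θ z * φ.1 (B.torus q.out)) = _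
        rw [← map_mul, map_mul θ]
        have := (θ z).ne_zero
        have := (θ q.out).ne_zero
        simp only [mul_inv, Units.val_mul, Units.val_inv_eq_inv_val]
        field_simp
      rw [finsum_eq_sum_of_fintype, Finset.sum_congr rfl fun q _ => h1 q,
        Finset.sum_sub_distrib, sub_eq_zero]
      exact Equiv.sum_comp (Equiv.mulRight (z : Eˣ ⧸ U)) fun q => θ z * B.twist p θ φ U q
    | zero =>
      exact ⟨⊤, ⟨isOpen_univ, fun _ => Subgroup.mem_top _⟩, fun U _ _ =>
        finsum_eq_zero_of_forall_eq_zero fun q => mul_zero _⟩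
    | add w w' _ _ ih ih' =>
      obtain ⟨U₁, ⟨o₁, f₁⟩, h₁⟩ := ih
      obtain ⟨U₂, ⟨o₂, f₂⟩, h₂⟩ := ih'
      refine ⟨U₁ ⊓ U₂, ⟨o₁.inter o₂, fun x => ⟨f₁ x, f₂ x⟩⟩, fun U hU hfin => ?_⟩
      calc ∑ᶠ q, B.twist p θ (w + w') U q =
            ∑ᶠ q, (B.twist p θ w U q + B.twist p θ w' U q) := finsum_congr fun q => mul_add _ _ _
        _ = 0 := by
          rw [finsum_add_distrib (Set.toFinite _) (Set.toFinite _),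
            h₁ U (hU.trans inf_le_left) hfin, h₂ U (hU.trans inf_le_right) hfin, add_zero]
    | smul c w _ ih =>
      obtain ⟨U₁, o₁, h₁⟩ := ih
      refine ⟨U₁, o₁, fun U hU hfin => ?_⟩
      rw [← mul_zero c, ← h₁ U hU hfin, mul_finsum]
      exact finsum_congr fun q => mul_left_comm _ _ _
  intro h
  obtain ⟨U, ⟨o, f⟩, hU⟩ := key _ h
  have hfin := finite_quotient p F o f
  have := Fintype.ofFinite (Eˣ ⧸ U)
  have h0 := hU U le_rfl hfin
  rw [finsum_eq_sum_of_fintype] at h0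
  have h1 : ∀ q, B.twist p θ (B.charFun p hθ hF) U q = 1 := fun q => by
    rw [twist, charFun_apply, rowElt_torus, Units.inv_mul]
  simp only [h1, Finset.sum_const, nsmul_eq_mul, mul_one] at h0
  exact Fintype.card_ne_zero (α := Eˣ ⧸ U) (by exact_mod_cast h0)

end QuadraticBasis

/-! ### The orbits of `GL₂(F)` and the stabilizer character. -/

namespace QuadraticBasis

open Filter Topology

variable (p : ℕ) [Fact p.Prime] {F E : Type*} [NormedField F] [NormedField E]
  [NormedAlgebra ℚ_[p] F] [FiniteDimensional ℚ_[p] F] [NormedAlgebra ℚ_[p] E]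
  [FiniteDimensional ℚ_[p] E] [NormedAlgebra F E] [IsScalarTower ℚ_[p] F E]
  (B : QuadraticBasis F E)

/-- The inclusion of `GL₂(F)` in `GL₂(E)`. -/
noncomputable abbrev inclGL (F E : Type*) [Field F] [Field E] [Algebra F E] :
    GL (Fin 2) F →* GL (Fin 2) E :=
  Matrix.GeneralLinearGroup.map (algebraMap F E)

theorem inclGL_apply (g : GL (Fin 2) F) (i j : Fin 2) :
    inclGL F E g i j = algebraMap F E (g i j) := rfl

theorem inclGL_det (g : GL (Fin 2) F) : (inclGL F E g).det = incl F E g.det := by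
  ext
  rw [gl_det_eq, incl, Units.coe_map, MonoidHom.coe_coe, gl_det_eq]
  simp only [inclGL_apply, map_sub, map_mul]

/-- A representative of the open orbit of `GL₂(F)` on the projective line over `E`. -/
noncomputable def γ : GL (Fin 2) E := lowerGL B.τ

theorem γ_mul_10 (g : GL (Fin 2) F) :
    (B.γ * inclGL F E g) 1 0 = B.τ * algebraMap F E (g 0 0) + algebraMap F E (g 1 0) := by
  rw [gl_mul_apply, inclGL_apply, inclGL_apply, γ]
  simp

theorem γ_mul_11 (g : GL (Fin 2) F) :
    (B.γ * inclGL F E g) 1 1 = B.τ * algebraMap F E (g 0 1) + algebraMap F E (g 1 1) := by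
  rw [gl_mul_apply, inclGL_apply, inclGL_apply, γ]
  simp

theorem γ_mul_det (g : GL (Fin 2) F) : (B.γ * inclGL F E g).det = incl F E g.det := by
  rw [map_mul, inclGL_det, γ, lowerGL_det, one_mul]

theorem γ_torus_10 (z : Eˣ) : (B.γ * inclGL F E (B.torus z)) 1 0 = z * B.γ 1 0 := by
  rw [γ_mul_10, torus_00, torus_10, γ, lowerGL_10, map_mul]
  conv_rhs => rw [B.eq_re_im z]
  linear_combination (- algebraMap F E (B.im z)) * B.τ_mul

theorem γ_torus_11 (z : Eˣ) : (B.γ * inclGL F E (B.torus z)) 1 1 = z * B.γ 1 1 := by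
  rw [γ_mul_11, torus_01, torus_11, γ, lowerGL_11]
  conv_rhs => rw [B.eq_re_im z]
  ring

section TorusChar

variable (χ₁ χ₂ : Eˣ →* ℂˣ)

variable (F) in
/-- The character by which `Eˣ` acts at the representative of the open orbit. -/
noncomputable def torusChar : Eˣ →* ℂˣ where
  toFun z := borelChar p χ₁ χ₂ (incl F E (Units.map (Algebra.norm F (S := E)) z) * z⁻¹) z
  map_one' := by simp [borelChar]
  map_mul' x y := by
    rw [← borelChar_mul, map_mul, map_mul, mul_inv]
    congr 1
    ac_rfl

theorem torusChar_apply (z : Eˣ) : torusChar p F χ₁ χ₂ z =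
    borelChar p χ₁ χ₂ (incl F E (Units.map (Algebra.norm F (S := E)) z) * z⁻¹) z := rfl

/-- The modulus factor disappears because |N z|_E = |z|_E ^ 2. -/
theorem torusChar_eq (h2 : Module.finrank F E = 2) (z : Eˣ) : torusChar p F χ₁ χ₂ z =
    χ₁ (incl F E (Units.map (Algebra.norm F (S := E)) z)) * (χ₁ z)⁻¹ * χ₂ z := by
  have h : absPow p E (1 / 2) (incl F E (Units.map (Algebra.norm F (S := E)) z) * z⁻¹ / z) = 1 := by
    have hz := (normalizedAbs_pos p z).ne'
    have hu : ((incl F E (Units.map (Algebra.norm F (S := E)) z) * z⁻¹ / z : Eˣ) : E) * (z * z) =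
        algebraMap F E (Algebra.norm F (z : E)) := by
      have : incl F E (Units.map (Algebra.norm F (S := E)) z) * z⁻¹ / z * (z * z) =
          incl F E (Units.map (Algebra.norm F (S := E)) z) := by
        rw [← mul_assoc, div_mul_cancel, inv_mul_cancel_right]
      exact congrArg Units.val this
    have e : normalizedAbs p E
        ((incl F E (Units.map (Algebra.norm F (S := E)) z) * z⁻¹ / z : Eˣ) : E) *
        normalizedAbs p E z ^ 2 = normalizedAbs p E z ^ 2 := by
      have := congrArg (normalizedAbs p E) hu
      rwa [normalizedAbs_mul, normalizedAbs_mul, ← sq, normalizedAbs_algebraMap_norm p h2] at this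
    have e' := mul_right_cancel₀ (pow_ne_zero 2 hz) (e.trans (one_mul _).symm)
    ext
    rw [absPow_apply, e', Real.one_rpow]
    simp
  rw [torusChar_apply, borelChar, h, mul_one, map_mul, map_inv]

theorem isSmoothChar_torusChar {χ₁ χ₂ : Eˣ →* ℂˣ} (B : QuadraticBasis F E)
    (h₁ : IsSmoothChar χ₁) (h₂ : IsSmoothChar χ₂) : IsSmoothChar (torusChar p F χ₁ χ₂) := by
  refine Subgroup.isOpen_of_mem_nhds _ (g := 1) ?_
  have hc : Continuous fun z : Eˣ =>
      (incl F E (Units.map (Algebra.norm F (S := E)) z) * z⁻¹, z) := by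
    have hn : Continuous fun z : Eˣ => Units.map (Algebra.norm F (S := E)) z := by
      simp only [← B.torus_det]
      exact Matrix.GeneralLinearGroup.continuous_det.comp (B.continuous_torus p)
    have hi : Continuous (incl F E) :=
      Continuous.units_map _ (continuous_algebraMap F E)
    exact ((hi.comp hn).mul continuous_inv).prodMk continuous_id
  have ht := hc.tendsto 1
  simp only [map_one, inv_one, mul_one] at ht
  exact ht.eventually (eventually_borelChar p h₁ h₂)

theorem torusChar_incl (x : Fˣ) (h2 : Module.finrank F E = 2) :
    torusChar p F χ₁ χ₂ (incl F E x) = χ₁ (incl F E x) * χ₂ (incl F E x) := by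
  have : Units.map (Algebra.norm F (S := E)) (incl F E x) = x * x := by
    have : FiniteDimensional F E := FiniteDimensional.of_finrank_pos (by omega)
    ext
    simp only [incl, Units.coe_map, MonoidHom.coe_coe, Algebra.norm_algebraMap, h2, Units.val_mul, sq]
  rw [torusChar_eq p χ₁ χ₂ h2, this, map_mul, map_mul, mul_inv_cancel_right]

theorem absPow_half_incl (h2 : Module.finrank F E = 2) (a : Fˣ) :
    (absPow p E (1 / 2) (incl F E a) : ℂ) = normalizedAbs p F a := by
  rw [absPow_apply]
  change (((normalizedAbs p E (algebraMap F E a)) ^ (1 / 2 : ℝ) : ℝ) : ℂ) = _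
  rw [normalizedAbs_algebraMap p h2, ← Real.sqrt_eq_rpow, Real.sqrt_sq (normalizedAbs_pos p a).le]

theorem borelChar_incl_left (h2 : Module.finrank F E = 2) (a : Fˣ) :
    (borelChar p χ₁ χ₂ (incl F E a) 1 : ℂ) = χ₁ (incl F E a) * normalizedAbs p F a := by
  rw [borelChar, map_one, mul_one, div_one, Units.val_mul, absPow_half_incl p h2]

theorem borelChar_incl_right (h2 : Module.finrank F E = 2) (a : Fˣ) :
    (borelChar p χ₁ χ₂ 1 (incl F E a)⁻¹ : ℂ) = (χ₂ (incl F E a))⁻¹ * normalizedAbs p F a := by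
  rw [borelChar, map_one, one_mul, div_inv_eq_mul, one_mul, Units.val_mul, absPow_half_incl p h2,
    map_inv, Units.val_inv_eq_inv_val]

end TorusChar

section Orbits

/-- The two orbits of `GL₂(F)` on the projective line over `E`. -/
theorem orbits (h : GL (Fin 2) E) :
    (∃ (d : Eˣ) (a : Fˣ) (x : F), h 1 0 = d * (algebraMap F E x + algebraMap F E a * B.τ) ∧
      h 1 1 = d) ∨
    (∃ (d : Eˣ) (g : GL (Fin 2) F), h 1 0 = d * inclGL F E g 1 0 ∧ h 1 1 = d * inclGL F E g 1 1) := by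
  by_cases h1 : h 1 1 = 0
  · refine Or.inr ⟨Units.mk0 _ (gl_row_ne_zero h h1), swapGL F, ?_, ?_⟩ <;>
      simp [h1]
  set z := h 1 0 / h 1 1 with hz
  have hzd : h 1 0 = h 1 1 * z := by rw [hz, mul_div_cancel₀ _ h1]
  by_cases hi : B.im z = 0
  · refine Or.inr ⟨Units.mk0 _ h1, lowerGL (B.re z), ?_, ?_⟩
    · rw [inclGL_apply, lowerGL_10, hzd]
      conv_lhs => rw [B.eq_re_im z, hi]
      simp
    · simp
  · refine Or.inl ⟨Units.mk0 _ h1, Units.mk0 _ hi, B.re z, ?_, rfl⟩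
    rw [Units.val_mk0, Units.val_mk0, ← B.eq_re_im, hzd]

/-- The bottom row of `γ` times a lower triangular matrix over `F`. -/
theorem γ_diag_lower_10 (a : Fˣ) (x : F) :
    (B.γ * inclGL F E (diagGL a 1 * lowerGL x)) 1 0 =
      algebraMap F E x + algebraMap F E a * B.τ := by
  rw [γ_mul_10, gl_mul_apply, gl_mul_apply]
  simp
  ring

theorem γ_diag_lower_11 (a : Fˣ) (x : F) :
    (B.γ * inclGL F E (diagGL a 1 * lowerGL x)) 1 1 = 1 := by
  rw [γ_mul_11, gl_mul_apply, gl_mul_apply]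
  simp

end Orbits

/-! ### The functional attached to an intertwiner. -/

section Intertwiner

variable {χ₁ χ₂ : Eˣ →* ℂˣ} (Φ : FlagSpace p F →ₗ[ℂ] principalSeriesSpace p E χ₁ χ₂)

/-- Evaluation at the representative of the open orbit. -/
noncomputable def evalγ : FlagSpace p F →ₗ[ℂ] ℂ where
  toFun φ := (Φ φ).1 B.γ
  map_add' _ _ := by rw [map_add]; rfl
  map_smul' _ _ := by rw [map_smul]; rfl

theorem evalγ_apply (φ : FlagSpace p F) : B.evalγ p Φ φ = (Φ φ).1 B.γ := rfl

variable {Φ} (hΦ : ∀ (g : GL (Fin 2) F) (φ : FlagSpace p F) (h : GL (Fin 2) E),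
  (Φ (flagRep p F g φ)).1 h = (Φ φ).1 (h * inclGL F E g))

include hΦ

theorem equivariant_evalγ : B.Equivariant p (torusChar p F χ₁ χ₂) (B.evalγ p Φ) := by
  intro z φ
  rw [evalγ_apply, hΦ, apply_of_row p (Φ φ).2 (B.γ_torus_10 z) (B.γ_torus_11 z), γ_mul_det,
    torus_det, γ, lowerGL_det, inv_one, mul_one]
  rfl

/-- Vanishing at γ spreads over the open orbit by equivariance. The points `lowerGL (aτ)` of that
orbit tend to 1, so smoothness gives vanishing at 1, and equivariance again gives it on the closed
orbit. -/
theorem eq_zero_of_evalγ (h0 : B.evalγ p Φ = 0) : Φ = 0 := by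
  have hopen : ∀ φ g, (Φ φ).1 (B.γ * inclGL F E g) = 0 := fun φ g => by
    rw [← hΦ, ← evalγ_apply, h0, LinearMap.zero_apply]
  have hone : ∀ φ, (Φ φ).1 1 = 0 := fun φ => by
    have ht : Tendsto (fun a : F => lowerGL (algebraMap F E a * B.τ)) (𝓝 0) (𝓝 1) := by
      have hc : Continuous fun a : F => lowerGL (algebraMap F E a * B.τ) :=
        continuous_lowerGL.comp ((continuous_algebraMap F E).mul continuous_const)
      have := hc.tendsto 0
      rwa [map_zero, zero_mul, lowerGL_zero] at this
    obtain ⟨ε, hε, h⟩ := Metric.eventually_nhds_iff.1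
      (ht.eventually ((mem_principalSeriesSpace p).1 (Φ φ).2).2)
    obtain ⟨a, ha⟩ := exists_unit_norm_le p (F := F) (half_pos hε)
    have := h (y := a) (by rw [dist_zero_right]; linarith) 1
    rw [one_mul] at this
    rw [← this, apply_of_row p (Φ φ).2 (h' := B.γ * inclGL F E (diagGL a 1 * lowerGL 0)) (d := 1),
      hopen, mul_zero]
    · rw [γ_diag_lower_10, lowerGL_10]
      simp
    · rw [γ_diag_lower_11, lowerGL_11]
      simp
  refine LinearMap.ext fun φ => Subtype.ext (funext fun h => ?_)
  rcases B.orbits h with ⟨d, a, x, h0, h1⟩ | ⟨d, g, h0, h1⟩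
  · rw [apply_of_row p (Φ φ).2 (h' := B.γ * inclGL F E (diagGL a 1 * lowerGL x)) (d := d),
      hopen, mul_zero]
    · rfl
    · rw [γ_diag_lower_10, h0]
    · rw [γ_diag_lower_11, h1, mul_one]
  · rw [apply_of_row p (Φ φ).2 h0 h1, ← one_mul (inclGL F E g), ← hΦ, hone, mul_zero]
    rfl

/-- The values at small balls of the functional attached to an intertwiner. -/
theorem exists_evalγ_flagBall (h2 : Module.finrank F E = 2) (h₁ : IsSmoothChar χ₁)
    (h₂ : IsSmoothChar χ₂) : ∃ C : ℂ, ∃ ε > 0, ∃ κ : F → ℂˣ,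
    (∀ x : F, ‖x‖ ≤ ε → κ x = κ 0) ∧ ∀ (x : F) (a : Fˣ), ‖(a : F)‖ ≤ ε →
      B.evalγ p Φ (flagBall p x a) =
        κ x * ((χ₂ (incl F E a))⁻¹ * normalizedAbs p F a) * C := by
  set f := Φ (flagBall p 0 1) with hf
  have hs : ∀ x : F, B.τ - algebraMap F E x ≠ 0 := fun x => by
    have := B.add_ne_zero_of_right (x := -x) one_ne_zero
    rwa [map_neg, map_one, one_mul, neg_add_eq_sub] at this
  set s : F → Eˣ := fun x => Units.mk0 _ (hs x) with hsdef
  have hsv : ∀ x, (s x : E) = B.τ - algebraMap F E x := fun x => rfl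
  obtain ⟨M, hM, hMb⟩ := B.exists_repr_bound p
  -- The τ-coordinate of τ - x is 1, so its norm is bounded below independently of x. This makes the
  -- final ε uniform in x, which is needed when C = 0.
  have hsM : ∀ x, 1 ≤ M * ‖(s x : E)‖ := fun x => by
    have h := hMb (s x) 0
    have : B.b.repr (s x) 0 = 1 := by
      rw [hsv]
      have := B.im_add (-x) 1
      rwa [map_neg, map_one, one_mul, neg_add_eq_sub] at this
    rwa [this, norm_one] at h
  obtain ⟨ε₁, hε₁, hC⟩ : ∃ ε > 0, ∀ z : E, ‖z‖ ≤ ε →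
      f.1 (lowerGL z * swapGL E) = f.1 (swapGL E) := by
    have hc : Tendsto (lowerGL : E → GL (Fin 2) E) (𝓝 0) (𝓝 1) := by
      rw [← lowerGL_zero]
      exact continuous_lowerGL.tendsto 0
    obtain ⟨ε, hε, h⟩ := Metric.eventually_nhds_iff.1 (hc.eventually ((mem_principalSeriesSpace p).1
      (principalSeries p E χ₁ χ₂ (swapGL E) f).2).2)
    refine ⟨ε / 2, by positivity, fun z hz => ?_⟩
    have h3 : f.1 (1 * lowerGL z * swapGL E) = f.1 (1 * swapGL E) :=
      h (y := z) (by rw [dist_zero_right]; linarith) 1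
    rwa [one_mul, one_mul] at h3
  obtain ⟨ε₂, hε₂, hκ⟩ : ∃ ε > 0, ∀ u : Eˣ, ‖(u : E) - 1‖ ≤ ε → borelChar p χ₁ χ₂ u⁻¹ u = 1 := by
    refine exists_unit_nhds ?_
    have hc : Continuous fun u : Eˣ => (u⁻¹, u) := continuous_inv.prodMk continuous_id
    have ht := hc.tendsto 1
    rw [inv_one] at ht
    exact ht.eventually (eventually_borelChar p h₁ h₂)
  have hτ : 0 < ‖B.τ‖ := norm_pos_iff.2 B.τ_ne_zero
  refine ⟨f.1 (swapGL E), min (ε₁ / M) (ε₂ * ‖B.τ‖), by positivity,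
    fun x => borelChar p χ₁ χ₂ (-(s x)⁻¹) (s x), fun x hx => ?_, fun x a ha => ?_⟩
  · have hsx : ‖((s x * (s 0)⁻¹ : Eˣ) : E) - 1‖ ≤ ε₂ := by
      have : ((s x * (s 0)⁻¹ : Eˣ) : E) - 1 = - (algebraMap F E x / B.τ) := by
        rw [Units.val_mul, Units.val_inv_eq_inv_val, hsv, hsv, map_zero, sub_zero]
        field_simp [B.τ_ne_zero]
        ring
      rw [this, norm_neg, norm_div, norm_algebraMap', div_le_iff₀ hτ]
      exact hx.trans (min_le_right _ _)
    have h3 := hκ _ hsx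
    have h4 := borelChar_mul p χ₁ χ₂ (s x * (s 0)⁻¹)⁻¹ (s x * (s 0)⁻¹) (-(s 0)⁻¹) (s 0)
    rw [h3, one_mul, inv_mul_cancel_right] at h4
    change borelChar p χ₁ χ₂ (-(s x)⁻¹) (s x) = borelChar p χ₁ χ₂ (-(s 0)⁻¹) (s 0)
    rw [← h4]
    congr 1
    rw [mul_inv, inv_inv, mul_assoc, mul_neg, mul_inv_cancel, mul_neg, mul_one]
  · have ha0 : 0 < ‖(a : F)‖ := norm_pos_iff.2 a.ne_zero
    -- Every ball is a translate of the unit ball by `GL₂(F)`. Moving the translation to γ gives the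
    -- point [1 : a / (τ - x)], which approaches infinity as a → 0, and there `f` is locally
    -- constant.
    have hball : flagRep p F (lowerGL (-x) * diagGL a⁻¹ 1) (flagBall p 0 1) = flagBall p x a := by
      refine flagRep_flagBall p fun k => ?_
      have e0 : (k * (lowerGL (-x) * diagGL a⁻¹ 1)) 1 0 = (k 1 0 - x * k 1 1) * (a : F)⁻¹ := by
        simp only [gl_mul_apply]
        simp
        ring
      have e1 : (k * (lowerGL (-x) * diagGL a⁻¹ 1)) 1 1 = k 1 1 := by
        simp only [gl_mul_apply]
        simp
      rw [e0, e1, zero_mul, sub_zero, norm_mul, norm_inv, Units.val_one, norm_one, one_mul,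
        mul_inv_le_iff₀ ha0, mul_comm ‖(a : F)‖]
    set z : E := algebraMap F E a / s x with hz
    have hzε : ‖z‖ ≤ ε₁ := by
      rw [hz, norm_div, norm_algebraMap', div_le_iff₀ (norm_pos_iff.2 (s x).ne_zero)]
      have h3 := ha.trans (min_le_left _ _)
      rw [le_div_iff₀ hM] at h3
      have h4 := hsM x
      have h5 := norm_pos_iff.2 (s x).ne_zero
      have h6 : ‖(a : F)‖ ≤ ‖(a : F)‖ * M * ‖(s x : E)‖ := by
        rw [mul_assoc]
        exact le_mul_of_one_le_right ha0.le h4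
      exact h6.trans (mul_le_mul_of_nonneg_right h3 h5.le)
    rw [evalγ_apply, ← hball, hΦ, ← hf, apply_of_row p f.2 (h' := lowerGL z * swapGL E)
      (d := (incl F E a)⁻¹ * s x), hC z hzε, γ_mul_det, map_mul, map_mul, map_mul, lowerGL_det,
      lowerGL_det, swapGL_det, diagGL_det, ← borelChar_incl_right p χ₁ χ₂ h2, ← Units.val_mul, ← borelChar_mul]
    · congr 3
      · rw [map_one, one_mul, mul_one, mul_one, map_inv, one_mul, inv_neg, inv_one, mul_neg, mul_one, mul_inv,
          inv_inv, neg_mul, inv_mul_cancel_left]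
      · rw [mul_comm]
    · rw [γ_mul_10, gl_mul_apply, gl_mul_apply, gl_mul_apply]
      simp [hsv]
      ring
    · rw [γ_mul_11, gl_mul_apply, gl_mul_apply, gl_mul_apply]
      have hsx := (s x).ne_zero
      have hax : algebraMap F E a ≠ 0 := by simp
      simp [hz]
      field_simp

/-- If `χ₂` is nontrivial on `Fˣ`, the functional attached to an intertwiner that kills the
constants vanishes. -/
theorem evalγ_eq_zero (h2 : Module.finrank F E = 2) (h₁ : IsSmoothChar χ₁)
    (h₂ : IsSmoothChar χ₂) (hconst : Φ ⟨1, one_mem_principalSeriesSpace p F⟩ = 0)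
    (hne : ∃ x : Fˣ, χ₂ (incl F E x) ≠ 1) : B.evalγ p Φ = 0 := by
  obtain ⟨C, ε, hε, κ, hκ, hball⟩ := B.exists_evalγ_flagBall p hΦ h2 h₁ h₂
  have hC : C = 0 := by
    by_contra hC
    -- Cut the ball of radius |a| at 0 into |b|⁻¹ balls of radius |ab| (normalized absolute values).
    -- All pieces have equal measure since κ is constant near 0, and comparing with the whole leaves
    -- χ₂(b) = 1.
    have key : ∀ b : Fˣ, ‖(b : F)‖ ≤ 1 → χ₂ (incl F E b) = 1 := by
      intro b hb
      obtain ⟨a, ha⟩ := exists_unit_norm_le p (F := F) hε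
      have hab : ‖((a * b : Fˣ) : F)‖ ≤ ‖(a : F)‖ := by
        rw [Units.val_mul, norm_mul]
        exact mul_le_of_le_one_right (norm_nonneg _) hb
      obtain ⟨s, hs⟩ := exists_isBallReps p F ‖(a : F)‖ (norm_pos_iff.2 (a * b).ne_zero)
      have hcard := hs.card_mul p a.ne_zero (a * b).ne_zero hab
      have h3 := congrArg (B.evalγ p Φ) (flagBall_eq_sum p hs hab)
      rw [map_sum, hball 0 a ha, Finset.sum_congr rfl fun x hx => by
        rw [hball x (a * b) (hab.trans ha), hκ x ((hs.1 x hx).trans ha)], Finset.sum_const,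
        nsmul_eq_mul] at h3
      simp only [Units.val_inv_eq_inv_val] at h3
      have ha0 : (normalizedAbs p F a : ℂ) ≠ 0 := by
        exact_mod_cast (normalizedAbs_pos p a).ne'
      have hcard' : (s.card : ℂ) * normalizedAbs p F ((a * b : Fˣ) : F) = normalizedAbs p F a := by
        exact_mod_cast hcard
      have hκ0 := (κ 0).ne_zero
      have hχa := (χ₂ (incl F E a)).ne_zero
      have hχb := (χ₂ (incl F E b)).ne_zero
      have h4 : κ 0 * ((χ₂ (incl F E a) : ℂ)⁻¹ * normalizedAbs p F a) * C =
          κ 0 * ((χ₂ (incl F E a) : ℂ)⁻¹ * (χ₂ (incl F E b) : ℂ)⁻¹ * normalizedAbs p F a) * C := by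
        rw [h3, ← hcard', map_mul, map_mul, Units.val_mul, mul_inv]
        ring
      ext
      rw [Units.val_one]
      field_simp at h4
      exact h4
    obtain ⟨x, hx⟩ := hne
    rcases le_total ‖(x : F)‖ 1 with h | h
    · exact hx (key x h)
    · have := key x⁻¹ (by rw [Units.val_inv_eq_inv_val, norm_inv]; exact inv_le_one_of_one_le₀ h)
      rw [map_inv, map_inv, inv_eq_one] at this
      exact hx this
  subst hC
  simp only [mul_zero] at hball
  set c : FlagSpace p F := ⟨1, one_mem_principalSeriesSpace p F⟩
  -- With C = 0 the functional kills all small balls, hence every function that vanishes at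
  -- infinity; such functions and the constants span the space.
  have hvan : ∀ ψ : FlagSpace p F, ψ.1 (swapGL F) = 0 → B.evalγ p Φ ψ = 0 := by
    intro ψ hψ
    obtain ⟨R, hR, hsupp⟩ := exists_support_bound p hψ
    obtain ⟨δ, hδ, hinv⟩ := exists_flagRep_lowerGL_eq p ψ
    obtain ⟨r, hr⟩ := exists_unit_norm_le p (F := F) (lt_min hε (lt_min hR hδ))
    have hr1 := hr.trans (min_le_left _ _)
    have hr2 := hr.trans ((min_le_right _ _).trans (min_le_left _ _))
    have hr3 := hr.trans ((min_le_right _ _).trans (min_le_right _ _))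
    obtain ⟨s, hs⟩ := exists_isBallReps p F R (norm_pos_iff.2 r.ne_zero)
    rw [flag_eq_sum_flagBall p hs hr2 hsupp fun y hy => hinv y (hy.trans hr3), map_sum]
    refine Finset.sum_eq_zero fun x _ => ?_
    rw [map_smul, hball x r hr1, smul_zero]
  ext φ
  have h3 := hvan (φ - φ.1 (swapGL F) • c) (by
    change φ.1 (swapGL F) - φ.1 (swapGL F) * 1 = 0
    ring)
  have h4 : B.evalγ p Φ c = 0 := by
    rw [evalγ_apply, hconst]
    rfl
  rwa [map_sub, map_smul, h4, smul_zero, sub_zero] at h3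

end Intertwiner

end QuadraticBasis

/-! ### Local behaviour of equivariant functionals. -/

namespace QuadraticBasis

open Filter Topology

variable (p : ℕ) [Fact p.Prime] {F E : Type*} [NormedField F] [NormedField E]
  [NormedAlgebra ℚ_[p] F] [FiniteDimensional ℚ_[p] F] [NormedAlgebra ℚ_[p] E]
  [FiniteDimensional ℚ_[p] E] [NormedAlgebra F E] [IsScalarTower ℚ_[p] F E]
  (B : QuadraticBasis F E)

section LocalInvariance

variable {θ : Eˣ →* ℂˣ} {l : FlagSpace p F →ₗ[ℂ] ℂ}

/-- The element of `Eˣ` with given coordinates. -/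
noncomputable def unitOf (x y : F) (h : x ≠ 0 ∨ y ≠ 0) : Eˣ :=
  Units.mk0 (algebraMap F E x + algebraMap F E y * B.τ)
    (h.elim B.add_ne_zero_of_left B.add_ne_zero_of_right)

theorem unitOf_val (x y : F) (h : x ≠ 0 ∨ y ≠ 0) :
    (B.unitOf x y h : E) = algebraMap F E x + algebraMap F E y * B.τ := rfl

theorem norm_le_of_shear {K : Type*} [NormedField K] [IsUltrametricDist K] {c d w : K} {r : ℝ}
    (hr : 0 < r) (hw : r * ‖w‖ < 1) (h : ‖c‖ ≤ r * ‖d‖) : ‖c‖ ≤ r * ‖c * w + d‖ := by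
  by_contra! hlt
  have hc : 0 < ‖c‖ := lt_of_le_of_lt (by positivity) hlt
  have h1 := norm_sub_le_max_of_ultrametric (c * w + d) (c * w)
  rw [add_sub_cancel_left, norm_mul] at h1
  rcases le_max_iff.1 h1 with h2 | h2
  · nlinarith
  · have : r * ‖d‖ ≤ ‖c‖ * (r * ‖w‖) := by
      calc r * ‖d‖ ≤ r * (‖c‖ * ‖w‖) := by gcongr
        _ = _ := by ring
    nlinarith

theorem norm_shear_iff {K : Type*} [NormedField K] [IsUltrametricDist K] {c d w : K} {r : ℝ}
    (hr : 0 < r) (hw : r * ‖w‖ < 1) : ‖c‖ ≤ r * ‖c * w + d‖ ↔ ‖c‖ ≤ r * ‖d‖ := by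
  refine ⟨fun h => ?_, norm_le_of_shear hr hw⟩
  have := norm_le_of_shear (w := -w) hr (by rwa [norm_neg]) h
  rwa [mul_neg, neg_add_cancel_left] at this

/-- Small balls of the same radius near `0` have the same measure. -/
theorem exists_flagBall_invariant (hθ : IsSmoothChar θ) (hl : B.Equivariant p θ l) :
    ∃ ρ > 0, ∀ (y : F) (r : Fˣ), ‖y‖ ≤ ρ → ‖(r : F)‖ ≤ ρ →
      l (flagBall p y r) = l (flagBall p 0 r) := by
  have := isUltrametricDist_of_padic p F
  obtain ⟨ε, hε, h1⟩ := exists_unit_nhds hθ.eventually_eq_one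
  have hD := norm_pos_iff.2 B.D_ne_zero
  have hτ := norm_pos_iff.2 B.τ_ne_zero
  -- The first two bounds make 1 - y²/D a unit of norm 1 and allow `norm_shear_iff`; the third
  -- brings z = 1 + (y/D)τ so close to 1 that θ(z) = 1.
  refine ⟨min (min (1 / 2) (‖B.D‖ / 2)) (ε * ‖B.D‖ / ‖B.τ‖), by positivity, fun y r hy hr => ?_⟩
  have hr0 : 0 < ‖(r : F)‖ := norm_pos_iff.2 r.ne_zero
  have hy1 := hy.trans ((min_le_left _ _).trans (min_le_left _ _))
  have hy2 := hy.trans ((min_le_left _ _).trans (min_le_right _ _))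
  have hr1 := hr.trans ((min_le_left _ _).trans (min_le_left _ _))
  set z := B.unitOf 1 (y / B.D) (Or.inl one_ne_zero)
  have hz : θ z = 1 := by
    refine h1 z ?_
    rw [unitOf_val, map_one, add_sub_cancel_left, norm_mul, norm_algebraMap', norm_div,
      div_mul_eq_mul_div, div_le_iff₀ hD, ← le_div_iff₀ hτ]
    exact hy.trans (min_le_right _ _)
  have hyD : ‖y / B.D‖ ≤ 1 / 2 := by
    rw [norm_div, div_le_iff₀ hD]
    linarith
  -- The matrix of z acts by the homography c/d ↦ (c/d + y) / (1 + (y/D) c/d), which takes 0 to y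
  -- and small balls at 0 to balls at y of the same radius.
  have hball : flagRep p F (B.torus z) (flagBall p y r) = flagBall p 0 r := by
    refine flagRep_flagBall p fun k => ?_
    have e1 : (k * B.torus z) 1 1 = k 1 0 * (y / B.D) + k 1 1 := by
      rw [gl_mul_apply, torus_01, torus_11, unitOf_val, re_add, im_add, mul_one]
    have e0 : (k * B.torus z) 1 0 = k 1 0 + k 1 1 * y := by
      rw [gl_mul_apply, torus_00, torus_10, unitOf_val, re_add, im_add, mul_one,
        mul_div_cancel₀ _ B.D_ne_zero]
    have e2 : ‖k 1 0 + k 1 1 * y - y * (k 1 0 * (y / B.D) + k 1 1)‖ = ‖k 1 0‖ := by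
      rw [show k 1 0 + k 1 1 * y - y * (k 1 0 * (y / B.D) + k 1 1) =
        k 1 0 * (1 + -(y * (y / B.D))) by ring, norm_mul]
      have hlt : ‖-(y * (y / B.D))‖ < ‖(1 : F)‖ := by
        rw [norm_neg, norm_mul, norm_one]
        nlinarith [norm_nonneg y, norm_nonneg (y / B.D)]
      rw [IsUltrametricDist.norm_add_eq_max_of_norm_ne_norm hlt.ne', max_eq_left hlt.le, norm_one,
        mul_one]
    rw [e0, e1, e2, zero_mul, sub_zero]
    refine norm_shear_iff hr0 ?_
    nlinarith [norm_nonneg (y / B.D)]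
  rw [← hball, hl, hz, Units.val_one, one_mul]

/-- Near `0` an equivariant functional is proportional to the Haar measure. -/
theorem exists_flagBall_eq (hθ : IsSmoothChar θ) (hl : B.Equivariant p θ l) :
    ∃ C : ℂ, ∃ ρ > 0, ∀ (y : F) (r : Fˣ), ‖y‖ ≤ ρ → ‖(r : F)‖ ≤ ρ →
      l (flagBall p y r) = normalizedAbs p F r * C := by
  obtain ⟨ρ, hρ, h⟩ := B.exists_flagBall_invariant p hθ hl
  obtain ⟨r₀, hr₀⟩ := exists_unit_norm_le p (F := F) hρ
  have hn : (normalizedAbs p F r₀ : ℂ) ≠ 0 := by exact_mod_cast (normalizedAbs_pos p r₀).ne'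
  refine ⟨l (flagBall p 0 r₀) / normalizedAbs p F r₀, ‖(r₀ : F)‖, norm_pos_iff.2 r₀.ne_zero,
    fun y r hy hr => ?_⟩
  rw [h y r (hy.trans hr₀) (hr.trans hr₀)]
  obtain ⟨s, hs⟩ := exists_isBallReps p F ‖(r₀ : F)‖ (norm_pos_iff.2 r.ne_zero)
  have hcard : (s.card : ℂ) * normalizedAbs p F (r : F) = normalizedAbs p F r₀ := by
    exact_mod_cast hs.card_mul p r₀.ne_zero r.ne_zero hr
  have h3 : l (flagBall p 0 r₀) = s.card * l (flagBall p 0 r) := by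
    rw [flagBall_eq_sum p hs hr, map_sum, Finset.sum_congr rfl fun x hx =>
      h x r ((hs.1 x hx).trans hr₀) (hr.trans hr₀), Finset.sum_const, nsmul_eq_mul]
  rw [h3, mul_div_assoc', eq_div_iff hn, ← hcard]
  ring

/-- The behaviour of an equivariant functional that kills the constants under dilations. -/
theorem exists_dilation_eq (hθ : IsSmoothChar θ) (hl : B.Equivariant p θ l)
    (hconst : l ⟨1, one_mem_principalSeriesSpace p F⟩ = 0) (φ : FlagSpace p F) :
    ∃ C : ℂ, ∃ ε > 0, ∀ a : Fˣ, ‖(a : F)‖ ≤ ε →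
      l (flagRep p F (diagGL a 1) φ) = normalizedAbs p F a * C := by
  set c : FlagSpace p F := ⟨1, one_mem_principalSeriesSpace p F⟩
  -- Constants are fixed by `GL₂(F)` and killed by l, so φ may be replaced by a function that
  -- vanishes at the point [0 : 1].
  set ψ := φ - φ.1 1 • c with hψ
  have hψ1 : ψ.1 1 = 0 := by
    change φ.1 1 - φ.1 1 * 1 = 0
    ring
  have hlψ : ∀ g, l (flagRep p F g φ) = l (flagRep p F g ψ) := fun g => by
    have hc : flagRep p F g c = c := rfl
    rw [hψ, map_sub, map_smul, hc, map_sub, map_smul, hconst, smul_zero, sub_zero]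
  -- The element τ/D of the torus exchanges 0 and infinity and turns `diagGL a 1` into `diagGL 1 a`.
  -- The function φ' then has bounded support, which `diagGL 1 a` shrinks into the region where l is
  -- a Haar measure.
  set κ := B.unitOf 0 B.D⁻¹ (Or.inr (inv_ne_zero B.D_ne_zero))
  set φ' := flagRep p F (B.torus κ) ψ with hφ'
  have k00 : B.torus κ 0 0 = 0 := by rw [torus_00, unitOf_val, re_add]
  have k01 : B.torus κ 0 1 = B.D⁻¹ := by rw [torus_01, unitOf_val, im_add]
  have k10 : B.torus κ 1 0 = 1 := by rw [torus_10, unitOf_val, im_add, mul_inv_cancel₀ B.D_ne_zero]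
  have k11 : B.torus κ 1 1 = 0 := by rw [torus_11, unitOf_val, re_add]
  have hφ's : φ'.1 (swapGL F) = 0 := by
    rw [hφ', flagRep_apply, ← hψ1]
    refine flag_apply_of_row p ψ (inv_ne_zero B.D_ne_zero) ?_ ?_ <;>
      simp [gl_mul_apply, k00, k01]
  obtain ⟨R, hR, hsupp⟩ := exists_support_bound p hφ's
  obtain ⟨δ, hδ, hinv⟩ := exists_flagRep_lowerGL_eq p φ'
  obtain ⟨r, hr⟩ := exists_unit_norm_le p (F := F) (lt_min hR hδ)
  obtain ⟨s, hs⟩ := exists_isBallReps p F R (norm_pos_iff.2 r.ne_zero)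
  have hsum := flag_eq_sum_flagBall p hs (hr.trans (min_le_left _ _)) hsupp
    fun y hy => hinv y (hy.trans (hr.trans (min_le_right _ _)))
  obtain ⟨C, ρ, hρ, hball⟩ := B.exists_flagBall_eq p hθ hl
  refine ⟨(θ κ : ℂ)⁻¹ * ∑ x ∈ s, φ'.1 (lowerGL x) * (normalizedAbs p F r * C), ρ / R,
    by positivity, fun a ha => ?_⟩
  rw [le_div_iff₀ hR] at ha
  have h1 : l (flagRep p F (diagGL 1 a) φ') =
      normalizedAbs p F a * ∑ x ∈ s, φ'.1 (lowerGL x) * (normalizedAbs p F r * C) := by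
    conv_lhs => rw [hsum]
    rw [map_sum, map_sum, Finset.mul_sum]
    refine Finset.sum_congr rfl fun x hx => ?_
    have hb : flagRep p F (diagGL 1 a) (flagBall p x r) = flagBall p (a * x) (a * r) := by
      refine flagRep_flagBall p fun k => ?_
      have e0 : (k * diagGL 1 a) 1 0 = k 1 0 := by simp [gl_mul_apply]
      have e1 : (k * diagGL 1 a) 1 1 = k 1 1 * a := by simp [gl_mul_apply]
      rw [e0, e1, norm_mul, Units.val_mul, norm_mul, show x * (k 1 1 * a) = a * x * k 1 1 by ring,
        show ‖(r : F)‖ * (‖k 1 1‖ * ‖(a : F)‖) = ‖(a : F)‖ * ‖(r : F)‖ * ‖k 1 1‖ by ring]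
    rw [map_smul, map_smul, hb, hball, Units.val_mul, normalizedAbs_mul, smul_eq_mul]
    · push_cast
      ring
    · rw [norm_mul]
      exact (mul_le_mul_of_nonneg_left (hs.1 x hx) (norm_nonneg _)).trans ha
    · rw [Units.val_mul, norm_mul]
      exact (mul_le_mul_of_nonneg_left (hr.trans (min_le_left _ _)) (norm_nonneg _)).trans ha
  have h2 : B.torus κ * diagGL a 1 = diagGL 1 a * B.torus κ := by
    apply gl_ext <;> simp only [gl_mul_apply, k00, k01, k10, k11] <;> simp
  have h3 := hl κ (flagRep p F (diagGL a 1) ψ)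
  rw [← Module.End.mul_apply, ← map_mul, h2, map_mul, Module.End.mul_apply, h1] at h3
  rw [hlψ, ← mul_assoc, mul_comm _ (θ κ : ℂ)⁻¹, mul_assoc, h3, inv_mul_cancel_left₀ (θ κ).ne_zero]

end LocalInvariance

/-! ### From an equivariant functional to a function on the open orbit. -/

section OpenOrbit

/-- The bottom row of `h` is `d` times that of `γ g`. -/
def RowRel (h : GL (Fin 2) E) (d : Eˣ) (g : GL (Fin 2) F) : Prop :=
  h 1 0 = d * (B.γ * inclGL F E g) 1 0 ∧ h 1 1 = d * (B.γ * inclGL F E g) 1 1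

/-- The points of the open orbit. -/
def IsOpenPt (h : GL (Fin 2) E) : Prop := ∃ d g, B.RowRel h d g

variable {B}

theorem RowRel.mul_inclGL {h : GL (Fin 2) E} {d : Eˣ} {g : GL (Fin 2) F} (H : B.RowRel h d g)
    (k : GL (Fin 2) F) : B.RowRel (h * inclGL F E k) d (g * k) := by
  constructor <;> rw [map_mul, ← mul_assoc, gl_mul_apply, gl_mul_apply (B.γ * _), H.1, H.2] <;> ring

theorem RowRel.of_row {h h' : GL (Fin 2) E} {d e : Eˣ} {g : GL (Fin 2) F} (H : B.RowRel h d g)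
    (h0 : h' 1 0 = e * h 1 0) (h1 : h' 1 1 = e * h 1 1) : B.RowRel h' (e * d) g :=
  ⟨by rw [Units.val_mul]; linear_combination h0 + (e : E) * H.1,
    by rw [Units.val_mul]; linear_combination h1 + (e : E) * H.2⟩

theorem IsOpenPt.mul_inclGL {h : GL (Fin 2) E} (H : B.IsOpenPt h) (k : GL (Fin 2) F) :
    B.IsOpenPt (h * inclGL F E k) := by
  obtain ⟨d, g, H⟩ := H
  exact ⟨_, _, H.mul_inclGL k⟩

theorem IsOpenPt.of_row {h h' : GL (Fin 2) E} {e : Eˣ} (H : B.IsOpenPt h)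
    (h0 : h' 1 0 = e * h 1 0) (h1 : h' 1 1 = e * h 1 1) : B.IsOpenPt h' := by
  obtain ⟨d, g, H⟩ := H
  exact ⟨_, _, H.of_row h0 h1⟩

/-- The stabilizer of [τ : 1] in `GL₂(F)` is the torus: a matrix over `F` that multiplies the row
(τ, 1) by z is the matrix of multiplication by z in the basis (τ, 1). -/
theorem RowRel.eq_torus_mul {h : GL (Fin 2) E} {d d' : Eˣ} {g g' : GL (Fin 2) F}
    (H : B.RowRel h d g) (H' : B.RowRel h d' g') : g = B.torus (d⁻¹ * d') * g' := by
  set z := d⁻¹ * d' with hz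
  have hd : (d' : E) = d * z := by rw [hz, ← Units.val_mul, mul_inv_cancel_left]
  obtain ⟨m, hm⟩ : ∃ m, m = g * g'⁻¹ := ⟨_, rfl⟩
  have hg : g = m * g' := by rw [hm, inv_mul_cancel_right]
  have H1 := H.mul_inclGL g'⁻¹
  have H2 := H'.mul_inclGL g'⁻¹
  rw [← hm] at H1
  rw [mul_inv_cancel] at H2
  have e0 := H1.1.symm.trans H2.1
  have e1 := H1.2.symm.trans H2.2
  rw [γ_mul_10, γ_mul_10, hd, mul_assoc] at e0
  rw [γ_mul_11, γ_mul_11, hd, mul_assoc] at e1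
  have f0 := mul_left_cancel₀ d.ne_zero e0
  have f1 := mul_left_cancel₀ d.ne_zero e1
  simp only [Units.val_one, Matrix.one_apply_eq, map_one, mul_one] at f0 f1
  rw [Matrix.one_apply_ne (by decide), map_zero] at f0 f1
  rw [mul_zero, zero_add, mul_one] at f1
  rw [add_zero] at f0
  have r1 : B.re z = m 1 1 := by
    rw [← f1, add_comm, mul_comm, re_add]
  have i1 : B.im z = m 0 1 := by
    rw [← f1, add_comm, mul_comm, im_add]
  have r2 : B.D * B.im z = m 1 0 := by
    rw [← re_mul_τ, ← f0, add_comm, mul_comm B.τ, re_add]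
  have i2 : B.re z = m 0 0 := by
    rw [← im_mul_τ, ← f0, add_comm, mul_comm B.τ, im_add]
  rw [hg]
  congr 1
  apply gl_ext
  · rw [torus_00, i2]
  · rw [torus_01, i1]
  · rw [torus_10, r2]
  · rw [torus_11, r1]

theorem γ_rowRel : B.RowRel B.γ 1 1 := by simp [RowRel]

theorem RowRel.of_coord {h : GL (Fin 2) E} {d : Eˣ} {a : Fˣ} {x : F}
    (h0 : h 1 0 = d * (algebraMap F E x + algebraMap F E a * B.τ)) (h1 : h 1 1 = d) :
    B.RowRel h d (diagGL a 1 * lowerGL x) :=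
  ⟨by rw [γ_diag_lower_10, h0], by rw [γ_diag_lower_11, h1, mul_one]⟩

/-- If the affine coordinate lay in `F`, the rows of `g` would be proportional. -/
theorem IsOpenPt.im_ne_zero {h : GL (Fin 2) E} (H : B.IsOpenPt h) (h1 : h 1 1 ≠ 0) :
    B.im (h 1 0 / h 1 1) ≠ 0 := by
  obtain ⟨d, g, H0, H1⟩ := H
  intro hi
  set x := B.re (h 1 0 / h 1 1)
  have hx : h 1 0 = algebraMap F E x * h 1 1 := by
    rw [← div_eq_iff h1]
    conv_lhs => rw [B.eq_re_im (h 1 0 / h 1 1), hi, map_zero, zero_mul, add_zero]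
  rw [H0, H1, mul_left_comm] at hx
  have := mul_left_cancel₀ d.ne_zero hx
  rw [γ_mul_10, γ_mul_11] at this
  have h2 : algebraMap F E (g 1 0) + algebraMap F E (g 0 0) * B.τ =
      algebraMap F E (x * g 1 1) + algebraMap F E (x * g 0 1) * B.τ := by
    rw [map_mul, map_mul]
    linear_combination this
  have hr := congrArg B.re h2
  have him := congrArg B.im h2
  rw [re_add, re_add] at hr
  rw [im_add, im_add] at him
  have := g.det.ne_zero
  rw [gl_det_eq, hr, him] at this
  exact this (by ring)

variable (χ₁ χ₂ : Eˣ →* ℂˣ) (l : FlagSpace p F →ₗ[ℂ] ℂ)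

variable (B) in
open Classical in
/-- The function on the open orbit attached to a functional on `FlagSpace`. -/
noncomputable def openVal (φ : FlagSpace p F) (h : GL (Fin 2) E) : ℂ :=
  if H : B.IsOpenPt h then
    borelChar p χ₁ χ₂ (h.det * (incl F E H.choose_spec.choose.det)⁻¹ * H.choose⁻¹) H.choose *
      l (flagRep p F H.choose_spec.choose φ)
  else 0

variable {χ₁ χ₂ l}

/-- Two choices of `g` differ by the torus, and equivariance of l compensates exactly the change of
`borelChar`. This makes `openVal` independent of the choices in its definition. -/
theorem RowRel.value_eq (hl : B.Equivariant p (torusChar p F χ₁ χ₂) l) {h : GL (Fin 2) E}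
    {d d' : Eˣ} {g g' : GL (Fin 2) F} (H : B.RowRel h d g) (H' : B.RowRel h d' g')
    (φ : FlagSpace p F) :
    borelChar p χ₁ χ₂ (h.det * (incl F E g'.det)⁻¹ * d'⁻¹) d' * l (flagRep p F g' φ) =
      borelChar p χ₁ χ₂ (h.det * (incl F E g.det)⁻¹ * d⁻¹) d * l (flagRep p F g φ) := by
  have e := H.eq_torus_mul H'
  set z := d⁻¹ * d' with hz
  have hd' : d' = d * z := by rw [hz, mul_inv_cancel_left]
  rw [e, map_mul, map_mul (flagRep p F), torus_det, Module.End.mul_apply, hl, torusChar_apply,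
    ← mul_assoc, ← Units.val_mul, ← borelChar_mul, hd', map_mul (incl F E)]
  congr 3
  have : ∀ a b c d e : Eˣ, a * b⁻¹ * (c * d)⁻¹ = a * (e * b)⁻¹ * c⁻¹ * (e * d⁻¹) := by
    intro a b c d e
    ext
    push_cast
    field_simp
  exact this _ _ _ _ _

theorem openVal_eq (hl : B.Equivariant p (torusChar p F χ₁ χ₂) l) {h : GL (Fin 2) E} {d : Eˣ}
    {g : GL (Fin 2) F} (H : B.RowRel h d g) (φ : FlagSpace p F) :
    B.openVal p χ₁ χ₂ l φ h = borelChar p χ₁ χ₂ (h.det * (incl F E g.det)⁻¹ * d⁻¹) d *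
      l (flagRep p F g φ) := by
  have Ho : B.IsOpenPt h := ⟨d, g, H⟩
  rw [openVal, dif_pos Ho]
  exact H.value_eq p hl Ho.choose_spec.choose_spec φ

theorem openVal_mul_inclGL (hl : B.Equivariant p (torusChar p F χ₁ χ₂) l) {h : GL (Fin 2) E}
    (H : B.IsOpenPt h) (k : GL (Fin 2) F) (φ : FlagSpace p F) :
    B.openVal p χ₁ χ₂ l φ (h * inclGL F E k) = B.openVal p χ₁ χ₂ l (flagRep p F k φ) h := by
  obtain ⟨d, g, H⟩ := H
  rw [openVal_eq p hl H, openVal_eq p hl (H.mul_inclGL k), map_mul, map_mul, map_mul, map_mul,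
    Module.End.mul_apply, inclGL_det, mul_inv, mul_assoc h.det, mul_comm _ (incl F E k.det)⁻¹,
    mul_inv_cancel_left]

theorem openVal_of_row (hl : B.Equivariant p (torusChar p F χ₁ χ₂) l) {h h' : GL (Fin 2) E}
    (H : B.IsOpenPt h) {e : Eˣ} (h0 : h' 1 0 = e * h 1 0) (h1 : h' 1 1 = e * h 1 1)
    (φ : FlagSpace p F) : B.openVal p χ₁ χ₂ l φ h' =
      borelChar p χ₁ χ₂ (h'.det * h.det⁻¹ * e⁻¹) e * B.openVal p χ₁ χ₂ l φ h := by
  obtain ⟨d, g, H⟩ := H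
  rw [openVal_eq p hl H, openVal_eq p hl (H.of_row h0 h1), ← mul_assoc, ← Units.val_mul,
    ← borelChar_mul]
  congr 3
  rw [mul_inv]
  have : ∀ a b c d e : Eˣ, a * b * (c * d) = a * e⁻¹ * c * (e * b * d) := by
    intro a b c d e
    ext
    push_cast
    field_simp
  exact this _ _ _ _ _

end OpenOrbit

end QuadraticBasis

/-! ### Local constancy up to the closed orbit. -/

namespace QuadraticBasis

open Filter Topology

variable (p : ℕ) [Fact p.Prime] {F E : Type*} [NormedField F] [NormedField E]
  [NormedAlgebra ℚ_[p] F] [FiniteDimensional ℚ_[p] F] [NormedAlgebra ℚ_[p] E]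
  [FiniteDimensional ℚ_[p] E] [NormedAlgebra F E] [IsScalarTower ℚ_[p] F E]
  {B : QuadraticBasis F E}

section LocallyConstant

variable {χ₁ χ₂ : Eˣ →* ℂˣ} {l : FlagSpace p F →ₗ[ℂ] ℂ}

theorem eventually_forall_unit {K : Type*} [NormedField K] {X : Type*} {f : Filter X} {u : X → K}
    (hu : Tendsto u f (𝓝 1)) {P : Kˣ → Prop} (h : ∀ᶠ z in 𝓝 1, P z) :
    ∀ᶠ x in f, ∀ z : Kˣ, (z : K) = u x → P z := by
  obtain ⟨ε, hε, hP⟩ := exists_unit_nhds h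
  filter_upwards [Metric.tendsto_nhds.1 hu ε hε] with x hx z hz
  refine hP z ?_
  rw [hz, ← dist_eq_norm]
  exact hx.le

theorem eventually_borelChar_row (h₁ : IsSmoothChar χ₁) (h₂ : IsSmoothChar χ₂) (z₀ : E) :
    ∀ᶠ k in 𝓝 (lowerGL z₀), ∀ d : Eˣ, (d : E) = k 1 1 →
      borelChar p χ₁ χ₂ (k.det * d⁻¹) d = 1 := by
  have e1 : ∀ᶠ k in 𝓝 (lowerGL z₀), borelChar p χ₁ χ₂ k.det 1 = 1 := by
    have hc : Continuous fun k : GL (Fin 2) E => (k.det, (1 : Eˣ)) :=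
      Matrix.GeneralLinearGroup.continuous_det.prodMk continuous_const
    have ht := hc.tendsto (lowerGL z₀)
    rw [lowerGL_det] at ht
    exact ht.eventually (eventually_borelChar p h₁ h₂)
  have e2 : ∀ᶠ k in 𝓝 (lowerGL z₀), ∀ d : Eˣ, (d : E) = k 1 1 → borelChar p χ₁ χ₂ d⁻¹ d = 1 := by
    refine eventually_forall_unit ?_ ?_
    · have := (continuous_gl_apply (K := E) 1 1).tendsto (lowerGL z₀)
      rwa [lowerGL_11] at this
    · have hc : Continuous fun u : Eˣ => (u⁻¹, u) := continuous_inv.prodMk continuous_id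
      have ht := hc.tendsto 1
      rw [inv_one] at ht
      exact ht.eventually (eventually_borelChar p h₁ h₂)
  filter_upwards [e1, e2] with k h1 h2 d hd
  have := borelChar_mul p χ₁ χ₂ k.det 1 d⁻¹ d
  rwa [one_mul, h1, h2 d hd, one_mul] at this

/-- The point [x + aτ : 1] is γ moved by `diagGL a 1 * lowerGL x`. As χ₁ is trivial on `Fˣ`, the
factor left by `diagGL a 1` is |a|⁻¹ alone. -/
theorem openVal_coord (hl : B.Equivariant p (torusChar p F χ₁ χ₂) l)
    (h2 : Module.finrank F E = 2) (hχ₁ : ∀ x : Fˣ, χ₁ (incl F E x) = 1)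
    {k : GL (Fin 2) E} {d : Eˣ} {a : Fˣ} (h1 : k 1 1 = d) (ha : B.im (k 1 0 / k 1 1) = a)
    (φ : FlagSpace p F) : B.openVal p χ₁ χ₂ l φ k =
      borelChar p χ₁ χ₂ (k.det * d⁻¹) d * ((normalizedAbs p F a : ℂ)⁻¹ *
        l (flagRep p F (diagGL a 1) (flagRep p F (lowerGL (B.re (k 1 0 / k 1 1))) φ))) := by
  have h0 : k 1 0 = d * (algebraMap F E (B.re (k 1 0 / k 1 1)) + algebraMap F E a * B.τ) := by
    rw [← ha, ← B.eq_re_im, h1, mul_div_cancel₀ _ d.ne_zero]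
  have e : (normalizedAbs p F a : ℂ)⁻¹ = borelChar p χ₁ χ₂ (incl F E a)⁻¹ 1 := by
    rw [← map_inv, borelChar_incl_left p χ₁ χ₂ h2, hχ₁, Units.val_one, one_mul, ← Complex.ofReal_inv]
    congr 1
    refine inv_eq_of_mul_eq_one_right ?_
    rw [← normalizedAbs_mul, Units.mul_inv]
    simp [normalizedAbs]
  rw [openVal_eq p hl (RowRel.of_coord h0 h1), map_mul, diagGL_det, lowerGL_det, mul_one, mul_one,
    map_mul (flagRep p F), Module.End.mul_apply, e, ← mul_assoc, ← Units.val_mul, ← borelChar_mul,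
    mul_one, mul_right_comm]

theorem tendsto_div_lowerGL (z₀ : E) :
    Tendsto (fun k : GL (Fin 2) E => k 1 0 / k 1 1) (𝓝 (lowerGL z₀)) (𝓝 z₀) := by
  have h0 := (continuous_gl_apply (K := E) 1 0).tendsto (lowerGL z₀)
  have h1 := (continuous_gl_apply (K := E) 1 1).tendsto (lowerGL z₀)
  have := h0.div h1 (by rw [lowerGL_11]; exact one_ne_zero)
  rwa [lowerGL_10, lowerGL_11, div_one] at this

theorem eventually_ne_zero_lowerGL (z₀ : E) : ∀ᶠ k in 𝓝 (lowerGL z₀), k 1 1 ≠ 0 := by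
  have h1 := (continuous_gl_apply (K := E) 1 1).tendsto (lowerGL z₀)
  rw [lowerGL_11] at h1
  exact h1.eventually_ne one_ne_zero

include p in
theorem tendsto_re (z₀ : E) :
    Tendsto (fun k : GL (Fin 2) E => B.re (k 1 0 / k 1 1)) (𝓝 (lowerGL z₀)) (𝓝 (B.re z₀)) :=
  ((B.continuous_repr p 1).tendsto z₀).comp (tendsto_div_lowerGL z₀)

include p in
theorem tendsto_im (z₀ : E) :
    Tendsto (fun k : GL (Fin 2) E => B.im (k 1 0 / k 1 1)) (𝓝 (lowerGL z₀)) (𝓝 (B.im z₀)) :=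
  ((B.continuous_repr p 0).tendsto z₀).comp (tendsto_div_lowerGL z₀)

theorem eventually_norm_le {X K : Type*} [NormedField K] {f : Filter X} {u : X → K}
    (hu : Tendsto u f (𝓝 0)) {ε : ℝ} (hε : 0 < ε) : ∀ᶠ x in f, ‖u x‖ ≤ ε := by
  filter_upwards [Metric.tendsto_nhds.1 hu ε hε] with x hx
  rw [← dist_zero_right]
  exact hx.le

/-- Near γ the coordinate x is close to 0 and a is close to 1; both fix φ, and the constant is l φ.
-/
theorem eventually_openVal_γ (hl : B.Equivariant p (torusChar p F χ₁ χ₂) l)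
    (h2 : Module.finrank F E = 2) (h₁ : IsSmoothChar χ₁) (h₂ : IsSmoothChar χ₂)
    (hχ₁ : ∀ x : Fˣ, χ₁ (incl F E x) = 1) (φ : FlagSpace p F) :
    ∃ C, ∀ᶠ k in 𝓝 B.γ, B.IsOpenPt k → B.openVal p χ₁ χ₂ l φ k = C := by
  obtain ⟨δ, hδ, hφ⟩ := exists_flagRep_lowerGL_eq p φ
  have hre := tendsto_re p (B := B) B.τ
  have him := tendsto_im p (B := B) B.τ
  have e1 := B.re_add 0 1
  have e2 := B.im_add 0 1
  rw [map_zero, map_one, one_mul, zero_add] at e1 e2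
  rw [e1] at hre
  rw [e2] at him
  have hd : Tendsto (fun a : Fˣ => diagGL a 1) (𝓝 1) (𝓝 1) := by
    refine tendsto_gl fun i j => ?_
    fin_cases i <;> fin_cases j
    · exact Units.continuous_val.tendsto 1
    · exact tendsto_const_nhds
    · exact tendsto_const_nhds
    · exact tendsto_const_nhds
  have habs : ∀ᶠ a : Fˣ in 𝓝 1, normalizedAbs p F a = 1 := by
    filter_upwards [(isSmoothChar_absPow p (K := F) 1).eventually_eq_one] with a ha
    have := congrArg Units.val ha
    rw [absPow_apply, Real.rpow_one, Units.val_one] at this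
    exact_mod_cast this
  refine ⟨l φ, ?_⟩
  filter_upwards [eventually_ne_zero_lowerGL B.τ, eventually_borelChar_row p h₁ h₂ B.τ,
    eventually_norm_le hre hδ, eventually_forall_unit him ((hd.eventually (flag_eventually p φ)).and habs)]
    with k k1 hb hr hi Hk
  have hne := Hk.im_ne_zero k1
  obtain ⟨h3, h4⟩ := hi (Units.mk0 _ hne) rfl
  rw [openVal_coord p hl h2 hχ₁ (d := Units.mk0 _ k1) (a := Units.mk0 _ hne) rfl rfl, hb _ rfl,
    hφ _ hr, h3, h4]
  simp

/-- Here a tends to 0, and the factor |a|⁻¹ is cancelled by the dilation law for functionals that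
kill the constants. This is where the extension across the closed orbit is won. -/
theorem eventually_openVal_one (hl : B.Equivariant p (torusChar p F χ₁ χ₂) l)
    (h2 : Module.finrank F E = 2) (h₁ : IsSmoothChar χ₁) (h₂ : IsSmoothChar χ₂)
    (hχ₁ : ∀ x : Fˣ, χ₁ (incl F E x) = 1)
    (hconst : l ⟨1, one_mem_principalSeriesSpace p F⟩ = 0) (φ : FlagSpace p F) :
    ∃ C, ∀ᶠ k in 𝓝 (1 : GL (Fin 2) E), B.IsOpenPt k → B.openVal p χ₁ χ₂ l φ k = C := by
  obtain ⟨δ, hδ, hφ⟩ := exists_flagRep_lowerGL_eq p φ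
  obtain ⟨C, ε, hε, hC⟩ := B.exists_dilation_eq p (isSmoothChar_torusChar p B h₁ h₂) hl hconst φ
  have hre := tendsto_re p (B := B) 0
  have him := tendsto_im p (B := B) 0
  have e1 := B.re_add 0 0
  have e2 := B.im_add 0 0
  rw [map_zero, zero_mul, zero_add] at e1 e2
  rw [e1] at hre
  rw [e2] at him
  rw [← lowerGL_zero]
  refine ⟨C, ?_⟩
  filter_upwards [eventually_ne_zero_lowerGL (0 : E), eventually_borelChar_row p h₁ h₂ 0,
    eventually_norm_le hre hδ, eventually_norm_le him hε] with k k1 hb hr hi Hk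
  have hne := Hk.im_ne_zero k1
  have hn : (normalizedAbs p F (B.im (k 1 0 / k 1 1)) : ℂ) ≠ 0 := by
    exact_mod_cast (normalizedAbs_pos p (Units.mk0 _ hne)).ne'
  rw [openVal_coord p hl h2 hχ₁ (d := Units.mk0 _ k1) (a := Units.mk0 _ hne) rfl rfl, hb _ rfl,
    hφ _ hr, hC (Units.mk0 _ hne) hi, Units.val_one, one_mul, Units.val_mk0,
    inv_mul_cancel_left₀ hn]

/-- Upper triangular matrices on the left scale the values and `GL₂(F)` on the right changes φ, so
one point per orbit suffices. The hypothesis at `h₀` is for all φ because φ changes. -/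
theorem eventually_openVal_of_row (hl : B.Equivariant p (torusChar p F χ₁ χ₂) l)
    {h h₀ : GL (Fin 2) E} {d : Eˣ} {g : GL (Fin 2) F}
    (h0 : h 1 0 = d * (h₀ * inclGL F E g) 1 0) (h1 : h 1 1 = d * (h₀ * inclGL F E g) 1 1)
    (H : ∀ φ, ∃ C, ∀ᶠ k in 𝓝 h₀, B.IsOpenPt k → B.openVal p χ₁ χ₂ l φ k = C) (φ : FlagSpace p F) :
    ∃ C, ∀ᶠ k in 𝓝 h, B.IsOpenPt k → B.openVal p χ₁ χ₂ l φ k = C := by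
  obtain ⟨b, hb, b10, -, b11⟩ := exists_upper_mul h0 h1
  obtain ⟨C, hC⟩ := H (flagRep p F g φ)
  have ht : Tendsto (fun k => b⁻¹ * k * (inclGL F E g)⁻¹) (𝓝 h) (𝓝 h₀) := by
    have hc : Continuous fun k : GL (Fin 2) E => b⁻¹ * k * (inclGL F E g)⁻¹ := by fun_prop
    have := hc.tendsto h
    rwa [show b⁻¹ * h * (inclGL F E g)⁻¹ = h₀ by rw [hb]; group] at this
  refine ⟨borelChar p χ₁ χ₂ (b.det * d⁻¹) d * C, ?_⟩
  filter_upwards [ht.eventually hC] with k hk Hk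
  set k' := b⁻¹ * k * (inclGL F E g)⁻¹ with hk'
  have hkb : k = b * k' * inclGL F E g := by rw [hk']; group
  have hkb' : b * k' = k * inclGL F E g⁻¹ := by rw [hk', map_inv]; group
  have Hb : B.IsOpenPt (b * k') := by
    rw [hkb']
    exact Hk.mul_inclGL _
  have r0 : (b * k') 1 0 = d * k' 1 0 := by rw [gl_mul_apply, b10, b11]; ring
  have r1 : (b * k') 1 1 = d * k' 1 1 := by rw [gl_mul_apply, b10, b11]; ring
  have Hk' : B.IsOpenPt k' := by
    refine Hb.of_row (e := d⁻¹) ?_ ?_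
    · rw [r0, Units.inv_mul_cancel_left]
    · rw [r1, Units.inv_mul_cancel_left]
  rw [hkb, openVal_mul_inclGL p hl Hb, openVal_of_row p hl Hk' r0 r1, hk Hk', map_mul,
    mul_inv_cancel_right]

/-- The function on the open orbit extends to a locally constant function. -/
theorem exists_eventually_openVal (hl : B.Equivariant p (torusChar p F χ₁ χ₂) l)
    (h2 : Module.finrank F E = 2) (h₁ : IsSmoothChar χ₁) (h₂ : IsSmoothChar χ₂)
    (hχ₁ : ∀ x : Fˣ, χ₁ (incl F E x) = 1)
    (hconst : l ⟨1, one_mem_principalSeriesSpace p F⟩ = 0) (φ : FlagSpace p F) (h : GL (Fin 2) E) :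
    ∃ C, ∀ᶠ k in 𝓝 h, B.IsOpenPt k → B.openVal p χ₁ χ₂ l φ k = C := by
  rcases B.orbits h with ⟨d, a, x, h0, h1⟩ | ⟨d, g, h0, h1⟩
  · refine eventually_openVal_of_row p hl (d := d) (g := diagGL a 1 * lowerGL x) (h₀ := B.γ) ?_ ?_
      (eventually_openVal_γ p hl h2 h₁ h₂ hχ₁) φ
    · rw [γ_diag_lower_10, h0]
    · rw [γ_diag_lower_11, h1, mul_one]
  · exact eventually_openVal_of_row p hl (d := d) (g := g) (h₀ := 1) (by rwa [one_mul])
      (by rwa [one_mul]) (eventually_openVal_one p hl h2 h₁ h₂ hχ₁ hconst) φ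

include p in
/-- The open orbit is dense. -/
theorem exists_isOpenPt {h : GL (Fin 2) E} {P : GL (Fin 2) E → Prop} (hP : ∀ᶠ k in 𝓝 h, P k) :
    ∃ k, B.IsOpenPt k ∧ P k := by
  rcases B.orbits h with ⟨d, a, x, h0, h1⟩ | ⟨d, g, h0, h1⟩
  · exact ⟨h, ⟨_, _, RowRel.of_coord h0 h1⟩, hP.self_of_nhds⟩
  obtain ⟨b, hb, b10, -, b11⟩ := exists_upper_mul h0 h1
  -- Near b g, a point of the closed orbit, the points b · `lowerGL (aτ)` · g with a ≠ 0 lie in the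
  -- open orbit.
  have ht : Tendsto (fun a : F => b * lowerGL (algebraMap F E a * B.τ) * inclGL F E g) (𝓝 0)
      (𝓝 h) := by
    have hc : Continuous fun a : F => b * lowerGL (algebraMap F E a * B.τ) * inclGL F E g :=
      (continuous_const.mul (continuous_lowerGL.comp
        ((continuous_algebraMap F E).mul continuous_const))).mul continuous_const
    have := hc.tendsto 0
    rwa [map_zero, zero_mul, lowerGL_zero, mul_one, ← hb] at this
  obtain ⟨ε, hε, H⟩ := Metric.eventually_nhds_iff.1 (ht.eventually hP)
  obtain ⟨a, ha⟩ := exists_unit_norm_le p (F := F) (half_pos hε)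
  refine ⟨_, ?_, H (y := a) (by rw [dist_zero_right]; linarith)⟩
  refine IsOpenPt.mul_inclGL (IsOpenPt.of_row (e := d) (h := lowerGL (algebraMap F E a * B.τ))
    ⟨1, _, RowRel.of_coord (a := a) (x := 0) ?_ ?_⟩ ?_ ?_) g
  · simp
  · simp
  · rw [gl_mul_apply, b10, b11]; ring
  · rw [gl_mul_apply, b10, b11]; ring

end LocallyConstant

end QuadraticBasis

/-! ### The extension as an intertwiner. -/

namespace QuadraticBasis

open Filter Topology

variable (p : ℕ) [Fact p.Prime] {F E : Type*} [NormedField F] [NormedField E]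
  [NormedAlgebra ℚ_[p] F] [FiniteDimensional ℚ_[p] F] [NormedAlgebra ℚ_[p] E]
  [FiniteDimensional ℚ_[p] E] [NormedAlgebra F E] [IsScalarTower ℚ_[p] F E]
  (B : QuadraticBasis F E)

section Extension

variable {χ₁ χ₂ : Eˣ →* ℂˣ} {l : FlagSpace p F →ₗ[ℂ] ℂ}

variable (χ₁ χ₂ l) in
open Classical in
/-- The locally constant extension of `openVal` to `GL₂(E)`. -/
noncomputable def extVal (φ : FlagSpace p F) (h : GL (Fin 2) E) : ℂ :=
  if H : ∃ C, ∀ᶠ k in 𝓝 h, B.IsOpenPt k → B.openVal p χ₁ χ₂ l φ k = C then H.choose else 0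

variable {B}

/-- Density of the open orbit makes the limiting constant unique. Identities for `extVal` can
therefore be checked at nearby open points. -/
theorem extVal_eq {φ : FlagSpace p F} {h : GL (Fin 2) E} {C : ℂ}
    (H : ∀ᶠ k in 𝓝 h, B.IsOpenPt k → B.openVal p χ₁ χ₂ l φ k = C) :
    B.extVal p χ₁ χ₂ l φ h = C := by
  have H' : ∃ C, ∀ᶠ k in 𝓝 h, B.IsOpenPt k → B.openVal p χ₁ χ₂ l φ k = C := ⟨C, H⟩
  rw [extVal, dif_pos H']
  obtain ⟨k, hk, h1, h2⟩ := exists_isOpenPt p (B := B) (H.and H'.choose_spec)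
  rw [← h1 hk, ← h2 hk]

variable (hl : B.Equivariant p (torusChar p F χ₁ χ₂) l)
  (H : ∀ (φ : FlagSpace p F) (h : GL (Fin 2) E),
    ∃ C, ∀ᶠ k in 𝓝 h, B.IsOpenPt k → B.openVal p χ₁ χ₂ l φ k = C)

include H

theorem eventually_openVal_eq_extVal (φ : FlagSpace p F) (h : GL (Fin 2) E) :
    ∀ᶠ k in 𝓝 h, B.IsOpenPt k → B.openVal p χ₁ χ₂ l φ k = B.extVal p χ₁ χ₂ l φ h := by
  obtain ⟨C, hC⟩ := H φ h
  rwa [extVal_eq p hC]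

theorem extVal_of_isOpenPt (φ : FlagSpace p F) {h : GL (Fin 2) E} (hh : B.IsOpenPt h) :
    B.extVal p χ₁ χ₂ l φ h = B.openVal p χ₁ χ₂ l φ h :=
  ((eventually_openVal_eq_extVal p H φ h).self_of_nhds hh).symm

theorem eventually_extVal_eq (φ : FlagSpace p F) (h : GL (Fin 2) E) :
    ∀ᶠ k in 𝓝 h, B.extVal p χ₁ χ₂ l φ k = B.extVal p χ₁ χ₂ l φ h := by
  filter_upwards [(eventually_openVal_eq_extVal p H φ h).eventually_nhds] with k hk
  exact extVal_eq p hk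

include hl

theorem extVal_upper_mul (φ : FlagSpace p F) {b h : GL (Fin 2) E} {d : Eˣ} (b10 : b 1 0 = 0)
    (b11 : b 1 1 = d) : B.extVal p χ₁ χ₂ l φ (b * h) =
      borelChar p χ₁ χ₂ (b.det * d⁻¹) d * B.extVal p χ₁ χ₂ l φ h := by
  have ht : Tendsto (fun k => b * k) (𝓝 h) (𝓝 (b * h)) := (continuous_const_mul b).tendsto h
  obtain ⟨k, hk, h1, h2⟩ := exists_isOpenPt p (B := B)
    ((eventually_extVal_eq p H φ h).and (ht.eventually (eventually_extVal_eq p H φ (b * h))))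
  have r0 : (b * k) 1 0 = d * k 1 0 := by rw [gl_mul_apply, b10, b11]; ring
  have r1 : (b * k) 1 1 = d * k 1 1 := by rw [gl_mul_apply, b10, b11]; ring
  rw [← h1, ← h2, extVal_of_isOpenPt p H φ hk, extVal_of_isOpenPt p H φ (hk.of_row r0 r1),
    openVal_of_row p hl hk r0 r1, map_mul, mul_inv_cancel_right]

theorem extVal_mul_inclGL (φ : FlagSpace p F) (h : GL (Fin 2) E) (g : GL (Fin 2) F) :
    B.extVal p χ₁ χ₂ l φ (h * inclGL F E g) = B.extVal p χ₁ χ₂ l (flagRep p F g φ) h := by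
  have ht : Tendsto (fun k => k * inclGL F E g) (𝓝 h) (𝓝 (h * inclGL F E g)) :=
    (continuous_mul_const _).tendsto h
  obtain ⟨k, hk, h1, h2⟩ := exists_isOpenPt p (B := B)
    ((eventually_extVal_eq p H (flagRep p F g φ) h).and
      (ht.eventually (eventually_extVal_eq p H φ (h * inclGL F E g))))
  rw [← h1, ← h2, extVal_of_isOpenPt p H _ hk, extVal_of_isOpenPt p H φ (hk.mul_inclGL g),
    openVal_mul_inclGL p hl hk]

theorem extVal_add (φ ψ : FlagSpace p F) (h : GL (Fin 2) E) :
    B.extVal p χ₁ χ₂ l (φ + ψ) h = B.extVal p χ₁ χ₂ l φ h + B.extVal p χ₁ χ₂ l ψ h := by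
  refine extVal_eq p ?_
  filter_upwards [eventually_openVal_eq_extVal p H φ h, eventually_openVal_eq_extVal p H ψ h]
    with k h1 h2 hk
  rw [← h1 hk, ← h2 hk]
  obtain ⟨d, g, Hk⟩ := hk
  rw [openVal_eq p hl Hk, openVal_eq p hl Hk, openVal_eq p hl Hk, map_add, map_add, mul_add]

theorem extVal_smul (c : ℂ) (φ : FlagSpace p F) (h : GL (Fin 2) E) :
    B.extVal p χ₁ χ₂ l (c • φ) h = c * B.extVal p χ₁ χ₂ l φ h := by
  refine extVal_eq p ?_
  filter_upwards [eventually_openVal_eq_extVal p H φ h] with k h1 hk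
  rw [← h1 hk]
  obtain ⟨d, g, Hk⟩ := hk
  rw [openVal_eq p hl Hk, openVal_eq p hl Hk, map_smul, map_smul, smul_eq_mul, mul_left_comm]

theorem extVal_const (hconst : l ⟨1, one_mem_principalSeriesSpace p F⟩ = 0) (h : GL (Fin 2) E) :
    B.extVal p χ₁ χ₂ l ⟨1, one_mem_principalSeriesSpace p F⟩ h = 0 := by
  refine extVal_eq p (Eventually.of_forall fun k hk => ?_)
  obtain ⟨d, g, Hk⟩ := hk
  have hc : flagRep p F g ⟨1, one_mem_principalSeriesSpace p F⟩ =
    ⟨1, one_mem_principalSeriesSpace p F⟩ := rfl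
  rw [openVal_eq p hl Hk, hc, hconst, mul_zero]

/-- Local constancy becomes uniform by compactness: the matrices in `K` meet every point of the
projective line over `E`, and left multiplication by upper triangular matrices only scales the
values. -/
theorem extVal_smooth (φ : FlagSpace p F) :
    ∀ᶠ u in 𝓝 (1 : GL (Fin 2) E), ∀ h, B.extVal p χ₁ χ₂ l φ (h * u) = B.extVal p χ₁ χ₂ l φ h := by
  have := FiniteDimensional.proper ℚ_[p] E
  have hK : IsCompact (lowerGL '' Metric.closedBall (0 : E) 1) :=
    (isCompact_closedBall 0 1).image continuous_lowerGL
  set K : Set (GL (Fin 2) E) := lowerGL '' Metric.closedBall (0 : E) 1 ∪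
    (fun k => k * swapGL E) '' (lowerGL '' Metric.closedBall (0 : E) 1)
  have hKc : IsCompact K := hK.union (hK.image (continuous_mul_const _))
  have hev : ∀ᶠ u in 𝓝 (1 : GL (Fin 2) E), ∀ k ∈ K,
      B.extVal p χ₁ χ₂ l φ (k * u) = B.extVal p χ₁ χ₂ l φ k := by
    refine hKc.eventually_forall_of_forall_eventually fun k _ => ?_
    have t1 : Tendsto (fun z : GL (Fin 2) E × GL (Fin 2) E => z.2 * z.1) (𝓝 (1, k)) (𝓝 k) := by
      have hc : Continuous fun z : GL (Fin 2) E × GL (Fin 2) E => z.2 * z.1 := by fun_prop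
      simpa using hc.tendsto (1, k)
    have t2 : Tendsto (fun z : GL (Fin 2) E × GL (Fin 2) E => z.2) (𝓝 (1, k)) (𝓝 k) :=
      continuous_snd.tendsto (1, k)
    filter_upwards [t1.eventually (eventually_extVal_eq p H φ k),
      t2.eventually (eventually_extVal_eq p H φ k)] with z h1 h2
    exact h1.trans h2.symm
  filter_upwards [hev] with u hu h
  obtain ⟨k, hk, d, h0, h1⟩ : ∃ k ∈ K, ∃ d : Eˣ, h 1 0 = d * k 1 0 ∧ h 1 1 = d * k 1 1 := by
    rcases le_or_gt ‖h 1 0‖ ‖h 1 1‖ with hle | hlt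
    · have hne : h 1 1 ≠ 0 := fun h' => gl_row_ne_zero h h' (by
        rw [h', norm_zero] at hle
        exact norm_le_zero_iff.1 hle)
      refine ⟨lowerGL (h 1 0 / h 1 1), Or.inl ⟨_, ?_, rfl⟩, Units.mk0 _ hne, ?_, ?_⟩
      · rw [mem_closedBall_zero_iff, norm_div]
        exact div_le_one_of_le₀ hle (norm_nonneg _)
      · rw [lowerGL_10, Units.val_mk0, mul_div_cancel₀ _ hne]
      · rw [lowerGL_11, Units.val_mk0, mul_one]
    · have hne : h 1 0 ≠ 0 := norm_pos_iff.1 ((norm_nonneg _).trans_lt hlt)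
      refine ⟨lowerGL (h 1 1 / h 1 0) * swapGL E, Or.inr ⟨_, ⟨_, ?_, rfl⟩, rfl⟩,
        Units.mk0 _ hne, ?_, ?_⟩
      · rw [mem_closedBall_zero_iff, norm_div]
        exact div_le_one_of_le₀ hlt.le (norm_nonneg _)
      · simp [gl_mul_apply]
      · simp [gl_mul_apply, mul_div_cancel₀ _ hne]
  obtain ⟨b, rfl, b10, -, b11⟩ := exists_upper_mul h0 h1
  rw [mul_assoc, extVal_upper_mul p hl H φ b10 b11, extVal_upper_mul p hl H φ b10 b11, hu k hk]

/-- The intertwiner attached to an equivariant functional. -/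
noncomputable def extMap : FlagSpace p F →ₗ[ℂ] principalSeriesSpace p E χ₁ χ₂ where
  toFun φ := ⟨B.extVal p χ₁ χ₂ l φ, (mem_principalSeriesSpace p).2
    ⟨fun b g a d b10 b00 b11 => by
      have hdet : b.det = a * d := by
        ext
        rw [gl_det_eq, b10, b00, b11, mul_zero, sub_zero, Units.val_mul]
      rw [extVal_upper_mul p hl H φ b10 b11, hdet, mul_inv_cancel_right],
    extVal_smooth p hl H φ⟩⟩
  map_add' φ ψ := Subtype.ext (funext (extVal_add p hl H φ ψ))
  map_smul' c φ := Subtype.ext (funext (extVal_smul p hl H c φ))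

omit H in
/-- Every equivariant functional that kills the constants is attached to an intertwiner. -/
theorem exists_evalγ_eq (h2 : Module.finrank F E = 2) (h₁ : IsSmoothChar χ₁)
    (h₂ : IsSmoothChar χ₂) (hχ₁ : ∀ x : Fˣ, χ₁ (incl F E x) = 1)
    (hconst : l ⟨1, one_mem_principalSeriesSpace p F⟩ = 0) :
    ∃ Φ : FlagSpace p F →ₗ[ℂ] principalSeriesSpace p E χ₁ χ₂,
      (∀ (g : GL (Fin 2) F) (φ : FlagSpace p F) (h : GL (Fin 2) E),
        (Φ (flagRep p F g φ)).1 h = (Φ φ).1 (h * inclGL F E g)) ∧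
      Φ ⟨1, one_mem_principalSeriesSpace p F⟩ = 0 ∧ B.evalγ p Φ = l := by
  have H := exists_eventually_openVal p hl h2 h₁ h₂ hχ₁ hconst
  refine ⟨extMap p hl H, fun g φ h => (extVal_mul_inclGL p hl H φ h g).symm,
    Subtype.ext (funext (extVal_const p hl H hconst)), LinearMap.ext fun φ => ?_⟩
  rw [evalγ_apply]
  change B.extVal p χ₁ χ₂ l φ B.γ = _
  rw [extVal_of_isOpenPt p H φ ⟨_, _, γ_rowRel⟩, openVal_eq p hl γ_rowRel, γ, lowerGL_det]
  simp [borelChar]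

end Extension

end QuadraticBasis

/-! ### Intertwiners from the Steinberg representation. -/

namespace QuadraticBasis

variable (p : ℕ) [Fact p.Prime] {F E : Type*} [NormedField F] [NormedField E]
  [NormedAlgebra ℚ_[p] F] [FiniteDimensional ℚ_[p] F] [NormedAlgebra ℚ_[p] E]
  [FiniteDimensional ℚ_[p] E] [NormedAlgebra F E] [IsScalarTower ℚ_[p] F E]
  (B : QuadraticBasis F E) {χ₁ χ₂ : Eˣ →* ℂˣ}

section Steinberg

/-- An intertwiner from the Steinberg representation, as a map on `FlagSpace`. -/
noncomputable def ofSteinberg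
    (φ : (steinberg p F).IntertwiningMap (restrictGL F (principalSeries p E χ₁ χ₂))) :
    FlagSpace p F →ₗ[ℂ] principalSeriesSpace p E χ₁ χ₂ :=
  φ.toLinearMap ∘ₗ (constantFunctions p F).mkQ

theorem ofSteinberg_flagRep
    (φ : (steinberg p F).IntertwiningMap (restrictGL F (principalSeries p E χ₁ χ₂)))
    (g : GL (Fin 2) F) (f : FlagSpace p F) (h : GL (Fin 2) E) :
    (ofSteinberg p φ (flagRep p F g f)).1 h = (ofSteinberg p φ f).1 (h * inclGL F E g) := by
  have := Representation.IntertwiningMap.isIntertwining _ _ φ g ((constantFunctions p F).mkQ f)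
  exact congrArg (fun v => v.1 h) this

theorem ofSteinberg_const
    (φ : (steinberg p F).IntertwiningMap (restrictGL F (principalSeries p E χ₁ χ₂))) :
    ofSteinberg p φ ⟨1, one_mem_principalSeriesSpace p F⟩ = 0 := by
  have : (constantFunctions p F).mkQ ⟨1, one_mem_principalSeriesSpace p F⟩ = 0 :=
    (Submodule.Quotient.mk_eq_zero _).2 (Submodule.subset_span rfl)
  rw [ofSteinberg, LinearMap.comp_apply, this, map_zero]

theorem ofSteinberg_injective
    {φ ψ : (steinberg p F).IntertwiningMap (restrictGL F (principalSeries p E χ₁ χ₂))}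
    (h : ofSteinberg p φ = ofSteinberg p ψ) : φ = ψ :=
  Representation.IntertwiningMap.ext (Submodule.linearMap_qext _ h)

theorem exists_ofSteinberg_eq {Φ : FlagSpace p F →ₗ[ℂ] principalSeriesSpace p E χ₁ χ₂}
    (hΦ : ∀ (g : GL (Fin 2) F) (φ : FlagSpace p F) (h : GL (Fin 2) E),
      (Φ (flagRep p F g φ)).1 h = (Φ φ).1 (h * inclGL F E g))
    (hconst : Φ ⟨1, one_mem_principalSeriesSpace p F⟩ = 0) :
    ∃ φ : (steinberg p F).IntertwiningMap (restrictGL F (principalSeries p E χ₁ χ₂)),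
      ofSteinberg p φ = Φ := by
  have hle : constantFunctions p F ≤ LinearMap.ker Φ :=
    Submodule.span_le.2 (by rintro _ rfl; exact hconst)
  refine ⟨⟨(constantFunctions p F).liftQ Φ hle, fun g => ?_⟩, ?_⟩
  · refine Submodule.linearMap_qext _ (LinearMap.ext fun f => Subtype.ext (funext fun h => ?_))
    exact hΦ g f h
  · exact Submodule.liftQ_mkQ _ _ _

include B in
/-- Vanishing of the intertwiners. -/
theorem intertwiningMap_eq_zero (h2 : Module.finrank F E = 2) (h₁ : IsSmoothChar χ₁)
    (h₂ : IsSmoothChar χ₂)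
    (hne : ¬ (χ₁ ≠ χ₂ ∧ restrictChar F χ₁ = 1 ∧ restrictChar F χ₂ = 1))
    (φ : (steinberg p F).IntertwiningMap (restrictGL F (principalSeries p E χ₁ χ₂))) : φ = 0 := by
  have hΦ := ofSteinberg_flagRep p φ
  have hl := B.equivariant_evalγ p hΦ
  suffices h : B.evalγ p (ofSteinberg p φ) = 0 from
    ofSteinberg_injective p ((B.eq_zero_of_evalγ p hΦ h).trans (LinearMap.zero_comp _).symm)
  by_cases hθ : ∀ x : Fˣ, torusChar p F χ₁ χ₂ (incl F E x) = 1
  swap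
  · obtain ⟨x, hx⟩ := not_forall.1 hθ
    exact hl.eq_zero p B hx
  by_cases hF : ∀ x : Fˣ, χ₂ (incl F E x) = 1
  swap
  · exact B.evalγ_eq_zero p hΦ h2 h₁ h₂ (ofSteinberg_const p φ) (not_forall.1 hF)
  have hF₁ : ∀ x : Fˣ, χ₁ (incl F E x) = 1 := fun x => by
    rw [← hθ x, torusChar_incl p χ₁ χ₂ x h2, hF, mul_one]
  have heq : χ₁ = χ₂ := by
    by_contra h
    exact hne ⟨h, MonoidHom.ext hF₁, MonoidHom.ext hF⟩
  have hs := isSmoothChar_torusChar p B h₁ h₂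
  -- The only case left is χ₁ = χ₂, trivial on `Fˣ`. There θ = 1 and `charFun` is the constant 1,
  -- which the intertwiner kills; but an equivariant functional is determined by its value at
  -- `charFun`.
  have hc : B.charFun p hs hθ = ⟨1, one_mem_principalSeriesSpace p F⟩ := by
    refine Subtype.ext (funext fun g => ?_)
    rw [charFun_apply, torusChar_eq p χ₁ χ₂ h2, hF₁, heq, one_mul, inv_mul_cancel]
    rfl
  ext f
  obtain ⟨c, hc'⟩ := B.exists_equivariant_eq p hs hθ f
  rw [hc' _ hl, hc, evalγ_apply, ofSteinberg_const]
  exact mul_zero c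

include B in
/-- The multiplicity one case. -/
theorem finrank_intertwiningMap (h2 : Module.finrank F E = 2) (h₁ : IsSmoothChar χ₁)
    (h₂ : IsSmoothChar χ₂) (hne : χ₁ ≠ χ₂) (hF₁ : restrictChar F χ₁ = 1)
    (hF₂ : restrictChar F χ₂ = 1) :
    Module.finrank ℂ
      ((steinberg p F).IntertwiningMap (restrictGL F (principalSeries p E χ₁ χ₂))) = 1 := by
  replace hF₁ : ∀ x : Fˣ, χ₁ (incl F E x) = 1 := DFunLike.congr_fun hF₁
  replace hF₂ : ∀ x : Fˣ, χ₂ (incl F E x) = 1 := DFunLike.congr_fun hF₂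
  have hθ : ∀ x : Fˣ, torusChar p F χ₁ χ₂ (incl F E x) = 1 := fun x => by
    rw [torusChar_incl p χ₁ χ₂ x h2, hF₁, hF₂, mul_one]
  have hs := isSmoothChar_torusChar p B h₁ h₂
  obtain ⟨l, hl, hl0⟩ := B.exists_equivariant p hs hθ
  obtain ⟨z, hz⟩ := DFunLike.ne_iff.1 hne
  -- The torus fixes the constants and acts on l by θ = χ₂/χ₁, which is not 1 at z.
  have hconst : l ⟨1, one_mem_principalSeriesSpace p F⟩ = 0 := by
    have h := hl z ⟨1, one_mem_principalSeriesSpace p F⟩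
    have hc : flagRep p F (B.torus z) ⟨1, one_mem_principalSeriesSpace p F⟩ =
      ⟨1, one_mem_principalSeriesSpace p F⟩ := rfl
    rw [hc, torusChar_eq p χ₁ χ₂ h2, hF₁, one_mul] at h
    have h3 : (((χ₁ z)⁻¹ * χ₂ z : ℂˣ) - 1 : ℂ) * l ⟨1, one_mem_principalSeriesSpace p F⟩ = 0 := by
      rw [sub_mul, ← h, one_mul, sub_self]
    refine (mul_eq_zero.1 h3).resolve_left fun h4 => hz ?_
    have h5 : (χ₁ z)⁻¹ * χ₂ z = 1 := Units.ext (sub_eq_zero.1 h4)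
    exact inv_mul_eq_one.1 h5
  obtain ⟨Φ, hΦ, hΦc, hev⟩ := exists_evalγ_eq p hl h2 h₁ h₂ hF₁ hconst
  obtain ⟨φ₀, rfl⟩ := exists_ofSteinberg_eq p hΦ hΦc
  have hφ₀ : φ₀ ≠ 0 := by
    rintro rfl
    refine hl0 ?_
    rw [← hev]
    rfl
  refine (finrank_eq_one_iff_of_nonzero' φ₀ hφ₀).2 fun φ => ?_
  set c := B.charFun p hs hθ
  -- With this ratio, the functional attached to `r • φ₀ - φ` vanishes at `charFun`, hence
  -- everywhere.
  set r := B.evalγ p (ofSteinberg p φ) c / l c with hr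
  refine ⟨r, ?_⟩
  rw [← sub_eq_zero]
  have hΨ := ofSteinberg_flagRep p (r • φ₀ - φ)
  refine ofSteinberg_injective p
    ((B.eq_zero_of_evalγ p hΨ ?_).trans (LinearMap.zero_comp _).symm)
  ext f
  obtain ⟨t, ht⟩ := B.exists_equivariant_eq p hs hθ f
  rw [ht _ (B.equivariant_evalγ p hΨ)]
  have : B.evalγ p (ofSteinberg p (r • φ₀ - φ)) c = r * l c - B.evalγ p (ofSteinberg p φ) c := by
    rw [← hev]
    rfl
  rw [this, hr, div_mul_cancel₀ _ hl0, sub_self, mul_zero, LinearMap.zero_apply]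

end Steinberg

end QuadraticBasis

theorem mainTheorem11 (p : ℕ) [Fact p.Prime] (F E : Type*) [NormedField F] [NormedField E]
    [NormedAlgebra ℚ_[p] F] [FiniteDimensional ℚ_[p] F]
    [NormedAlgebra ℚ_[p] E] [NormedAlgebra F E] [IsScalarTower ℚ_[p] F E]
    (hEF : Module.finrank F E = 2)
    (χ₁ χ₂ : Eˣ →* ℂˣ) (hχ₁ : IsSmoothChar χ₁) (hχ₂ : IsSmoothChar χ₂)
    (hirr : (principalSeries p E χ₁ χ₂).IsIrreducible) :
    (Module.finrank ℂ
        ((steinberg p F).IntertwiningMap (restrictGL F (principalSeries p E χ₁ χ₂))) = 1 ↔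
      χ₁ ≠ χ₂ ∧ restrictChar F χ₁ = 1 ∧ restrictChar F χ₂ = 1) ∧
    (¬ (χ₁ ≠ χ₂ ∧ restrictChar F χ₁ = 1 ∧ restrictChar F χ₂ = 1) →
      ∀ φ : (steinberg p F).IntertwiningMap (restrictGL F (principalSeries p E χ₁ χ₂)), φ = 0) := by
  have : FiniteDimensional F E := FiniteDimensional.of_finrank_pos (by omega)
  have : FiniteDimensional ℚ_[p] E := Module.Finite.trans F E
  have : CharZero F := charZero_of_injective_algebraMap (algebraMap ℚ_[p] F).injective
  obtain ⟨B⟩ := QuadraticBasis.exists_of_finrank hEF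
  have hzero := B.intertwiningMap_eq_zero p hEF hχ₁ hχ₂
  refine ⟨⟨fun h => ?_, fun h => B.finrank_intertwiningMap p hEF hχ₁ hχ₂ h.1 h.2.1 h.2.2⟩, hzero⟩
  by_contra hne
  have : Subsingleton
      ((steinberg p F).IntertwiningMap (restrictGL F (principalSeries p E χ₁ χ₂))) :=
    ⟨fun φ ψ => (hzero hne φ).trans (hzero hne ψ).symm⟩
  rw [Module.finrank_zero_of_subsingleton] at h
  exact zero_ne_one h
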